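/- **Theorem 1.** Let $d,n_1,n_2\ge 1$, $T>0$, and let $\Omega\subset\mathbb R^d$ be open with $\|x\|_2\le 1$ for all $x=(x_0,x_1,\dots,x_d)\in[0,T]\times\overline\Omega\subset\mathbb R^{d+1}$. Let $f$ on $(0,T)\times\Omega$ and $g$ on $\{0\}\times\Omega\,\cup\,[0,T]\times\partial\Omega$ be continuous with $|f|,|g|\le M$. Let $x_1,\dots,x_{n_1}\in(0,T)\times\Omega$ and $y_1,\dots,y_{n_2}\in\{0\}\times\Omega\,\cup\,[0,T]\times\partial\Omega$ be samples no two of which are parallel (any two of the $n_1+n_2$ samples with different indices are linearly independent). Let $\sigma:\mathbb R\to\mathbb R$ be real-analytic and not a polynomial, with $|\sigma'''|\le c$ and $|\sigma^{(k)}(z)-\sigma^{(k)}(z')|\le c|z-z'|$ for all $z,z'\in\mathbb R$ and $k\in\{0,1,2,3\}$, and $|\sigma(0)|\le S$. For $w=(w_1,\dots,w_m)$ with $w_r\in\mathbb R^{d+1}$ and $a\in\{-1,1\}^m$ let $u(x;w)=\frac1{\sqrt m}\sum_{r=1}^m a_r\,\sigma(w_r^{T}x)$, and put $$s_p(w)=\tfrac1{\sqrt{n_1}}\Big(\tfrac{\partial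 u}{\partial x_0}-\sum_{i=1}^d\tfrac{\partial^2u}{\partial x_i^2}-f\Big)(x_p),\qquad h_j(w)=\tfrac1{\sqrt{n_2}}\,(u-g)(y_j),\qquad L(w)=\tfrac12\big(\|s(w)\|_2^2+\|h(w)\|_2^2\big).$$ Initialize with independent $w_r(0)\sim\mathcal N(0,I_{d+1})$ and $a_r\sim\mathrm{Unif}\{-1,1\}$, $r=1,\dots,m$; keep $a$ fixed and train $w$ by implicit gradient descent with learning rate $\eta>0$: $$w(k+1)\in\operatorname*{arg\,min}_{w}\ \tfrac12\|w-w(k)\|_2^2+\eta L(w),\qquad\text{so that}\qquad w(k+1)=w(k)-\eta\nabla L(w(k+1)).$$ Let $G(0)$ be the $(n_1+n_2)\times(n_1+n_2)$ Gram matrix of the gradients with respect to $w$, at $w(0)$, of $s_1,\dots,s_{n_1},h_1,\dots,h_{n_2}$; let $G^\infty=\mathbb E\,G(0)$ (which does not depend on $m$) and $\lambda_0=\lambda_{\min}(G^\infty)$. Then $\lambda_0>0$. Moreover there is a constant $C>0$ depending only on $c$, $S$ and $M$ such that for all $\eta>0$, $\delta\in(0,1)$ and $m\ge2$ with $$m\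 \ge\ C\,\frac{d^8}{\lambda_0^2}\log\Big(\frac{n_1+n_2}{\delta}\Big)\max\Big\{\eta^4d^2\log\Big(\frac{n_1+n_2}{\delta}\Big),\ \frac1{\lambda_0^2}\Big(\log\frac m\delta\Big)^2,\ \frac{\eta^2}{\lambda_0^2}\Big(\log\frac m\delta\Big)^6\log\Big(\frac{n_1+n_2}{\delta}\Big)\Big\},$$ with probability at least $1-\delta$ over the random initialization, implicit gradient descent can be run for all iterations, and every sequence $(w(k))_{k\ge0}$ that it produces satisfies $$L(w(k))\le\Big(1+\frac{\eta\lambda_0}{2}\Big)^{-k}L(w(0))\qquad\text{for all }k\in\mathbb N .$$ -/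

import Mathlib

open MeasureTheory ProbabilityTheory
open scoped ENNReal

noncomputable section

/-- Space-time points `x = (x₀, x₁, …, x_d)`, with the Euclidean norm; `x₀` is the time variable. -/
abbrev SpaceTime (d : ℕ) : Type := EuclideanSpace ℝ (Fin (d + 1))

/-- The spatial part `(x₁, …, x_d)` of a space-time point. -/
def spacePart {d : ℕ} (x : SpaceTime d) : EuclideanSpace ℝ (Fin d) :=
  WithLp.toLp 2 (fun i : Fin d => x i.succ)

/-- The open space-time cylinder `(0,T) × Ω`. -/
def cylInterior {d : ℕ} (T : ℝ) (Ω : Set (EuclideanSpace ℝ (Fin d))) : Set (SpaceTime d) :=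
  {x | x 0 ∈ Set.Ioo 0 T ∧ spacePart x ∈ Ω}

/-- The initial and lateral boundary `{0} × Ω ∪ [0,T] × ∂Ω`. -/
def cylBoundary {d : ℕ} (T : ℝ) (Ω : Set (EuclideanSpace ℝ (Fin d))) : Set (SpaceTime d) :=
  {x | x 0 = 0 ∧ spacePart x ∈ Ω} ∪ {x | x 0 ∈ Set.Icc 0 T ∧ spacePart x ∈ frontier Ω}

/-- The closed cylinder `[0,T] × closure Ω`. -/
def cylClosed {d : ℕ} (T : ℝ) (Ω : Set (EuclideanSpace ℝ (Fin d))) : Set (SpaceTime d) :=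
  {x | x 0 ∈ Set.Icc 0 T ∧ spacePart x ∈ closure Ω}

/-- Hypotheses on the activation function, with the constant `c`. -/
structure ActivationAssumption (σ : ℝ → ℝ) (c : ℝ) : Prop where
  bounded_third : ∀ z, |iteratedDeriv 3 σ z| ≤ c
  lipschitz : ∀ k ≤ 3, ∀ z z' : ℝ,
    |iteratedDeriv k σ z - iteratedDeriv k σ z'| ≤ c * |z - z'|
  analytic : ∀ z, AnalyticAt ℝ σ z
  not_polynomial : ¬ ∃ p : Polynomial ℝ, ∀ z, σ z = p.eval z

/-- First-layer weights `w = (w₁, …, w_m)`, `w_r ∈ ℝ^{d+1}`, with the Euclidean structure of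
`ℝ^{m(d+1)}`. -/
abbrev Weights (d m : ℕ) : Type := PiLp 2 (fun _ : Fin m => SpaceTime d)

/-- The two-layer network `u(x; w, a) = m^{-1/2} ∑ᵣ aᵣ σ(wᵣᵀ x)`. -/
def network {d m : ℕ} (σ : ℝ → ℝ) (a : Fin m → ℝ) (w : Weights d m) (x : SpaceTime d) : ℝ :=
  1 / Real.sqrt m * ∑ r, a r * σ (inner ℝ (w r) x)

/-- The partial derivative `∂u/∂x_i`. -/
def pderiv {d : ℕ} (i : Fin (d + 1)) (u : SpaceTime d → ℝ) (x : SpaceTime d) : ℝ :=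
  lineDeriv ℝ u x (EuclideanSpace.single i 1)

/-- `∂u/∂x₀ - ∑_{i=1}^d ∂²u/∂x_i²`. -/
def heatOp {d : ℕ} (u : SpaceTime d → ℝ) (x : SpaceTime d) : ℝ :=
  pderiv 0 u x - ∑ i : Fin d, pderiv i.succ (pderiv i.succ u) x

/-- Training data: source term `f`, boundary data `g`, interior samples `x`, boundary
samples `y`. -/
structure TrainingData (d n₁ n₂ : ℕ) where
  f : SpaceTime d → ℝ
  g : SpaceTime d → ℝ
  x : Fin n₁ → SpaceTime d
  y : Fin n₂ → SpaceTime d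

/-- All samples, `x₁, …, x_{n₁}, y₁, …, y_{n₂}`. -/
def TrainingData.sample {d n₁ n₂ : ℕ} (D : TrainingData d n₁ n₂) :
    Fin n₁ ⊕ Fin n₂ → SpaceTime d :=
  Sum.elim D.x D.y

/-- No two samples (with different indices) are parallel. -/
def TrainingData.NonParallel {d n₁ n₂ : ℕ} (D : TrainingData d n₁ n₂) : Prop :=
  ∀ i j, i ≠ j → LinearIndependent ℝ ![D.sample i, D.sample j]

/-- The residuals `(s₁, …, s_{n₁}, h₁, …, h_{n₂})` as functions of the weights. -/
def pinnResidual {d n₁ n₂ m : ℕ} (σ : ℝ → ℝ) (D : TrainingData d n₁ n₂) (a : Fin m → ℝ) :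
    Fin n₁ ⊕ Fin n₂ → Weights d m → ℝ
  | Sum.inl p, w => 1 / Real.sqrt n₁ * (heatOp (network σ a w) (D.x p) - D.f (D.x p))
  | Sum.inr j, w => 1 / Real.sqrt n₂ * (network σ a w (D.y j) - D.g (D.y j))

/-- The empirical loss `L(w) = (‖s(w)‖² + ‖h(w)‖²) / 2`. -/
def loss {d n₁ n₂ m : ℕ} (σ : ℝ → ℝ) (D : TrainingData d n₁ n₂) (a : Fin m → ℝ)
    (w : Weights d m) : ℝ :=
  1 / 2 * ((∑ p, pinnResidual σ D a (Sum.inl p) w ^ 2) + ∑ j, pinnResidual σ D a (Sum.inr j) w ^ 2)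

/-- The Gram matrix `G(w) = DᵀD`, where the columns of `D` are the gradients in `w` of the
residuals. -/
def gram {d n₁ n₂ m : ℕ} (σ : ℝ → ℝ) (D : TrainingData d n₁ n₂) (a : Fin m → ℝ)
    (w : Weights d m) : Matrix (Fin n₁ ⊕ Fin n₂) (Fin n₁ ⊕ Fin n₂) ℝ :=
  Matrix.of fun i j =>
    inner ℝ (gradient (pinnResidual σ D a i) w) (gradient (pinnResidual σ D a j) w)

/-- The uniform distribution on `{-1, 1}`. -/
def signLaw : Measure ℝ :=
  (2⁻¹ : ℝ≥0∞) • Measure.dirac (-1) + (2⁻¹ : ℝ≥0∞) • Measure.dirac 1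

/-- The law of the random initialization `((w_r(0))_r, (a_r)_r)`: all independent,
`w_r(0) ∼ N(0, I_{d+1})` and `a_r ∼ Unif{-1,1}`. -/
def initLaw (d m : ℕ) : Measure ((Fin m → SpaceTime d) × (Fin m → ℝ)) :=
  (Measure.pi fun _ : Fin m => stdGaussian (SpaceTime d)).prod
    (Measure.pi fun _ : Fin m => signLaw)

/-- The expected Gram matrix at initialization, `G^∞ = E[G(0)]`. (It does not depend on the
width `m ≥ 1`: the neurons are i.i.d., `G(0)` is an average over them, and `a_r² = 1`.) -/
def gramInf {d n₁ n₂ : ℕ} (m : ℕ) (σ : ℝ → ℝ) (D : TrainingData d n₁ n₂) :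
    Matrix (Fin n₁ ⊕ Fin n₂) (Fin n₁ ⊕ Fin n₂) ℝ :=
  Matrix.of fun i j => ∫ ω, gram σ D ω.2 (WithLp.toLp 2 ω.1) i j ∂(initLaw d m)

/-- The least eigenvalue of a real symmetric matrix. -/
def lambdaMin {ι : Type*} [Fintype ι] [DecidableEq ι] (A : Matrix ι ι ℝ) : ℝ :=
  sInf (spectrum ℝ A)

/-- `w(0), w(1), …` is produced by implicit gradient descent on `F` with learning rate `η`:
`w(k+1)` minimizes `v ↦ ‖v - w(k)‖²/2 + η F(v)` and satisfies the resulting implicit equation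
`w(k+1) = w(k) - η ∇F(w(k+1))`. -/
def IsIGD {E : Type*} [NormedAddCommGroup E] [InnerProductSpace ℝ E] [CompleteSpace E]
    (η : ℝ) (F : E → ℝ) (w : ℕ → E) : Prop :=
  ∀ k, IsMinOn (fun v => 1 / 2 * ‖v - w k‖ ^ 2 + η * F v) Set.univ (w (k + 1)) ∧
    w (k + 1) = w k - η • gradient F (w (k + 1))

/-- The quantity that the width has to dominate, up to a constant factor; `N` is the number
`n₁ + n₂` of samples and `lam` stands for `λ₀`. -/
def widthBound (d N m : ℕ) (lam η δ : ℝ) : ℝ :=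
  (d : ℝ) ^ 8 / lam ^ 2 * Real.log (N / δ) *
    max (η ^ 4 * (d : ℝ) ^ 2 * Real.log (N / δ))
      (max (1 / lam ^ 2 * Real.log (m / δ) ^ 2)
        (η ^ 2 * Real.log (m / δ) ^ 6 * Real.log (N / δ) / lam ^ 2))

end

set_option linter.unusedSectionVars false

/-! This is a lazy-training argument. For a wide network each weight moves so little that the Gram
matrix of the residual gradients stays close to its Gaussian mean, and the residual vector `R` then
contracts geometrically.

Contraction. One implicit step gives `w - v = η ∇L(v)`. Expanding `R(w)` about the new point `v` and
pairing with `R(v)` yields `⟪R(v), R(w)⟫ = ‖R(v)‖² + η ‖∇L(v)‖² + remainder`. Here `‖∇L(v)‖²` is the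
Gram form at `R(v)`, at least `3/4 λ₀ ‖R(v)‖²`, and the Taylor remainder has a factor `1/√m` that
makes it at most `ηλ₀/4 ‖R(v)‖²`. Hence `(1 + ηλ₀/2) ‖R(v)‖ ≤ ‖R(w)‖` (`featVec_contract`), with no
step-size restriction apart from the width condition. The drifts of a neuron then sum to a geometric
series, so the iterates stay near `w(0)` and the induction closes (`featVec_decay`).

Initialization. With probability `1 - δ` the initial residual is of order `d √log(N/δ)`, the squared
weights are of order `d log(m/δ)`, and the Gram form over neurons of moderate norm is at least `7/8
λ₀` (`exists_good_event`). The gradients grow quadratically, so the Gram entries are truncated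
before Hoeffding's inequality is applied; a sixth moment bounds the loss.

Positivity of `λ₀`. A null vector of `G^∞` is a linear relation between the feature gradients that
holds for every weight. Differentiating the corresponding combination of features `k` times along a
generic ray at the origin gives `σ⁽ᵏ⁾(0) ∑ αᵢ Pᵢ(k) zᵢᵏ = 0`, with `Pᵢ` of degree at most two and
distinct `|zᵢ|`. As `σ` is not a polynomial, `σ⁽ᵏ⁾(0) ≠ 0` infinitely often, so the dominant term
forces all `αᵢ = 0` (`pinnFeatureGrad_independent`). -/

/-- A family of neuron features `φ i` with gradients `γ i` of at most quadratic growth. -/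
structure FeatureBound {ι E : Type*} [NormedAddCommGroup E] [InnerProductSpace ℝ E]
    [CompleteSpace E] (φ : ι → E → ℝ) (γ : ι → E → E) (b : ℝ) : Prop where
  one_le : 1 ≤ b
  hasGrad : ∀ i w, HasGradientAt (φ i) (γ i w) w
  val : ∀ i w, |φ i w| ≤ b * (1 + ‖w‖ ^ 2)
  grad : ∀ i w, ‖γ i w‖ ≤ b * (1 + ‖w‖ ^ 2)
  lip : ∀ i v w, ‖γ i v - γ i w‖ ≤ b * (1 + ‖v‖ ^ 2 + ‖w‖ ^ 2) * ‖v - w‖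

/-! ### Deterministic analysis of implicit gradient descent for a general two-layer model. -/

section Deterministic

variable {ι E : Type*} [Fintype ι] [NormedAddCommGroup E] [InnerProductSpace ℝ E]
  [CompleteSpace E] {m : ℕ}

/-- Weighted residual of the width-`m` network built from the feature `φ i`. -/
noncomputable def featResidual (c t : ι → ℝ) (φ : ι → E → ℝ) (a : Fin m → ℝ) (i : ι)
    (w : PiLp 2 (fun _ : Fin m => E)) : ℝ :=
  c i * (1 / √m * ∑ r, a r * φ i (w r) - t i)

/-- The vector of all residuals. -/
noncomputable def featVec (c t : ι → ℝ) (φ : ι → E → ℝ) (a : Fin m → ℝ)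
    (w : PiLp 2 (fun _ : Fin m => E)) : EuclideanSpace ℝ ι :=
  WithLp.toLp 2 fun i => featResidual c t φ a i w

/-- Gradient of `featResidual`. -/
noncomputable def featGrad (c : ι → ℝ) (γ : ι → E → E) (a : Fin m → ℝ) (i : ι)
    (w : PiLp 2 (fun _ : Fin m => E)) : PiLp 2 (fun _ : Fin m => E) :=
  WithLp.toLp 2 fun r => (c i * (1 / √m) * a r) • γ i (w r)

/-- Half the sum of squares of the residuals. -/
noncomputable def featLoss (c t : ι → ℝ) (φ : ι → E → ℝ) (a : Fin m → ℝ)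
    (w : PiLp 2 (fun _ : Fin m => E)) : ℝ :=
  1 / 2 * ‖featVec c t φ a w‖ ^ 2

/-- Gradient of `featLoss`. -/
noncomputable def featLossGrad (c t : ι → ℝ) (φ : ι → E → ℝ) (γ : ι → E → E) (a : Fin m → ℝ)
    (w : PiLp 2 (fun _ : Fin m => E)) : PiLp 2 (fun _ : Fin m => E) :=
  ∑ i, featResidual c t φ a i w • featGrad c γ a i w

variable {c t : ι → ℝ} {φ : ι → E → ℝ} {γ : ι → E → E} {b : ℝ} {a : Fin m → ℝ}

lemma hasGradientAt_featResidual (h : FeatureBound φ γ b) (i : ι)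
    (w : PiLp 2 (fun _ : Fin m => E)) :
    HasGradientAt (featResidual c t φ a i) (featGrad c γ a i w) w := by
  rw [hasGradientAt_iff_hasFDerivAt]
  have h1 : ∀ r : Fin m, HasFDerivAt (fun w : PiLp 2 (fun _ : Fin m => E) => φ i (w r))
      ((InnerProductSpace.toDual ℝ E (γ i (w r))).comp (PiLp.proj 2 (𝕜 := ℝ) (fun _ => E) r)) w :=
    fun r => ((hasGradientAt_iff_hasFDerivAt.1 (h.hasGrad i (w r)))).comp w
      (PiLp.hasFDerivAt_apply (𝕜 := ℝ) 2 w r)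
  have h2 := (((HasFDerivAt.fun_sum (u := Finset.univ)
    fun r _ => (h1 r).const_mul (a r)).const_mul (1 / √m)).sub_const (t i)).const_mul (c i)
  refine h2.congr_fderiv ?_
  ext v
  simp [featGrad, PiLp.inner_apply, Finset.mul_sum, real_inner_smul_left, mul_assoc]

lemma featLoss_eq (w : PiLp 2 (fun _ : Fin m => E)) :
    featLoss c t φ a w = 1 / 2 * ∑ i, featResidual c t φ a i w ^ 2 := by
  simp [featLoss, featVec, PiLp.norm_sq_eq_of_L2]

lemma hasGradientAt_featLoss (h : FeatureBound φ γ b) (w : PiLp 2 (fun _ : Fin m => E)) :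
    HasGradientAt (featLoss c t φ a) (featLossGrad c t φ γ a w) w := by
  rw [hasGradientAt_iff_hasFDerivAt]
  have h2 := (HasFDerivAt.fun_sum (u := Finset.univ) fun i _ =>
    ((hasGradientAt_iff_hasFDerivAt.1
      (hasGradientAt_featResidual (c := c) (t := t) (a := a) h i w)).pow 2)).const_mul
      (1 / 2 : ℝ)
  have h3 : featLoss c t φ a = fun w => 1 / 2 * ∑ i, featResidual c t φ a i w ^ 2 :=
    funext featLoss_eq
  rw [h3]
  refine h2.congr_fderiv ?_
  ext v
  simp only [one_div, smul_apply, sum_apply, Nat.add_one_sub_one, pow_one,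
    featLossGrad, map_sum, map_smul, smul_eq_mul, Finset.mul_sum, nsmul_eq_mul]
  refine Finset.sum_congr rfl fun i _ => ?_
  push_cast
  ring

lemma featLoss_nonneg (w : PiLp 2 (fun _ : Fin m => E)) : 0 ≤ featLoss c t φ a w := by
  unfold featLoss; positivity

/-- Implicit gradient descent on a nonnegative differentiable function can always be run. -/
lemma exists_isGD_step {F : Type*} [NormedAddCommGroup F] [InnerProductSpace ℝ F]
    [FiniteDimensional ℝ F] {L : F → ℝ} {g : F → F} (hL : ∀ x, HasGradientAt L (g x) x)
    (h0 : ∀ x, 0 ≤ L x) {η : ℝ} (hη : 0 < η) (w : F) :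
    ∃ v, IsMinOn (fun v => 1 / 2 * ‖v - w‖ ^ 2 + η * L v) Set.univ v ∧
      v = w - η • gradient L v := by
  have hc : Continuous L := continuous_iff_continuousAt.2 fun w =>
    (hasGradientAt_iff_hasFDerivAt.1 (hL w)).continuousAt
  have hco : Filter.Tendsto (fun v => 1 / 2 * ‖v - w‖ ^ 2 + η * L v) (Filter.cocompact F)
      Filter.atTop := by
    have h1 : Filter.Tendsto (fun v => ‖v - w‖) (Filter.cocompact F) Filter.atTop := by
      refine Filter.tendsto_atTop_mono (fun v => norm_sub_norm_le v w) ?_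
      exact Filter.tendsto_atTop_add_const_right _ (-‖w‖) (tendsto_norm_cocompact_atTop (E := F))
    have h2 : Filter.Tendsto (fun v => 1 / 2 * ‖v - w‖ ^ 2) (Filter.cocompact F) Filter.atTop :=
      Filter.Tendsto.const_mul_atTop (by norm_num)
        ((Filter.tendsto_pow_atTop (by norm_num)).comp h1)
    exact Filter.tendsto_atTop_mono
      (fun v => le_add_of_nonneg_right (mul_nonneg hη.le (h0 v))) h2
  obtain ⟨v, hv⟩ := Continuous.exists_forall_le (by fun_prop) hco
  have hmin : IsMinOn (fun v => 1 / 2 * ‖v - w‖ ^ 2 + η * L v) Set.univ v := fun y _ => hv y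
  refine ⟨v, hmin, ?_⟩
  have hd : HasFDerivAt (fun v => 1 / 2 * ‖v - w‖ ^ 2 + η * L v)
      (InnerProductSpace.toDual ℝ F (v - w + η • g v)) v := by
    have e1 := (((hasFDerivAt_id v).sub_const w).norm_sq.const_mul (1 / 2 : ℝ)).add
      ((hasGradientAt_iff_hasFDerivAt.1 (hL v)).const_mul η)
    refine e1.congr_fderiv ?_
    ext z
    simp
  have hz := (hmin.isLocalMin Filter.univ_mem).hasFDerivAt_eq_zero hd
  have hz' : v - w + η • g v = 0 := (InnerProductSpace.toDual ℝ F).map_eq_zero_iff.1 hz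
  rw [(hL v).gradient]
  linear_combination (norm := module) hz'

lemma exists_isIGD {F : Type*} [NormedAddCommGroup F] [InnerProductSpace ℝ F]
    [FiniteDimensional ℝ F] {L : F → ℝ} {g : F → F} (hL : ∀ x, HasGradientAt L (g x) x)
    (h0 : ∀ x, 0 ≤ L x) {η : ℝ} (hη : 0 < η) (w₀ : F) :
    ∃ w : ℕ → F, w 0 = w₀ ∧ IsIGD η L w := by
  choose f hf using exists_isGD_step hL h0 hη
  refine ⟨fun n => f^[n] w₀, rfl, fun k => ?_⟩
  simp only [Function.iterate_succ_apply']
  exact hf _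

/-- Energy estimate for one proximal step. -/
lemma prox_energy {η : ℝ} (hη : 0 < η) {w v : PiLp 2 (fun _ : Fin m => E)}
    (hmin : IsMinOn (fun v => 1 / 2 * ‖v - w‖ ^ 2 + η * featLoss c t φ a v) Set.univ v) :
    ‖featVec c t φ a v‖ ≤ ‖featVec c t φ a w‖ ∧ ‖v - w‖ ≤ √η * ‖featVec c t φ a w‖ := by
  have h : 1 / 2 * ‖v - w‖ ^ 2 + η * featLoss c t φ a v ≤
      1 / 2 * ‖w - w‖ ^ 2 + η * featLoss c t φ a w :=
    hmin (Set.mem_univ w)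
  simp only [featLoss, sub_self, norm_zero] at h
  constructor
  · apply le_of_sq_le_sq _ (norm_nonneg _)
    have : η * ‖featVec c t φ a v‖ ^ 2 ≤ η * ‖featVec c t φ a w‖ ^ 2 := by
      nlinarith [sq_nonneg ‖v - w‖]
    exact le_of_mul_le_mul_left this hη
  · apply le_of_sq_le_sq _ (by positivity)
    rw [mul_pow, Real.sq_sqrt hη.le]
    nlinarith [mul_nonneg hη.le (sq_nonneg ‖featVec c t φ a v‖)]

/-- Cauchy–Schwarz, with `√2` rounded up to `2`. Each of the two sample groups contributes `1` to `∑
cᵢ²`, so this replaces sums over samples by a norm without a factor depending on their number. -/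
lemma sum_abs_mul_le (hc : ∑ i, c i ^ 2 ≤ 2) (v : EuclideanSpace ℝ ι) :
    ∑ i, |v i * c i| ≤ 2 * ‖v‖ := by
  have h1 := Finset.sum_mul_sq_le_sq_mul_sq Finset.univ (fun i => |v i|) (fun i => |c i|)
  simp only [← abs_mul, sq_abs] at h1
  have h2 : ‖v‖ ^ 2 = ∑ i, v i ^ 2 := by simp [PiLp.norm_sq_eq_of_L2]
  rw [← h2] at h1
  apply le_of_sq_le_sq _ (by positivity)
  nlinarith [sq_nonneg ‖v‖]

lemma norm_sum_smul_le (hc : ∑ i, c i ^ 2 ≤ 2) (v : EuclideanSpace ℝ ι) {g : ι → E} {K : ℝ}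
    (hg : ∀ i, ‖g i‖ ≤ K) : ‖∑ i, (v i * c i) • g i‖ ≤ 2 * K * ‖v‖ := by
  rcases isEmpty_or_nonempty ι with hι | ⟨⟨i0⟩⟩
  · have : v = 0 := Subsingleton.elim _ _
    simp [this]
  have hK : 0 ≤ K := (norm_nonneg _).trans (hg i0)
  calc ‖∑ i, (v i * c i) • g i‖ ≤ ∑ i, ‖(v i * c i) • g i‖ := norm_sum_le _ _
    _ ≤ ∑ i, |v i * c i| * K := by
        gcongr with i
        rw [norm_smul, Real.norm_eq_abs]
        gcongr
        exact hg i
    _ = (∑ i, |v i * c i|) * K := by rw [Finset.sum_mul]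
    _ ≤ 2 * ‖v‖ * K := by gcongr; exact sum_abs_mul_le hc v
    _ = _ := by ring

lemma featLossGrad_apply (w : PiLp 2 (fun _ : Fin m => E)) (r : Fin m) :
    featLossGrad c t φ γ a w r =
      (1 / √m * a r) • ∑ i, (featVec c t φ a w i * c i) • γ i (w r) := by
  simp only [featLossGrad, featGrad, featVec, WithLp.ofLp_sum, Finset.sum_apply, PiLp.smul_apply,
    Finset.smul_sum, smul_smul]
  refine Finset.sum_congr rfl fun i _ => ?_
  congr 1
  ring

/-- The right side is the Gram form evaluated at the residual vector; the signs disappear because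
`|a r| = 1`. A lower bound on the Gram form thus bounds the gradient from below. -/
lemma norm_featLossGrad_sq (ha : ∀ r, |a r| = 1) (w : PiLp 2 (fun _ : Fin m => E)) :
    ‖featLossGrad c t φ γ a w‖ ^ 2 =
      1 / m * ∑ r, ‖∑ i, (featVec c t φ a w i * c i) • γ i (w r)‖ ^ 2 := by
  rw [PiLp.norm_sq_eq_of_L2, Finset.mul_sum]
  refine Finset.sum_congr rfl fun r _ => ?_
  rw [featLossGrad_apply, norm_smul, mul_pow, norm_mul, mul_pow]
  simp [ha r]

lemma norm_featLossGrad_apply_le (h : FeatureBound φ γ b) (hc : ∑ i, c i ^ 2 ≤ 2)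
    (ha : ∀ r, |a r| = 1) (w : PiLp 2 (fun _ : Fin m => E)) (r : Fin m) :
    ‖featLossGrad c t φ γ a w r‖ ≤ 2 * b / √m * (1 + ‖w r‖ ^ 2) * ‖featVec c t φ a w‖ := by
  rw [featLossGrad_apply, norm_smul]
  have h1 := norm_sum_smul_le hc (featVec c t φ a w) (g := fun i => γ i (w r))
    fun i => h.grad i (w r)
  have h2 : ‖1 / √(m : ℝ) * a r‖ = 1 / √m := by simp [ha r]
  rw [h2]
  calc _ ≤ 1 / √m * (2 * (b * (1 + ‖w r‖ ^ 2)) * ‖featVec c t φ a w‖) := by gcongr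
    _ = _ := by ring

/-- First-order Taylor bound for a single feature. -/
lemma FeatureBound.taylor (h : FeatureBound φ γ b) (i : ι) {v w : E} {K : ℝ}
    (hv : ‖v‖ ^ 2 ≤ K) (hw : ‖w‖ ^ 2 ≤ K) :
    |φ i w - φ i v - inner ℝ (γ i v) (w - v)| ≤ b * (1 + 2 * K) * ‖w - v‖ ^ 2 := by
  have hb : 0 ≤ b := zero_le_one.trans h.one_le
  have hK : 0 ≤ K := (sq_nonneg _).trans hv
  have key := Convex.norm_image_sub_le_of_norm_hasFDerivWithin_le' (𝕜 := ℝ) (f := φ i)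
    (f' := fun z => InnerProductSpace.toDual ℝ E (γ i z)) (s := segment ℝ v w) (x := v) (y := w)
    (φ := InnerProductSpace.toDual ℝ E (γ i v)) (C := b * (1 + 2 * K) * ‖w - v‖)
    (fun z _ => (hasGradientAt_iff_hasFDerivAt.1 (h.hasGrad i z)).hasFDerivWithinAt)
    (fun z hz => ?_) (convex_segment v w) (left_mem_segment ℝ v w) (right_mem_segment ℝ v w)
  · simpa [Real.norm_eq_abs, pow_two, mul_assoc] using key
  · rw [← map_sub, LinearIsometryEquiv.norm_map]
    have hz2 : ‖z‖ ^ 2 ≤ K := by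
      have hball : z ∈ Metric.closedBall (0 : E) (√K) :=
        (convex_closedBall (0 : E) (√K)).segment_subset
          (by simpa using Real.le_sqrt_of_sq_le hv) (by simpa using Real.le_sqrt_of_sq_le hw) hz
      rw [mem_closedBall_zero_iff] at hball
      calc ‖z‖ ^ 2 ≤ √K ^ 2 := by gcongr
        _ = K := Real.sq_sqrt hK
    have hzv : ‖z - v‖ ≤ ‖w - v‖ := by
      rw [segment_eq_image'] at hz
      obtain ⟨θ, hθ, rfl⟩ := hz
      rw [add_sub_cancel_left, norm_smul, Real.norm_eq_abs, abs_of_nonneg hθ.1]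
      exact mul_le_of_le_one_left (norm_nonneg _) hθ.2
    calc ‖γ i z - γ i v‖ ≤ b * (1 + ‖z‖ ^ 2 + ‖v‖ ^ 2) * ‖z - v‖ := h.lip i z v
      _ ≤ b * (1 + K + K) * ‖w - v‖ := by gcongr
      _ = _ := by ring

/-- An implicit step bound `D ≤ (2bη/√m)(8Q + 2√η A D) x` is made explicit at large width. -/
lemma displacement_of_implicit {b s M Q A D x : ℝ} (hb : 0 ≤ b) (hs : 0 ≤ s) (hM : 0 < M)
    (hD : 0 ≤ D) (hx : 0 ≤ x) (hxA : x ≤ A) (hcond : 8 * b * s ^ 3 * A ^ 2 ≤ M)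
    (h : D ≤ 2 * b * s ^ 2 / M * (8 * Q + 2 * s * A * D) * x) :
    D ≤ 32 * b * s ^ 2 / M * Q * x := by
  -- The condition `8bs³A² ≤ M` makes the `D`-term on the right at most `D / 2`, so it is absorbed
  -- at the price of doubling `16` to `32`.
  have h1 : 4 * b * s ^ 3 * A * D * x ≤ 4 * b * s ^ 3 * A * D * A := by
    have hA : 0 ≤ A := hx.trans hxA
    gcongr
  have h2 : 2 * b * s ^ 2 / M * (8 * Q + 2 * s * A * D) * x
      = (16 * b * s ^ 2 * Q * x + 4 * b * s ^ 3 * A * D * x) / M := by field_simp; ring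
  rw [h2, le_div_iff₀ hM] at h
  have h3 : 32 * b * s ^ 2 / M * Q * x = 32 * b * s ^ 2 * Q * x / M := by ring
  rw [h3, le_div_iff₀ hM]
  nlinarith [mul_le_mul_of_nonneg_right hcond hD]

lemma one_add_norm_sq_le_of_dist {u v : E} {Q : ℝ} (hu : 1 + ‖u‖ ^ 2 ≤ Q)
    (hd : ‖v - u‖ ^ 2 ≤ Q / 4) : 1 + ‖v‖ ^ 2 ≤ 4 * Q := by
  have h1 : ‖v‖ ≤ ‖u‖ + ‖v - u‖ := norm_le_norm_add_norm_sub' v u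
  have h2 : ‖v‖ ^ 2 ≤ (‖u‖ + ‖v - u‖) ^ 2 := by gcongr
  nlinarith [sq_nonneg (‖u‖ - ‖v - u‖), sq_nonneg ‖u‖]

/-- Lower bound for the quadratic form of the Gram matrix, stable under perturbing neurons. -/
lemma gram_form_perturb (h : FeatureBound φ γ b) (hc : ∑ i, c i ^ 2 ≤ 2) {lam V ρ : ℝ}
    (hlam : 0 ≤ lam) (hm : 0 < m) (T : Finset (Fin m)) {u v : PiLp 2 (fun _ : Fin m => E)}
    (hV : ∀ r ∈ T, 1 + ‖u r‖ ^ 2 ≤ V)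
    (hG : ∀ x : EuclideanSpace ℝ ι,
      7 / 8 * lam * ‖x‖ ^ 2 ≤ 1 / m * ∑ r ∈ T, ‖∑ i, (x i * c i) • γ i (u r)‖ ^ 2)
    (hd : ∀ r, ‖v r - u r‖ ≤ 32 * b * (1 + ‖u r‖ ^ 2) * ρ)
    (hv : ∀ r, 1 + ‖v r‖ ^ 2 ≤ 4 * (1 + ‖u r‖ ^ 2)) (hρ : 0 ≤ ρ)
    (hcond : (320 * b ^ 2 * V ^ 2 * ρ) ^ 2 ≤ lam / 400) (x : EuclideanSpace ℝ ι) :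
    3 / 4 * lam * ‖x‖ ^ 2 ≤ 1 / m * ∑ r, ‖∑ i, (x i * c i) • γ i (v r)‖ ^ 2 := by
  have hb : 0 ≤ b := zero_le_one.trans h.one_le
  have hm' : (0 : ℝ) < m := by exact_mod_cast hm
  -- Young's inequality: `‖p‖² ≤ (‖q‖ + ‖q - p‖)² ≤ 16/15 ‖q‖² + 16 ‖q - p‖²`. Only neurons in `T`
  -- are compared; the others contribute nonnegative terms and are dropped.
  have key : ∀ r ∈ T, 15 / 16 * ‖∑ i, (x i * c i) • γ i (u r)‖ ^ 2 - 15 * (lam / 400) * ‖x‖ ^ 2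
      ≤ ‖∑ i, (x i * c i) • γ i (v r)‖ ^ 2 := by
    intro r hr
    set p := ∑ i, (x i * c i) • γ i (u r)
    set q := ∑ i, (x i * c i) • γ i (v r)
    have hdiff : q - p = ∑ i, (x i * c i) • (γ i (v r) - γ i (u r)) := by
      simp only [p, q, smul_sub, Finset.sum_sub_distrib]
    have hpq : ‖q - p‖ ≤ 320 * b ^ 2 * V ^ 2 * ρ * ‖x‖ := by
      rw [hdiff]
      have := norm_sum_smul_le hc x (g := fun i => γ i (v r) - γ i (u r))
        (K := 160 * b ^ 2 * V ^ 2 * ρ) (fun i => ?_)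
      · linarith
      · have hQV := hV r hr
        have hQ0 : 0 ≤ 1 + ‖u r‖ ^ 2 := by positivity
        calc ‖γ i (v r) - γ i (u r)‖ ≤ b * (1 + ‖v r‖ ^ 2 + ‖u r‖ ^ 2) * ‖v r - u r‖ := h.lip _ _ _
          _ ≤ b * (5 * V) * (32 * b * V * ρ) := by
            have h5 : 1 + ‖v r‖ ^ 2 + ‖u r‖ ^ 2 ≤ 5 * V := by linarith [hv r]
            have hV0 : 0 ≤ V := hQ0.trans hQV
            have h6 : ‖v r - u r‖ ≤ 32 * b * V * ρ := (hd r).trans (by gcongr)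
            gcongr
          _ = _ := by ring
    have hpq2 : ‖q - p‖ ^ 2 ≤ lam / 400 * ‖x‖ ^ 2 := by
      calc ‖q - p‖ ^ 2 ≤ (320 * b ^ 2 * V ^ 2 * ρ * ‖x‖) ^ 2 := by gcongr
        _ = (320 * b ^ 2 * V ^ 2 * ρ) ^ 2 * ‖x‖ ^ 2 := by ring
        _ ≤ _ := by gcongr
    have hp : ‖p‖ ≤ ‖q‖ + ‖q - p‖ := norm_le_norm_add_norm_sub q p
    have hp2 : ‖p‖ ^ 2 ≤ (‖q‖ + ‖q - p‖) ^ 2 := by gcongr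
    nlinarith [sq_nonneg (‖q‖ - 15 * ‖q - p‖)]
  have hsum : 15 / 16 * ∑ r ∈ T, ‖∑ i, (x i * c i) • γ i (u r)‖ ^ 2
      - m * (15 * (lam / 400) * ‖x‖ ^ 2) ≤ ∑ r, ‖∑ i, (x i * c i) • γ i (v r)‖ ^ 2 := by
    calc _ ≤ 15 / 16 * ∑ r ∈ T, ‖∑ i, (x i * c i) • γ i (u r)‖ ^ 2
          - T.card * (15 * (lam / 400) * ‖x‖ ^ 2) := by
          have : (T.card : ℝ) ≤ m := by exact_mod_cast (card_finset_fin_le T)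
          gcongr
      _ = ∑ r ∈ T, (15 / 16 * ‖∑ i, (x i * c i) • γ i (u r)‖ ^ 2
            - 15 * (lam / 400) * ‖x‖ ^ 2) := by
          rw [Finset.sum_sub_distrib, ← Finset.mul_sum]; simp
      _ ≤ ∑ r ∈ T, ‖∑ i, (x i * c i) • γ i (v r)‖ ^ 2 := Finset.sum_le_sum key
      _ ≤ _ := Finset.sum_le_sum_of_subset_of_nonneg (Finset.subset_univ T)
          fun _ _ _ => by positivity
  -- The loss is affordable: `15/16 · 7/8 - 15/400 > 3/4`.
  have hGx := hG x
  rw [one_div, ← div_eq_inv_mul, le_div_iff₀ hm'] at hGx ⊢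
  have : 0 ≤ lam * ‖x‖ ^ 2 * m := by positivity
  nlinarith

/-- One implicit step contracts the residual if the Gram form at the new point is bounded below
and the step is small neuron by neuron. -/
lemma featVec_contract (h : FeatureBound φ γ b) (hc : ∑ i, c i ^ 2 ≤ 2) (ha : ∀ r, |a r| = 1)
    {lam η H A : ℝ} (hm : 0 < m) (hη : 0 < η)
    {w v : PiLp 2 (fun _ : Fin m => E)} (hv : v = w - η • featLossGrad c t φ γ a v)
    (hH : 1 ≤ H) (hwH : ∀ r, ‖w r‖ ^ 2 ≤ 4 * H) (hvH : ∀ r, ‖v r‖ ^ 2 ≤ 4 * H)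
    (hd : ∀ r, ‖w r - v r‖ ≤ 32 * b * η / √m * H * ‖featVec c t φ a v‖)
    (hA : ‖featVec c t φ a v‖ ≤ A)
    (hG : 3 / 4 * lam * ‖featVec c t φ a v‖ ^ 2 ≤
      1 / m * ∑ r, ‖∑ i, (featVec c t φ a v i * c i) • γ i (v r)‖ ^ 2)
    (hcond : 20000 * b ^ 3 * η * H ^ 3 * A ≤ lam / 4 * √m) :
    (1 + η * lam / 2) * ‖featVec c t φ a v‖ ≤ ‖featVec c t φ a w‖ := by
  have hb : 0 ≤ b := zero_le_one.trans h.one_le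
  have hm' : (0 : ℝ) < m := by exact_mod_cast hm
  have hM : 0 < √(m : ℝ) := Real.sqrt_pos.2 hm'
  set x := ‖featVec c t φ a v‖ with hx
  have hx0 : 0 ≤ x := norm_nonneg _
  -- First-order Taylor remainder about the new point `v`. Each neuron contributes a squared
  -- displacement of order `1/m`; summing `m` of them with prefactor `1/√m` leaves `1/√m`.
  set e : ι → ℝ := fun i => featResidual c t φ a i w - featResidual c t φ a i v
      - inner ℝ (featGrad c γ a i v) (w - v) with he
  have hei : ∀ i, |e i| ≤ |c i| * (9216 * b ^ 3 * η ^ 2 * H ^ 3 / √m * x ^ 2) := by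
    intro i
    have h1 : e i = c i * (1 / √m * ∑ r, a r *
        (φ i (w r) - φ i (v r) - inner ℝ (γ i (v r)) (w r - v r))) := by
      simp only [he, featResidual, featGrad, PiLp.inner_apply, real_inner_smul_left, mul_sub,
        Finset.sum_sub_distrib, Finset.mul_sum, PiLp.sub_apply]
      simp only [← mul_assoc]
      ring
    rw [h1, abs_mul]
    gcongr
    rw [abs_mul, abs_of_nonneg (by positivity : (0 : ℝ) ≤ 1 / √m)]
    calc 1 / √(m : ℝ) * |∑ r, a r * (φ i (w r) - φ i (v r) - inner ℝ (γ i (v r)) (w r - v r))|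
        ≤ 1 / √m * ∑ r : Fin m, 9 * b * H * (32 * b * η / √m * H * x) ^ 2 := by
          gcongr
          refine (Finset.abs_sum_le_sum_abs _ _).trans (Finset.sum_le_sum fun r _ => ?_)
          rw [abs_mul, ha r, one_mul]
          calc _ ≤ b * (1 + 2 * (4 * H)) * ‖w r - v r‖ ^ 2 := h.taylor i (hvH r) (hwH r)
            _ ≤ (9 * b * H) * (32 * b * η / √m * H * x) ^ 2 := by
              have : b * (1 + 2 * (4 * H)) ≤ 9 * b * H := by nlinarith
              have := hd r
              gcongr
      _ = _ := by
          have hs : √(m : ℝ) ^ 2 = m := Real.sq_sqrt hm'.le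
          simp only [Finset.sum_const, Finset.card_univ, Fintype.card_fin, nsmul_eq_mul]
          generalize √(m : ℝ) = M at hs hM
          rw [← hs]
          field_simp
          ring
  -- Since `w - v = η ∇L(v)`, the linear terms add up to `η ‖∇L(v)‖²`, with the favourable sign.
  -- This is where implicitness pays off.
  have hsum : inner ℝ (featVec c t φ a v) (featVec c t φ a w) =
      x ^ 2 + η * ‖featLossGrad c t φ γ a v‖ ^ 2 + ∑ i, featResidual c t φ a i v * e i := by
    have h1 : w - v = η • featLossGrad c t φ γ a v := by
      nth_rewrite 1 [hv]; simp
    have h2 : ∑ i, featResidual c t φ a i v * inner ℝ (featGrad c γ a i v) (w - v)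
        = η * ‖featLossGrad c t φ γ a v‖ ^ 2 := by
      have h3 : inner ℝ (featLossGrad c t φ γ a v) (featLossGrad c t φ γ a v) =
          inner ℝ (∑ i, featResidual c t φ a i v • featGrad c γ a i v)
            (featLossGrad c t φ γ a v) := rfl
      rw [h1, ← real_inner_self_eq_norm_sq, h3]
      simp only [real_inner_smul_right, sum_inner, real_inner_smul_left, Finset.mul_sum]
      exact Finset.sum_congr rfl fun i _ => by ring
    rw [← h2, hx, PiLp.norm_sq_eq_of_L2, PiLp.inner_apply, ← Finset.sum_add_distrib,
      ← Finset.sum_add_distrib]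
    refine Finset.sum_congr rfl fun i _ => ?_
    simp [he, featVec]
    ring
  have herr : |∑ i, featResidual c t φ a i v * e i| ≤ η * lam / 4 * x ^ 2 := by
    calc _ ≤ ∑ i, |featResidual c t φ a i v * e i| := Finset.abs_sum_le_sum_abs _ _
      _ ≤ ∑ i, |featVec c t φ a v i * c i| * (9216 * b ^ 3 * η ^ 2 * H ^ 3 / √m * x ^ 2) := by
          refine Finset.sum_le_sum fun i _ => ?_
          rw [abs_mul, abs_mul, mul_assoc]
          exact mul_le_mul_of_nonneg_left (hei i) (abs_nonneg _)
      _ = (∑ i, |featVec c t φ a v i * c i|) * (9216 * b ^ 3 * η ^ 2 * H ^ 3 / √m * x ^ 2) := by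
          rw [Finset.sum_mul]
      _ ≤ 2 * x * (9216 * b ^ 3 * η ^ 2 * H ^ 3 / √m * x ^ 2) := by
          gcongr; exact sum_abs_mul_le hc _
      _ = (18432 * b ^ 3 * η * H ^ 3 * x) * (η * x ^ 2) / √m := by ring
      _ ≤ (20000 * b ^ 3 * η * H ^ 3 * A) * (η * x ^ 2) / √m := by
          have hA0 : 0 ≤ A := hx0.trans hA
          gcongr
          norm_num
      _ ≤ (lam / 4 * √m) * (η * x ^ 2) / √m := by gcongr
      _ = _ := by field_simp
  have hinner : inner ℝ (featVec c t φ a v) (featVec c t φ a w) ≤ x * ‖featVec c t φ a w‖ :=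
    real_inner_le_norm _ _
  rw [hsum, norm_featLossGrad_sq ha] at hinner
  -- The rate is `3/4 lam` from the Gram form minus `1/4 lam` for the remainder.
  have h7 : (1 + η * lam / 2) * x * x ≤ ‖featVec c t φ a w‖ * x := by
    nlinarith [abs_le.1 herr, mul_le_mul_of_nonneg_left hG hη.le]
  rcases hx0.eq_or_lt with h0 | h0
  · rw [← h0]; simp
  · exact le_of_mul_le_mul_right h7 h0

/-- Bound on the displacement of a single neuron in one implicit step. -/
lemma prox_displacement (h : FeatureBound φ γ b) (hc : ∑ i, c i ^ 2 ≤ 2) (ha : ∀ r, |a r| = 1)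
    {η A : ℝ} {Q : Fin m → ℝ} (hm : 0 < m) (hη : 0 < η) {w v : PiLp 2 (fun _ : Fin m => E)}
    (hmin : IsMinOn (fun v => 1 / 2 * ‖v - w‖ ^ 2 + η * featLoss c t φ a v) Set.univ v)
    (hv : v = w - η • featLossGrad c t φ γ a v) (hA : ‖featVec c t φ a w‖ ≤ A)
    (hcond : 8 * b * √η ^ 3 * A ^ 2 ≤ √m) (hw : ∀ r, 1 + ‖w r‖ ^ 2 ≤ 4 * Q r) (r : Fin m) :
    ‖v r - w r‖ ≤ 32 * b * η / √m * Q r * ‖featVec c t φ a v‖ := by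
  have hb : 0 ≤ b := zero_le_one.trans h.one_le
  have hM : 0 < √(m : ℝ) := Real.sqrt_pos.2 (by exact_mod_cast hm)
  have hs : √η ^ 2 = η := Real.sq_sqrt hη.le
  obtain ⟨en1, en2⟩ := prox_energy hη hmin
  set x := ‖featVec c t φ a v‖ with hx
  have hx0 : 0 ≤ x := norm_nonneg _
  have hxA : x ≤ A := en1.trans hA
  set D := ‖v r - w r‖ with hD
  have hD0 : 0 ≤ D := norm_nonneg _
  have hD1 : D ≤ √η * A := by
    have : D ≤ ‖v - w‖ := PiLp.norm_apply_le (v - w) r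
    exact this.trans (en2.trans (by gcongr))
  have hD2 : D ≤ 2 * b * η / √m * (1 + ‖v r‖ ^ 2) * x := by
    have e1 : v r - w r = -(η • featLossGrad c t φ γ a v r) := by
      nth_rewrite 1 [hv]; simp
    rw [hD, e1, norm_neg, norm_smul, Real.norm_eq_abs, abs_of_pos hη]
    calc _ ≤ η * (2 * b / √m * (1 + ‖v r‖ ^ 2) * x) := by
          gcongr; exact norm_featLossGrad_apply_le h hc ha _ r
      _ = _ := by ring
  -- One of the two factors of `D²` is replaced by the energy bound `√η A`, which makes the
  -- inequality linear in `D`.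
  have hN : 1 + ‖v r‖ ^ 2 ≤ 8 * Q r + 2 * √η * A * D := by
    have h1 : ‖v r‖ ≤ ‖w r‖ + D := norm_le_norm_add_norm_sub' _ _
    have h2 : ‖v r‖ ^ 2 ≤ (‖w r‖ + D) ^ 2 := by gcongr
    nlinarith [hw r, sq_nonneg (‖w r‖ - D), mul_le_mul_of_nonneg_right hD1 hD0]
  have := displacement_of_implicit (s := √η) (M := √m) (Q := Q r) (A := A)
    hb (Real.sqrt_nonneg η) hM hD0 hx0 hxA hcond (by
      rw [hs]
      refine hD2.trans ?_
      gcongr)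
  rwa [hs] at this

/-- Linear convergence of implicit gradient descent in the lazy-training regime. -/
theorem featVec_decay (h : FeatureBound φ γ b) (hc : ∑ i, c i ^ 2 ≤ 2) (ha : ∀ r, |a r| = 1)
    {lam η H A V ρ : ℝ} (hm : 0 < m) (hη : 0 < η) (hlam : 0 < lam)
    {w : ℕ → PiLp 2 (fun _ : Fin m => E)} (hw : IsIGD η (featLoss c t φ a) w)
    (T : Finset (Fin m)) (hA : ‖featVec c t φ a (w 0)‖ ≤ A)
    (hH : ∀ r, 1 + ‖w 0 r‖ ^ 2 ≤ H) (hV : ∀ r ∈ T, 1 + ‖w 0 r‖ ^ 2 ≤ V)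
    (hG : ∀ x : EuclideanSpace ℝ ι,
      7 / 8 * lam * ‖x‖ ^ 2 ≤ 1 / m * ∑ r ∈ T, ‖∑ i, (x i * c i) • γ i (w 0 r)‖ ^ 2)
    (hρ : ρ = A / √m * (2 / lam + η))
    (hc1 : 8 * b * √η ^ 3 * A ^ 2 ≤ √m) (hc2 : 64 * b * ρ * √H ≤ 1)
    (hc3 : (320 * b ^ 2 * V ^ 2 * ρ) ^ 2 ≤ lam / 400)
    (hc4 : 20000 * b ^ 3 * η * H ^ 3 * A ≤ lam / 4 * √m) (k : ℕ) :
    ‖featVec c t φ a (w k)‖ ≤ ((1 + η * lam / 2) ^ k)⁻¹ * ‖featVec c t φ a (w 0)‖ := by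
  have hb : 0 ≤ b := zero_le_one.trans h.one_le
  have hm' : (0 : ℝ) < m := by exact_mod_cast hm
  have hM : 0 < √(m : ℝ) := Real.sqrt_pos.2 hm'
  have hA0 : 0 ≤ A := (norm_nonneg _).trans hA
  have hρ0 : 0 ≤ ρ := by rw [hρ]; positivity
  set q := 1 + η * lam / 2 with hq
  have hq1 : 1 ≤ q := by rw [hq]; nlinarith [mul_pos hη hlam]
  have hq0 : 0 < q := by linarith
  have hclose : ∀ (r : Fin m) (z : E), ‖z - w 0 r‖ ≤ 32 * b * (1 + ‖w 0 r‖ ^ 2) * ρ →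
      1 + ‖z‖ ^ 2 ≤ 4 * (1 + ‖w 0 r‖ ^ 2) := by
    intro r z hz
    refine one_add_norm_sq_le_of_dist le_rfl ?_
    set Q := 1 + ‖w 0 r‖ ^ 2 with hQ
    have hQ0 : 0 ≤ Q := by rw [hQ]; positivity
    have hQs : √Q ^ 2 = Q := Real.sq_sqrt hQ0
    have hle : 64 * b * ρ * √Q ≤ 1 :=
      le_trans (by gcongr; exact hH r) hc2
    have : ‖z - w 0 r‖ ≤ √Q / 2 := by
      refine hz.trans ?_
      nlinarith [Real.sqrt_nonneg Q, mul_le_mul_of_nonneg_right hle (Real.sqrt_nonneg Q)]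
    calc ‖z - w 0 r‖ ^ 2 ≤ (√Q / 2) ^ 2 := by gcongr
      _ = Q / 4 := by rw [div_pow, hQs]; norm_num
  -- The drift bound is a partial geometric sum: step `j` costs a multiple of `η q⁻ʲ`, and these sum
  -- to `(2/lam)(1 - q⁻ᵏ)`.
  suffices hmain : ∀ k, ‖featVec c t φ a (w k)‖ ≤ (q ^ k)⁻¹ * ‖featVec c t φ a (w 0)‖ ∧
      ∀ r, ‖w k r - w 0 r‖ ≤
        32 * b * (1 + ‖w 0 r‖ ^ 2) * (A / √m * (2 / lam) * (1 - (q ^ k)⁻¹)) from (hmain k).1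
  intro k
  induction k with
  | zero => simp
  | succ k ih =>
    obtain ⟨ih1, ih2⟩ := ih
    obtain ⟨hmin, hstep⟩ := hw k
    rw [(hasGradientAt_featLoss (c := c) (t := t) (a := a) h (w (k + 1))).gradient] at hstep
    obtain ⟨en1, en2⟩ := prox_energy hη hmin
    have hqk : (q ^ k)⁻¹ ≤ 1 := inv_le_one_of_one_le₀ (one_le_pow₀ hq1)
    have hqk0 : 0 < (q ^ k)⁻¹ := by positivity
    have hRk : ‖featVec c t φ a (w k)‖ ≤ A :=
      (ih1.trans (mul_le_of_le_one_left (norm_nonneg _) hqk)).trans hA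
    set x := ‖featVec c t φ a (w (k + 1))‖ with hx
    have hx0 : 0 ≤ x := norm_nonneg _
    have hxA : x ≤ A := en1.trans hRk
    have hwk : ∀ r, 1 + ‖w k r‖ ^ 2 ≤ 4 * (1 + ‖w 0 r‖ ^ 2) := by
      intro r
      refine hclose r _ ((ih2 r).trans ?_)
      have : A / √m * (2 / lam) * (1 - (q ^ k)⁻¹) ≤ ρ := by
        rw [hρ]
        have h1 : 0 ≤ A / √m := by positivity
        have h2 : 0 ≤ A / √m * (2 / lam) := by positivity
        nlinarith [mul_nonneg h1 hη.le]
      gcongr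
    have hdisp : ∀ r, ‖w (k + 1) r - w k r‖ ≤ 32 * b * η / √m * (1 + ‖w 0 r‖ ^ 2) * x :=
      prox_displacement h hc ha hm hη hmin hstep hRk hc1 hwk
    have hdist : ∀ r y, x ≤ y → ‖w (k + 1) r - w 0 r‖ ≤ 32 * b * (1 + ‖w 0 r‖ ^ 2) *
        (A / √m * (2 / lam) * (1 - (q ^ k)⁻¹) + η / √m * y) := by
      intro r y hy
      calc ‖w (k + 1) r - w 0 r‖ ≤ ‖w (k + 1) r - w k r‖ + ‖w k r - w 0 r‖ :=
            norm_sub_le_norm_sub_add_norm_sub _ _ _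
        _ ≤ 32 * b * η / √m * (1 + ‖w 0 r‖ ^ 2) * x + 32 * b * (1 + ‖w 0 r‖ ^ 2) *
              (A / √m * (2 / lam) * (1 - (q ^ k)⁻¹)) := add_le_add (hdisp r) (ih2 r)
        _ ≤ 32 * b * η / √m * (1 + ‖w 0 r‖ ^ 2) * y + 32 * b * (1 + ‖w 0 r‖ ^ 2) *
              (A / √m * (2 / lam) * (1 - (q ^ k)⁻¹)) := by gcongr
        _ = _ := by ring
    -- Contraction at step `k + 1` is not yet available, so the new residual is bounded by `A` only.
    -- This explains the extra `η` in `ρ`; once contraction holds, the sharper drift bound is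
    -- restored.
    have hdist' : ∀ r, ‖w (k + 1) r - w 0 r‖ ≤ 32 * b * (1 + ‖w 0 r‖ ^ 2) * ρ := by
      intro r
      refine (hdist r A hxA).trans ?_
      have : A / √m * (2 / lam) * (1 - (q ^ k)⁻¹) + η / √m * A ≤ ρ := by
        have h1 : η / √m * A = A / √m * η := by ring
        have h2 : 0 ≤ A / √m * (2 / lam) := by positivity
        rw [hρ, h1]
        nlinarith
      gcongr
    have hwk1 : ∀ r, 1 + ‖w (k + 1) r‖ ^ 2 ≤ 4 * (1 + ‖w 0 r‖ ^ 2) :=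
      fun r => hclose r _ (hdist' r)
    have hH1 : 1 ≤ H := by
      have := hH ⟨0, hm⟩
      nlinarith [sq_nonneg ‖w 0 ⟨0, hm⟩‖]
    have hcontr : q * x ≤ ‖featVec c t φ a (w k)‖ := by
      refine featVec_contract (H := H) (A := A) h hc ha hm hη hstep hH1 (fun r => ?_) (fun r => ?_)
        (fun r => ?_) hxA (gram_form_perturb h hc hlam.le hm T hV hG hdist' hwk1 hρ0 hc3 _) hc4
      · linarith [hwk r, hH r]
      · linarith [hwk1 r, hH r]
      · rw [norm_sub_rev]
        refine (hdisp r).trans ?_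
        have := hH r
        gcongr
    have hx1 : x ≤ (q ^ (k + 1))⁻¹ * ‖featVec c t φ a (w 0)‖ := by
      rw [pow_succ, mul_inv, mul_comm (q ^ k)⁻¹, mul_assoc, ← div_eq_inv_mul, le_div_iff₀ hq0]
      linarith
    refine ⟨hx1, fun r => ?_⟩
    refine (hdist r ((q ^ (k + 1))⁻¹ * A) (hx1.trans (by gcongr))).trans (le_of_eq ?_)
    have hηq : η = 2 / lam * (q - 1) := by rw [hq]; field_simp; ring
    have h1 : A / √m * (2 / lam) * (1 - (q ^ k)⁻¹) + η / √m * ((q ^ (k + 1))⁻¹ * A)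
        = A / √m * (2 / lam) * (1 - (q ^ (k + 1))⁻¹) := by
      have h2 : (q ^ k)⁻¹ = q * (q ^ (k + 1))⁻¹ := by
        rw [pow_succ]; field_simp
      rw [h2]
      nth_rewrite 1 [hηq]
      ring
    rw [h1]

/-- Squaring the residual bound gives the rate `q⁻²ᵏ`, which is weakened to `q⁻ᵏ`. -/
theorem featLoss_decay_of_featVec_decay {η lam : ℝ} (hη : 0 < η) (hlam : 0 < lam)
    {w : ℕ → PiLp 2 (fun _ : Fin m => E)} (k : ℕ)
    (hk : ‖featVec c t φ a (w k)‖ ≤ ((1 + η * lam / 2) ^ k)⁻¹ * ‖featVec c t φ a (w 0)‖) :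
    featLoss c t φ a (w k) ≤ ((1 + η * lam / 2) ^ k)⁻¹ * featLoss c t φ a (w 0) := by
  have hq1 : 1 ≤ 1 + η * lam / 2 := by nlinarith [mul_pos hη hlam]
  set y := ((1 + η * lam / 2) ^ k)⁻¹ with hy
  have hy0 : 0 ≤ y := by positivity
  have hy1 : y ≤ 1 := inv_le_one_of_one_le₀ (one_le_pow₀ hq1)
  have h1 : ‖featVec c t φ a (w k)‖ ^ 2 ≤ (y * ‖featVec c t φ a (w 0)‖) ^ 2 := by gcongr
  have h2 : y * y ≤ y * 1 := by gcongr
  unfold featLoss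
  nlinarith [sq_nonneg ‖featVec c t φ a (w 0)‖]

end Deterministic

/-! ### Exponential and polynomial moments of the standard Gaussian norm. -/

section GaussianMoments

lemma integral_exp_sq_gaussianReal {s : ℝ} (hs : s < 1 / 2) :
    Integrable (fun x => Real.exp (s * x ^ 2)) (gaussianReal 0 1) ∧
      ∫ x, Real.exp (s * x ^ 2) ∂gaussianReal 0 1 = (√(1 - 2 * s))⁻¹ := by
  have hb : 0 < 1 / 2 - s := by linarith
  have e : ∀ x : ℝ, gaussianPDFReal 0 1 x * Real.exp (s * x ^ 2) =
      (√(2 * Real.pi))⁻¹ * Real.exp (-(1 / 2 - s) * x ^ 2) := by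
    intro x
    simp only [gaussianPDFReal, NNReal.coe_one, mul_one, sub_zero, mul_assoc, ← Real.exp_add]
    congr 2
    ring
  constructor
  · rw [gaussianReal_of_var_ne_zero _ one_ne_zero, integrable_withDensity_iff_integrable_smul'
      (measurable_gaussianPDF _ _) (by simp [gaussianPDF])]
    simp only [toReal_gaussianPDF, smul_eq_mul, e]
    exact (integrable_exp_neg_mul_sq hb).const_mul _
  · rw [integral_gaussianReal_eq_integral_smul one_ne_zero]
    simp only [smul_eq_mul, e]
    rw [integral_const_mul, integral_gaussian, ← Real.sqrt_inv, ← Real.sqrt_inv,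
      ← Real.sqrt_mul (by positivity)]
    congr 1
    have : 1 - 2 * s ≠ 0 := by linarith
    field_simp

/-- After squaring, `e^{4s} ≥ 1 + 4s` reduces it to `(1 - 2s)(1 + 4s) ≥ 1`, which is where `s ≤ 1/4`
enters. -/
lemma inv_sqrt_le_exp {s : ℝ} (h0 : 0 ≤ s) (hs : s ≤ 1 / 4) :
    (√(1 - 2 * s))⁻¹ ≤ Real.exp (2 * s) := by
  have h1 : 1 ≤ √(1 - 2 * s) * Real.exp (2 * s) := by
    apply le_of_sq_le_sq _ (by positivity)
    rw [mul_pow, Real.sq_sqrt (by linarith), ← Real.exp_nat_mul]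
    have := Real.add_one_le_exp ((2 : ℕ) * (2 * s))
    push_cast at this ⊢
    nlinarith
  have h2 : 0 < √(1 - 2 * s) := Real.sqrt_pos.2 (by linarith)
  rw [inv_le_iff_one_le_mul₀ h2]
  linarith

variable {ι : Type*} [Fintype ι]

lemma integral_exp_norm_sq_stdGaussian {s : ℝ} (h0 : 0 ≤ s) (hs : s ≤ 1 / 4) :
    Integrable (fun x => Real.exp (s * ‖x‖ ^ 2)) (stdGaussian (EuclideanSpace ℝ ι)) ∧
      ∫ x, Real.exp (s * ‖x‖ ^ 2) ∂stdGaussian (EuclideanSpace ℝ ι) ≤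
        Real.exp (2 * s * Fintype.card ι) := by
  have hI := integral_exp_sq_gaussianReal (s := s) (by linarith)
  have e : ∀ x : ι → ℝ, Real.exp (s * ‖(WithLp.toLp 2 x : EuclideanSpace ℝ ι)‖ ^ 2) =
      ∏ i, Real.exp (s * x i ^ 2) := by
    intro x
    rw [EuclideanSpace.norm_sq_eq, ← Real.exp_sum, Finset.mul_sum]
    simp
  have hmeas : AEStronglyMeasurable (fun x : EuclideanSpace ℝ ι => Real.exp (s * ‖x‖ ^ 2))
      (Measure.map (WithLp.toLp 2) (Measure.pi fun _ : ι => gaussianReal 0 1)) := by fun_prop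
  have hm : AEMeasurable (WithLp.toLp 2 : (ι → ℝ) → EuclideanSpace ℝ ι)
    (Measure.pi fun _ : ι => gaussianReal 0 1) := by fun_prop
  rw [← map_pi_eq_stdGaussian, integrable_map_measure hmeas hm, integral_map hm hmeas]
  simp only [Function.comp_def, e]
  refine ⟨Integrable.fintype_prod fun i => hI.1, ?_⟩
  rw [integral_fintype_prod_eq_prod (fun _ x => Real.exp (s * x ^ 2)), hI.2]
  calc _ ≤ ∏ _i : ι, Real.exp (2 * s) := by
        gcongr
        exact inv_sqrt_le_exp h0 hs
    _ = _ := by rw [Finset.prod_const, ← Real.exp_nat_mul, Finset.card_univ]; ring_nf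

/-- Allows a continuous function vanishing almost everywhere to be recognised as zero in
`gramInf_posDef`. -/
instance isOpenPosMeasure_stdGaussian : (stdGaussian (EuclideanSpace ℝ ι)).IsOpenPosMeasure := by
  have : (gaussianReal 0 1).IsOpenPosMeasure :=
    (gaussianReal_absolutelyContinuous' 0 one_ne_zero).isOpenPosMeasure
  rw [← map_pi_eq_stdGaussian]
  have hc : Continuous (WithLp.toLp 2 : (ι → ℝ) → EuclideanSpace ℝ ι) := by fun_prop
  exact hc.isOpenPosMeasure_map (WithLp.equiv 2 (ι → ℝ)).symm.surjective

variable {d : ℕ}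

/-- The scale `4d` makes the exponential moment dimension-free: the exponents add up to at most `1/4
+ 1`, and `e^{5/4} < 4`. -/
lemma integral_exp_stdGaussian_dim (hd : 0 < d) :
    Integrable (fun x => Real.exp ((1 + ‖x‖ ^ 2) / (4 * d))) (stdGaussian (SpaceTime d)) ∧
      ∫ x, Real.exp ((1 + ‖x‖ ^ 2) / (4 * d)) ∂stdGaussian (SpaceTime d) ≤ 4 := by
  have hd' : (1 : ℝ) ≤ d := by exact_mod_cast hd
  have h0 : (0 : ℝ) ≤ 1 / (4 * d) := by positivity
  have h1 : 1 / (4 * (d : ℝ)) ≤ 1 / 4 := by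
    apply one_div_le_one_div_of_le <;> linarith
  have h := integral_exp_norm_sq_stdGaussian (ι := Fin (d + 1)) h0 h1
  have e : ∀ x : SpaceTime d, Real.exp ((1 + ‖x‖ ^ 2) / (4 * d)) =
      Real.exp (1 / (4 * d)) * Real.exp (1 / (4 * d) * ‖x‖ ^ 2) := by
    intro x; rw [← Real.exp_add]; congr 1; ring
  simp only [e]
  refine ⟨h.1.const_mul _, ?_⟩
  rw [integral_const_mul]
  have h2 : 2 * (1 / (4 * (d : ℝ))) * Fintype.card (Fin (d + 1)) ≤ 1 := by
    rw [Fintype.card_fin]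
    push_cast
    rw [mul_one_div, div_mul_eq_mul_div, div_le_one (by positivity)]
    linarith
  have h3 : Real.exp (1 / 4 + 1) ≤ 4 := by
    have : Real.exp (1 / 4 + 1) ^ 4 ≤ 4 ^ 4 := by
      rw [← Real.exp_nat_mul]
      have e5 : ((4 : ℕ) : ℝ) * (1 / 4 + 1) = (5 : ℕ) * 1 := by norm_num
      rw [e5, Real.exp_nat_mul]
      calc Real.exp 1 ^ 5 ≤ 2.7182818286 ^ 5 := by gcongr; exact Real.exp_one_lt_d9.le
        _ ≤ _ := by norm_num
    exact le_of_pow_le_pow_left₀ (by norm_num) (by norm_num) this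
  calc _ ≤ Real.exp (1 / 4) * Real.exp 1 := by
        gcongr
        exact h.2.trans (Real.exp_le_exp.2 h2)
    _ = Real.exp (1 / 4 + 1) := by rw [Real.exp_add]
    _ ≤ 4 := h3

lemma integrable_one_add_norm_sq_pow (k : ℕ) :
    Integrable (fun x : SpaceTime d => (1 + ‖x‖ ^ 2) ^ k) (stdGaussian (SpaceTime d)) := by
  have h := (integral_exp_norm_sq_stdGaussian (ι := Fin (d + 1)) (s := 1 / 4) (by norm_num)
    le_rfl).1.const_mul (k.factorial * 4 ^ k * Real.exp (1 / 4))
  refine h.mono' (by fun_prop) (Filter.Eventually.of_forall fun x => ?_)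
  have h1 := Real.pow_div_factorial_le_exp ((1 + ‖x‖ ^ 2) / 4) (by positivity) k
  have hk : (0 : ℝ) < k.factorial := by positivity
  rw [Real.norm_of_nonneg (by positivity)]
  rw [div_le_iff₀ hk, div_pow, div_le_iff₀ (by positivity)] at h1
  refine h1.trans (le_of_eq ?_)
  have : (1 + ‖x‖ ^ 2) / 4 = 1 / 4 + 1 / 4 * ‖x‖ ^ 2 := by ring
  rw [this, Real.exp_add]
  ring

/-- From `y⁶/6! ≤ eʸ` at `y = (1 + ‖x‖²)/(4d)`; the constant is `720 · 4⁶ · 4`, rounded up. -/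
lemma integral_one_add_norm_sq_pow_six (hd : 0 < d) :
    ∫ x : SpaceTime d, (1 + ‖x‖ ^ 2) ^ 6 ∂stdGaussian (SpaceTime d) ≤ 12000000 * (d : ℝ) ^ 6 := by
  have hd' : (0 : ℝ) < d := by exact_mod_cast hd
  have h := integral_exp_stdGaussian_dim hd
  calc _ ≤ ∫ x : SpaceTime d, 720 * (4 * (d : ℝ)) ^ 6 * Real.exp ((1 + ‖x‖ ^ 2) / (4 * d))
          ∂stdGaussian (SpaceTime d) := by
        refine integral_mono (integrable_one_add_norm_sq_pow 6) (h.1.const_mul _) fun x => ?_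
        have h1 := Real.pow_div_factorial_le_exp ((1 + ‖x‖ ^ 2) / (4 * d)) (by positivity) 6
        have h6 : ((Nat.factorial 6 : ℕ) : ℝ) = 720 := by norm_num [Nat.factorial]
        rw [h6, div_le_iff₀ (by norm_num), div_pow, div_le_iff₀ (by positivity)] at h1
        simp only
        linarith
    _ ≤ 720 * (4 * (d : ℝ)) ^ 6 * 4 := by
        rw [integral_const_mul]
        gcongr
        exact h.2
    _ ≤ _ := by
        have : 0 ≤ (d : ℝ) ^ 6 := by positivity
        nlinarith

lemma stdGaussian_tail (H : ℝ) :
    (stdGaussian (SpaceTime d)).real {x | H < 1 + ‖x‖ ^ 2} ≤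
      Real.exp ((d + 1) / 2 - (H - 1) / 4) := by
  have h := integral_exp_norm_sq_stdGaussian (ι := Fin (d + 1)) (s := 1 / 4) (by norm_num) le_rfl
  have hM := mul_meas_ge_le_integral_of_nonneg (μ := stdGaussian (SpaceTime d))
    (Filter.Eventually.of_forall fun x => (Real.exp_pos _).le) h.1 (Real.exp ((H - 1) / 4))
  have hsub : {x : SpaceTime d | H < 1 + ‖x‖ ^ 2} ⊆
      {x | Real.exp ((H - 1) / 4) ≤ Real.exp (1 / 4 * ‖x‖ ^ 2)} := by
    intro x hx
    simp only [Set.mem_ofPred_eq, Real.exp_le_exp] at hx ⊢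
    linarith
  have h1 := measureReal_mono (μ := stdGaussian (SpaceTime d)) hsub
  refine h1.trans ?_
  rw [Real.exp_sub, le_div_iff₀ (Real.exp_pos _), mul_comm]
  refine hM.trans (h.2.trans (le_of_eq ?_))
  congr 1
  rw [Fintype.card_fin]
  push_cast
  ring

end GaussianMoments

/-! ### Concentration of sums over independent neurons. -/

section Concentration

/-- Termwise in the power series: `s²ⁿ ≤ s²` for `n ≥ 1`. One finite exponential moment thereby
gives a moment generating function of the form `1 + O(s²)`. -/
lemma cosh_mul_sub_one_le {s : ℝ} (h0 : 0 ≤ s) (h1 : s ≤ 1) (x : ℝ) :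
    Real.cosh (s * x) - 1 ≤ s ^ 2 * (Real.cosh x - 1) := by
  have ha := Real.hasSum_cosh (s * x)
  have hb := ((hasSum_ite_eq (0 : ℕ) (1 - s ^ 2))).add ((Real.hasSum_cosh x).mul_left (s ^ 2))
  have := hasSum_le (fun n => ?_) ha hb
  · linarith
  · rcases Nat.eq_zero_or_pos n with rfl | hn
    · simp
    · simp only [hn.ne', if_false, zero_add, mul_pow]
      rw [mul_div_assoc]
      have hx : 0 ≤ x ^ (2 * n) / ((2 * n).factorial : ℝ) :=
        div_nonneg (by rw [pow_mul]; positivity) (by positivity)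
      gcongr ?_ * _
      exact pow_le_pow_of_le_one h0 h1 (by omega)

instance isProbabilityMeasure_signLaw : IsProbabilityMeasure signLaw := by
  constructor
  simp [signLaw, ENNReal.inv_two_add_inv_two]

lemma integrable_signLaw (f : ℝ → ℝ) : Integrable f signLaw := by
  unfold signLaw
  refine Integrable.add_measure ?_ ?_ <;>
  exact (integrable_dirac (by simp)).smul_measure (by simp)

lemma integral_signLaw (f : ℝ → ℝ) : ∫ x, f x ∂signLaw = (f (-1) + f 1) / 2 := by
  unfold signLaw
  rw [integral_add_measure
    ((integrable_dirac (by simp)).smul_measure (by simp))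
    ((integrable_dirac (by simp)).smul_measure (by simp)), integral_smul_measure,
    integral_smul_measure, integral_dirac, integral_dirac]
  simp
  ring

lemma ae_signLaw_abs : ∀ᵐ x ∂signLaw, |x| = 1 := by
  unfold signLaw
  rw [ae_add_measure_iff]
  constructor <;>
  · refine Measure.ae_smul_measure ?_ _
    rw [ae_dirac_iff (measurableSet_eq_fun (by fun_prop) (by fun_prop))]
    simp

variable {d m : ℕ}

instance isProbabilityMeasure_initLaw : IsProbabilityMeasure (initLaw d m) := by
  unfold initLaw; infer_instance

lemma ae_initLaw_abs : ∀ᵐ ω ∂initLaw d m, ∀ r, |ω.2 r| = 1 := by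
  have h : ∀ᵐ a ∂(Measure.pi fun _ : Fin m => signLaw), ∀ r, |a r| = 1 :=
    ae_all_iff.2 fun r =>
      (measurePreserving_eval (fun _ : Fin m => signLaw) r).quasiMeasurePreserving.ae ae_signLaw_abs
  exact Measure.quasiMeasurePreserving_snd.ae h

variable {ψ : SpaceTime d → ℝ} {b : ℝ}

lemma cosh_le_of_quadratic (hd : 0 < d) (hb : 0 < b) (hψ : ∀ w, |ψ w| ≤ b * (1 + ‖w‖ ^ 2))
    {s : ℝ} (h0 : 0 ≤ s) (h1 : s ≤ 1) (w : SpaceTime d) :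
    Real.cosh (s / (4 * b * d) * ψ w) ≤
      1 + s ^ 2 * (Real.exp ((1 + ‖w‖ ^ 2) / (4 * d)) - 1) := by
  have hd' : (0 : ℝ) < d := by exact_mod_cast hd
  have e : s / (4 * b * d) * ψ w = s * (ψ w / (4 * b * d)) := by ring
  have h2 := cosh_mul_sub_one_le h0 h1 (ψ w / (4 * b * d))
  have h3 : Real.cosh (ψ w / (4 * b * d)) ≤ Real.exp ((1 + ‖w‖ ^ 2) / (4 * d)) := by
    refine le_trans (b := Real.exp |ψ w / (4 * b * d)|) ?_ (Real.exp_le_exp.2 ?_)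
    · rw [← Real.cosh_abs, Real.cosh_eq]
      have := Real.exp_le_exp.2 (neg_le_self (abs_nonneg (ψ w / (4 * b * d))))
      linarith
    rw [abs_div, abs_of_pos (by positivity : 0 < 4 * b * d), div_le_div_iff₀ (by positivity)
      (by positivity)]
    nlinarith [hψ w]
  rw [e]
  nlinarith [sq_nonneg s]

lemma integral_cosh_le (hd : 0 < d) (hb : 0 < b) (hψc : Continuous ψ)
    (hψ : ∀ w, |ψ w| ≤ b * (1 + ‖w‖ ^ 2)) {s : ℝ} (h0 : 0 ≤ s) (h1 : s ≤ 1) :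
    Integrable (fun w => Real.cosh (s / (4 * b * d) * ψ w)) (stdGaussian (SpaceTime d)) ∧
      ∫ w, Real.cosh (s / (4 * b * d) * ψ w) ∂stdGaussian (SpaceTime d) ≤ Real.exp (3 * s ^ 2) := by
  have hE := integral_exp_stdGaussian_dim hd
  have hI : Integrable (fun w : SpaceTime d =>
      1 + s ^ 2 * (Real.exp ((1 + ‖w‖ ^ 2) / (4 * d)) - 1)) (stdGaussian (SpaceTime d)) :=
    (integrable_const 1).add ((hE.1.sub (integrable_const 1)).const_mul _)
  have hint : Integrable (fun w => Real.cosh (s / (4 * b * d) * ψ w))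
      (stdGaussian (SpaceTime d)) := by
    refine hI.mono' (by fun_prop) (Filter.Eventually.of_forall fun w => ?_)
    rw [Real.norm_of_nonneg (Real.cosh_pos _).le]
    exact cosh_le_of_quadratic hd hb hψ h0 h1 w
  refine ⟨hint, ?_⟩
  calc _ ≤ ∫ w : SpaceTime d, 1 + s ^ 2 * (Real.exp ((1 + ‖w‖ ^ 2) / (4 * d)) - 1)
          ∂stdGaussian (SpaceTime d) :=
        integral_mono hint hI (cosh_le_of_quadratic hd hb hψ h0 h1)
    _ = 1 + s ^ 2 * (∫ w : SpaceTime d, Real.exp ((1 + ‖w‖ ^ 2) / (4 * d))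
          ∂stdGaussian (SpaceTime d) - 1) := by
        have h2 : Integrable (fun w : SpaceTime d =>
            s ^ 2 * (Real.exp ((1 + ‖w‖ ^ 2) / (4 * d)) - 1)) (stdGaussian (SpaceTime d)) :=
          (hE.1.sub (integrable_const 1)).const_mul _
        rw [integral_add (integrable_const 1) h2, integral_const_mul,
          integral_sub hE.1 (integrable_const 1)]
        simp
    _ ≤ 1 + s ^ 2 * (4 - 1) := by gcongr; exact hE.2
    _ ≤ Real.exp (3 * s ^ 2) := by
        have := Real.add_one_le_exp (3 * s ^ 2)
        linarith

/-- Integrating the signs first turns each factor into a `cosh`, so no mean of `ψ` has to be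
subtracted. -/
lemma mgf_signed_sum_le (hd : 0 < d) (hb : 0 < b) (hψc : Continuous ψ)
    (hψ : ∀ w, |ψ w| ≤ b * (1 + ‖w‖ ^ 2)) {s : ℝ} (h0 : 0 ≤ s) (h1 : s ≤ 1) :
    Integrable (fun ω : (Fin m → SpaceTime d) × (Fin m → ℝ) =>
        Real.exp (s / (4 * b * d) * ∑ r, ω.2 r * ψ (ω.1 r))) (initLaw d m) ∧
      mgf (fun ω : (Fin m → SpaceTime d) × (Fin m → ℝ) => ∑ r, ω.2 r * ψ (ω.1 r)) (initLaw d m)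
        (s / (4 * b * d)) ≤ Real.exp (m * (3 * s ^ 2)) := by
  set θ := s / (4 * b * d) with hθ
  have hc := integral_cosh_le hd hb hψc hψ h0 h1
  have e : ∀ (w : Fin m → SpaceTime d) (a : Fin m → ℝ),
      Real.exp (θ * ∑ r, a r * ψ (w r)) = ∏ r, Real.exp (θ * (a r * ψ (w r))) := by
    intro w a; rw [Finset.mul_sum, Real.exp_sum]
  have hinner : ∀ w : Fin m → SpaceTime d, ∫ a, Real.exp (θ * ∑ r, a r * ψ (w r))
      ∂(Measure.pi fun _ : Fin m => signLaw) = ∏ r, Real.cosh (θ * ψ (w r)) := by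
    intro w
    simp only [e]
    rw [integral_fintype_prod_eq_prod (fun r x => Real.exp (θ * (x * ψ (w r))))]
    refine Finset.prod_congr rfl fun r _ => ?_
    rw [integral_signLaw, Real.cosh_eq]
    ring_nf
  have hint : Integrable (fun ω : (Fin m → SpaceTime d) × (Fin m → ℝ) =>
        Real.exp (θ * ∑ r, ω.2 r * ψ (ω.1 r))) (initLaw d m) := by
    unfold initLaw
    have hcont : Continuous (fun ω : (Fin m → SpaceTime d) × (Fin m → ℝ) =>
        Real.exp (θ * ∑ r, ω.2 r * ψ (ω.1 r))) := by fun_prop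
    refine (integrable_prod_iff hcont.aestronglyMeasurable).2
      ⟨Filter.Eventually.of_forall fun w => ?_, ?_⟩
    · simp only [e]
      exact Integrable.fintype_prod (f := fun r x => Real.exp (θ * (x * ψ (w r))))
        fun r => integrable_signLaw _
    · simp only [Real.norm_eq_abs, Real.abs_exp, hinner]
      exact Integrable.fintype_prod (f := fun _ x => Real.cosh (θ * ψ x)) fun r => hc.1
  refine ⟨hint, ?_⟩
  unfold mgf
  unfold initLaw at hint ⊢
  rw [integral_prod _ hint]
  simp only [hinner]
  rw [integral_fintype_prod_eq_prod (fun _ x => Real.cosh (θ * ψ x))]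
  calc _ ≤ ∏ _r : Fin m, Real.exp (3 * s ^ 2) := by
        refine Finset.prod_le_prod (fun _ _ => integral_nonneg fun x => (Real.cosh_pos _).le)
          fun _ _ => hc.2
    _ = _ := by rw [Finset.prod_const, ← Real.exp_nat_mul]; simp

/-- Bernstein-type tail bound for the initial output of the network. -/
lemma initLaw_signed_sum_tail (hd : 0 < d) (hm : 0 < m) (hb : 0 < b) (hψc : Continuous ψ)
    (hψ : ∀ w, |ψ w| ≤ b * (1 + ‖w‖ ^ 2)) {l : ℝ} (hl : 0 ≤ l) (hlm : l ≤ m) :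
    (initLaw d m).real {ω | 32 * b * d * √l * √m ≤ |∑ r, ω.2 r * ψ (ω.1 r)|} ≤
      2 * Real.exp (-(5 * l)) := by
  have hd' : (0 : ℝ) < d := by exact_mod_cast hd
  have hm' : (0 : ℝ) < m := by exact_mod_cast hm
  -- With this parameter the Chernoff exponent is `-8l + 3l = -5l`; `l ≤ m` ensures `s ≤ 1`.
  set s := √l / √m with hs
  have h0 : 0 ≤ s := by positivity
  have h1 : s ≤ 1 := by
    rw [hs, div_le_one (by positivity)]
    exact Real.sqrt_le_sqrt hlm
  have hs2 : (m : ℝ) * s ^ 2 = l := by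
    rw [hs, div_pow, Real.sq_sqrt hl, Real.sq_sqrt hm'.le]
    field_simp
  have one : ∀ χ : SpaceTime d → ℝ, Continuous χ → (∀ w, |χ w| ≤ b * (1 + ‖w‖ ^ 2)) →
      (initLaw d m).real {ω | 32 * b * d * √l * √m ≤ ∑ r, ω.2 r * χ (ω.1 r)} ≤
        Real.exp (-(5 * l)) := by
    intro χ hχc hχ
    have hmgf := mgf_signed_sum_le (m := m) hd hb hχc hχ h0 h1
    refine (measure_ge_le_exp_mul_mgf (32 * b * d * √l * √m)
      (by positivity : 0 ≤ s / (4 * b * d)) hmgf.1).trans ?_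
    calc _ ≤ Real.exp (-(s / (4 * b * d)) * (32 * b * d * √l * √m)) *
          Real.exp (m * (3 * s ^ 2)) := by gcongr; exact hmgf.2
      _ = Real.exp (-(5 * l)) := by
          rw [← Real.exp_add]
          congr 1
          have e1 : s / (4 * b * d) * (32 * b * d * √l * √m) = 8 * l := by
            have e2 : √l * √l = l := Real.mul_self_sqrt hl
            have e3 : s * √m = √l := by rw [hs]; field_simp
            calc s / (4 * b * d) * (32 * b * d * √l * √m) = 8 * ((s * √m) * √l) := by
                  field_simp; ring
              _ = 8 * l := by rw [e3, e2]
          linear_combination 3 * hs2 - e1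
  have hsub : {ω : (Fin m → SpaceTime d) × (Fin m → ℝ) |
        32 * b * d * √l * √m ≤ |∑ r, ω.2 r * ψ (ω.1 r)|} ⊆
      {ω | 32 * b * d * √l * √m ≤ ∑ r, ω.2 r * ψ (ω.1 r)} ∪
        {ω | 32 * b * d * √l * √m ≤ ∑ r, ω.2 r * (-ψ (ω.1 r))} := by
    intro ω hω
    rcases le_abs.1 (Set.mem_ofPred_eq ▸ hω :) with h | h
    · exact Or.inl h
    · refine Or.inr ?_
      simpa [Finset.sum_neg_distrib] using h
  refine (measureReal_mono hsub).trans ((measureReal_union_le _ _).trans ?_)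
  have ha := one ψ hψc hψ
  have hb := one (fun w => -ψ w) hψc.neg (by simpa using hψ)
  linarith

lemma initLaw_real_fst_preimage {S : Set (Fin m → SpaceTime d)} :
    (initLaw d m).real {ω | ω.1 ∈ S} =
      (Measure.pi fun _ : Fin m => stdGaussian (SpaceTime d)).real S := by
  have : {ω : (Fin m → SpaceTime d) × (Fin m → ℝ) | ω.1 ∈ S} = S ×ˢ Set.univ := by
    ext; simp
  rw [this, measureReal_def, initLaw, Measure.prod_prod]
  simp [measureReal_def]

/-- Two-sided Hoeffding inequality for a bounded function of the initial weights. -/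
lemma initLaw_hoeffding {K : ℝ} (hK : 0 < K) (hψ : Measurable ψ) (hψK : ∀ w, |ψ w| ≤ K)
    {ε : ℝ} (hε : 0 ≤ ε) :
    (initLaw d m).real {ω | m * ε ≤ |∑ r, ψ (ω.1 r) - m * ∫ w, ψ w ∂stdGaussian (SpaceTime d)|} ≤
      2 * Real.exp (-(m * ε ^ 2 / (2 * K ^ 2))) := by
  set P := Measure.pi fun _ : Fin m => stdGaussian (SpaceTime d) with hP
  have one : ∀ χ : SpaceTime d → ℝ, Measurable χ → (∀ w, |χ w| ≤ K) →
      P.real {w | m * ε ≤ ∑ r, (χ (w r) - ∫ v, χ v ∂stdGaussian (SpaceTime d))} ≤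
        Real.exp (-(m * ε ^ 2 / (2 * K ^ 2))) := by
    intro χ hχ hχK
    have hind : iIndepFun (fun (r : Fin m) (w : Fin m → SpaceTime d) =>
        χ (w r) - ∫ v, χ v ∂stdGaussian (SpaceTime d)) P :=
      iIndepFun_pi (X := fun (_ : Fin m) u => χ u - ∫ v, χ v ∂stdGaussian (SpaceTime d))
        fun _ => by fun_prop
    have hsub : ∀ r ∈ (Finset.univ : Finset (Fin m)), HasSubgaussianMGF
        (fun w : Fin m → SpaceTime d => χ (w r) - ∫ v, χ v ∂stdGaussian (SpaceTime d))
        ((‖K - (-K)‖₊ / 2) ^ 2) P := by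
      intro r _
      have h1 := hasSubgaussianMGF_of_mem_Icc (μ := P) (X := fun w : Fin m → SpaceTime d => χ (w r))
        (a := -K) (b := K) (hχ.comp (measurable_pi_apply r)).aemeasurable
        (Filter.Eventually.of_forall fun w => abs_le.1 (hχK (w r)))
      have h2 : ∫ w, χ (w r) ∂P = ∫ v, χ v ∂stdGaussian (SpaceTime d) := by
        have := (measurePreserving_eval (fun _ : Fin m => stdGaussian (SpaceTime d)) r)
        rw [← this.map_eq, integral_map this.measurable.aemeasurable
          hχ.aestronglyMeasurable]
      rwa [h2] at h1
    have hn : (((‖K - (-K)‖₊ / 2) ^ 2 : NNReal) : ℝ) = K ^ 2 := by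
      rw [NNReal.coe_pow, NNReal.coe_div, coe_nnnorm, Real.norm_eq_abs, abs_of_pos (by linarith)]
      norm_num
    generalize (‖K - (-K)‖₊ / 2) ^ 2 = k at hsub hn
    have h := HasSubgaussianMGF.measure_sum_ge_le_of_iIndepFun hind (c := fun _ => k) hsub
      (ε := m * ε) (by positivity)
    refine h.trans (le_of_eq ?_)
    congr 1
    rw [Finset.sum_const, Finset.card_univ, Fintype.card_fin, nsmul_eq_mul, NNReal.coe_mul, hn,
      NNReal.coe_natCast]
    rcases Nat.eq_zero_or_pos m with rfl | hm
    · simp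
    · have : (0 : ℝ) < m := by exact_mod_cast hm
      field_simp
  have hset : {ω : (Fin m → SpaceTime d) × (Fin m → ℝ) |
        m * ε ≤ |∑ r, ψ (ω.1 r) - m * ∫ w, ψ w ∂stdGaussian (SpaceTime d)|} ⊆
      {ω | ω.1 ∈ {w : Fin m → SpaceTime d |
        m * ε ≤ ∑ r, (ψ (w r) - ∫ v, ψ v ∂stdGaussian (SpaceTime d))}} ∪
      {ω | ω.1 ∈ {w : Fin m → SpaceTime d |
        m * ε ≤ ∑ r, (-ψ (w r) - ∫ v, -ψ v ∂stdGaussian (SpaceTime d))}} := by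
    intro ω hω
    rcases le_abs.1 (Set.mem_ofPred_eq ▸ hω :) with h | h
    · exact Or.inl (by simpa using h)
    · refine Or.inr ?_
      rw [neg_sub, sub_eq_neg_add] at h
      simpa [integral_neg, Finset.sum_add_distrib, Finset.sum_neg_distrib] using h
  refine (measureReal_mono hset).trans ((measureReal_union_le _ _).trans ?_)
  rw [initLaw_real_fst_preimage, initLaw_real_fst_preimage]
  have ha := one ψ hψ hψK
  have hb := one (fun w => -ψ w) hψ.neg (by simpa using hψK)
  linarith

/-- All initial weights are bounded with high probability. -/
lemma initLaw_norm_tail (H : ℝ) :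
    (initLaw d m).real {ω | ∃ r, H < 1 + ‖ω.1 r‖ ^ 2} ≤
      m * Real.exp ((d + 1) / 2 - (H - 1) / 4) := by
  have hset : {ω : (Fin m → SpaceTime d) × (Fin m → ℝ) | ∃ r, H < 1 + ‖ω.1 r‖ ^ 2} =
      {ω | ω.1 ∈ ⋃ r : Fin m, {w : Fin m → SpaceTime d | H < 1 + ‖w r‖ ^ 2}} := by
    ext; simp
  rw [hset, initLaw_real_fst_preimage]
  refine (measureReal_iUnion_fintype_le _).trans ?_
  calc _ ≤ ∑ _r : Fin m, Real.exp ((d + 1) / 2 - (H - 1) / 4) := by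
        refine Finset.sum_le_sum fun r _ => ?_
        refine le_trans (le_of_eq ?_) (stdGaussian_tail H)
        have hS : MeasurableSet {x : SpaceTime d | H < 1 + ‖x‖ ^ 2} :=
          measurableSet_lt (by fun_prop) (by fun_prop)
        exact (measurePreserving_eval (fun _ : Fin m => stdGaussian (SpaceTime d))
          r).measureReal_preimage
          hS.nullMeasurableSet
    _ = _ := by simp

end Concentration

/-! ### The high-probability event at initialization. -/

section GoodEvent

variable {d m : ℕ} {ι : Type*} [Fintype ι] {c t : ι → ℝ} {φ : ι → SpaceTime d → ℝ}
  {γ : ι → SpaceTime d → SpaceTime d} {b : ℝ}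

lemma FeatureBound.continuous_val (h : FeatureBound φ γ b) (i : ι) : Continuous (φ i) :=
  continuous_iff_continuousAt.2 fun w =>
    (hasGradientAt_iff_hasFDerivAt.1 (h.hasGrad i w)).continuousAt

lemma FeatureBound.continuous_grad (h : FeatureBound φ γ b) (i : ι) : Continuous (γ i) := by
  refine continuous_iff_continuousAt.2 fun w => ?_
  rw [ContinuousAt, tendsto_iff_norm_sub_tendsto_zero]
  have hc : Continuous fun v : SpaceTime d => b * (1 + ‖v‖ ^ 2 + ‖w‖ ^ 2) * ‖v - w‖ := by fun_prop
  have h0 := hc.tendsto w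
  simp only [sub_self, norm_zero, mul_zero] at h0
  exact squeeze_zero (fun v => norm_nonneg _) (fun v => h.lip i v w) h0

lemma norm_sq_sum_smul (x : EuclideanSpace ℝ ι) (g : ι → SpaceTime d) :
    ‖∑ i, (x i * c i) • g i‖ ^ 2 = ∑ i, ∑ j, (x i * c i) * (x j * c j) * inner ℝ (g i) (g j) := by
  rw [← real_inner_self_eq_norm_sq, sum_inner]
  refine Finset.sum_congr rfl fun i _ => ?_
  rw [inner_sum]
  refine Finset.sum_congr rfl fun j _ => ?_
  rw [real_inner_smul_left, real_inner_smul_right]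
  ring

lemma FeatureBound.integrable_norm_sq_sum (h : FeatureBound φ γ b) (hc : ∑ i, c i ^ 2 ≤ 2)
    (x : EuclideanSpace ℝ ι) :
    Integrable (fun w => ‖∑ i, (x i * c i) • γ i w‖ ^ 2) (stdGaussian (SpaceTime d)) := by
  have hγ := h.continuous_grad
  refine ((integrable_one_add_norm_sq_pow 2).const_mul (4 * b ^ 2 * ‖x‖ ^ 2)).mono'
    (by fun_prop) (Filter.Eventually.of_forall fun w => ?_)
  rw [Real.norm_of_nonneg (by positivity)]
  have := norm_sum_smul_le hc x (g := fun i => γ i w) fun i => h.grad i w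
  calc _ ≤ (2 * (b * (1 + ‖w‖ ^ 2)) * ‖x‖) ^ 2 := by gcongr
    _ = _ := by ring

lemma FeatureBound.integrable_inner (h : FeatureBound φ γ b) (i j : ι) :
    Integrable (fun w => inner ℝ (γ i w) (γ j w)) (stdGaussian (SpaceTime d)) := by
  refine ((integrable_one_add_norm_sq_pow 2).const_mul (b ^ 2)).mono'
    ((h.continuous_grad i).inner (h.continuous_grad j)).aestronglyMeasurable
    (Filter.Eventually.of_forall fun w => ?_)
  have hb : 0 ≤ b := zero_le_one.trans h.one_le
  calc ‖inner ℝ (γ i w) (γ j w)‖ ≤ ‖γ i w‖ * ‖γ j w‖ := abs_real_inner_le_norm _ _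
    _ ≤ (b * (1 + ‖w‖ ^ 2)) * (b * (1 + ‖w‖ ^ 2)) := by
        gcongr; exacts [h.grad i w, h.grad j w]
    _ = _ := by ring

/-- Gram entries, truncated to bounded weights. -/
noncomputable def truncGram (γ : ι → SpaceTime d → SpaceTime d) (V : ℝ) (i j : ι)
    (w : SpaceTime d) : ℝ :=
  if 1 + ‖w‖ ^ 2 ≤ V then inner ℝ (γ i w) (γ j w) else 0

lemma FeatureBound.measurable_truncGram (h : FeatureBound φ γ b) (V : ℝ) (i j : ι) :
    Measurable (truncGram γ V i j) := by
  have hγ := h.continuous_grad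
  refine Measurable.ite (measurableSet_le (by fun_prop) (by fun_prop)) ?_ measurable_const
  exact ((hγ i).inner (hγ j)).measurable

lemma FeatureBound.abs_truncGram_le (h : FeatureBound φ γ b) (V : ℝ) (i j : ι) (w : SpaceTime d) :
    |truncGram γ V i j w| ≤ b ^ 2 * V ^ 2 := by
  have hb : 0 ≤ b := zero_le_one.trans h.one_le
  unfold truncGram
  split_ifs with hw
  · have hQ : 0 ≤ 1 + ‖w‖ ^ 2 := by positivity
    have hV : 0 ≤ V := hQ.trans hw
    calc _ ≤ ‖γ i w‖ * ‖γ j w‖ := abs_real_inner_le_norm _ _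
      _ ≤ (b * V) * (b * V) := by
        have hi := (h.grad i w).trans (mul_le_mul_of_nonneg_left hw hb)
        have hj := (h.grad j w).trans (mul_le_mul_of_nonneg_left hw hb)
        gcongr
      _ = _ := by ring
  · rw [abs_zero]; positivity

lemma sum_truncGram (x : EuclideanSpace ℝ ι) (V : ℝ) (w : SpaceTime d) :
    ∑ i, ∑ j, (x i * c i) * (x j * c j) * truncGram γ V i j w =
      if 1 + ‖w‖ ^ 2 ≤ V then ‖∑ i, (x i * c i) • γ i w‖ ^ 2 else 0 := by
  unfold truncGram
  split_ifs
  · rw [norm_sq_sum_smul]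
  · simp

/-- Where `1 + ‖w‖² > V`, the integrand is at most `4b²‖x‖² (1 + ‖w‖²)⁶ / V⁴`. By the sixth moment
this costs at most `lam/16`; the constant is `4 · 16 · 12000000`. -/
lemma FeatureBound.truncGram_form_ge (h : FeatureBound φ γ b) (hc : ∑ i, c i ^ 2 ≤ 2)
    (hd : 0 < d) {lam V : ℝ} (hV : 0 < V) (hVlam : 768000000 * b ^ 2 * d ^ 6 ≤ lam * V ^ 4)
    (hG : ∀ x : EuclideanSpace ℝ ι, lam * ‖x‖ ^ 2 ≤
      ∫ w, ‖∑ i, (x i * c i) • γ i w‖ ^ 2 ∂stdGaussian (SpaceTime d))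
    (x : EuclideanSpace ℝ ι) :
    15 / 16 * lam * ‖x‖ ^ 2 ≤ ∑ i, ∑ j, (x i * c i) * (x j * c j) *
      ∫ w, truncGram γ V i j w ∂stdGaussian (SpaceTime d) := by
  have hb : 0 ≤ b := zero_le_one.trans h.one_le
  have hint : ∀ i j, Integrable (truncGram γ V i j) (stdGaussian (SpaceTime d)) := fun i j =>
    Integrable.of_bound (h.measurable_truncGram V i j).aestronglyMeasurable (b ^ 2 * V ^ 2)
      (Filter.Eventually.of_forall fun w => h.abs_truncGram_le V i j w)
  have hint2 : ∀ i j, Integrable (fun w => (x i * c i) * (x j * c j) * truncGram γ V i j w)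
      (stdGaussian (SpaceTime d)) := fun i j => (hint i j).const_mul _
  have e1 : ∑ i, ∑ j, (x i * c i) * (x j * c j) *
      ∫ w, truncGram γ V i j w ∂stdGaussian (SpaceTime d) =
      ∫ w, ∑ i, ∑ j, (x i * c i) * (x j * c j) * truncGram γ V i j w
        ∂stdGaussian (SpaceTime d) := by
    rw [integral_finsetSum _ fun i _ => integrable_finsetSum _ fun j _ => hint2 i j]
    refine Finset.sum_congr rfl fun i _ => ?_
    rw [integral_finsetSum _ fun j _ => hint2 i j]
    exact Finset.sum_congr rfl fun j _ => (integral_const_mul _ _).symm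
  rw [e1]
  have hS : Integrable (fun w => ‖∑ i, (x i * c i) • γ i w‖ ^ 2) (stdGaussian (SpaceTime d)) :=
    h.integrable_norm_sq_sum hc x
  have hQ := integrable_one_add_norm_sq_pow (d := d) 6
  have hle : ∫ w, (‖∑ i, (x i * c i) • γ i w‖ ^ 2 -
      4 * b ^ 2 * ‖x‖ ^ 2 / V ^ 4 * (1 + ‖w‖ ^ 2) ^ 6) ∂stdGaussian (SpaceTime d) ≤
      ∫ w, ∑ i, ∑ j, (x i * c i) * (x j * c j) * truncGram γ V i j w
        ∂stdGaussian (SpaceTime d) := by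
    refine integral_mono (hS.sub (hQ.const_mul _))
      (integrable_finsetSum _ fun i _ => integrable_finsetSum _ fun j _ => hint2 i j)
      fun w => ?_
    simp only [sum_truncGram]
    split_ifs with hw
    · have : 0 ≤ 4 * b ^ 2 * ‖x‖ ^ 2 / V ^ 4 * (1 + ‖w‖ ^ 2) ^ 6 := by positivity
      linarith
    · push Not at hw
      have h1 := norm_sum_smul_le hc x (g := fun i => γ i w) fun i => h.grad i w
      rw [sub_nonpos]
      calc ‖∑ i, (x i * c i) • γ i w‖ ^ 2 ≤ (2 * (b * (1 + ‖w‖ ^ 2)) * ‖x‖) ^ 2 := by gcongr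
        _ = 4 * b ^ 2 * ‖x‖ ^ 2 / V ^ 4 * ((1 + ‖w‖ ^ 2) ^ 2 * V ^ 4) := by field_simp; ring
        _ ≤ 4 * b ^ 2 * ‖x‖ ^ 2 / V ^ 4 * ((1 + ‖w‖ ^ 2) ^ 2 * (1 + ‖w‖ ^ 2) ^ 4) := by gcongr
        _ = _ := by ring
  refine le_trans ?_ hle
  rw [integral_sub hS (hQ.const_mul _), integral_const_mul]
  have h6 := integral_one_add_norm_sq_pow_six hd
  have h7 : 4 * b ^ 2 * ‖x‖ ^ 2 / V ^ 4 *
      ∫ w : SpaceTime d, (1 + ‖w‖ ^ 2) ^ 6 ∂stdGaussian (SpaceTime d) ≤ lam * ‖x‖ ^ 2 / 16 := by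
    calc _ ≤ 4 * b ^ 2 * ‖x‖ ^ 2 / V ^ 4 * (12000000 * (d : ℝ) ^ 6) := by gcongr
      _ = (768000000 * b ^ 2 * d ^ 6) * (‖x‖ ^ 2 / (16 * V ^ 4)) := by field_simp; ring
      _ ≤ (lam * V ^ 4) * (‖x‖ ^ 2 / (16 * V ^ 4)) := by gcongr
      _ = _ := by field_simp
  have := hG x
  linarith

/-- Entrywise closeness of the truncated Gram averages bounds the quadratic form from below. -/
lemma truncGram_sum_ge (hc : ∑ i, c i ^ 2 ≤ 2) (hm : 0 < m) {lam V : ℝ} {G : ι → ι → ℝ}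
    (w : Fin m → SpaceTime d) (hlam : 0 ≤ lam)
    (hdev : ∀ i j, |∑ r, truncGram γ V i j (w r) - m * G i j| ≤ m * (lam / 64))
    (hG : ∀ x : EuclideanSpace ℝ ι, 15 / 16 * lam * ‖x‖ ^ 2 ≤
      ∑ i, ∑ j, (x i * c i) * (x j * c j) * G i j)
    (x : EuclideanSpace ℝ ι) :
    7 / 8 * lam * ‖x‖ ^ 2 ≤ 1 / m *
      ∑ r with 1 + ‖w r‖ ^ 2 ≤ V, ‖∑ i, (x i * c i) • γ i (w r)‖ ^ 2 := by
  have hm' : (0 : ℝ) < m := by exact_mod_cast hm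
  have e1 : ∑ r with 1 + ‖w r‖ ^ 2 ≤ V, ‖∑ i, (x i * c i) • γ i (w r)‖ ^ 2 =
      ∑ i, ∑ j, (x i * c i) * (x j * c j) * ∑ r, truncGram γ V i j (w r) := by
    rw [Finset.sum_filter]
    simp only [← sum_truncGram]
    rw [Finset.sum_comm]
    refine Finset.sum_congr rfl fun i _ => ?_
    rw [Finset.sum_comm]
    exact Finset.sum_congr rfl fun j _ => (Finset.mul_sum _ _ _).symm
  rw [e1]
  have h1 : ∑ i, ∑ j, (x i * c i) * (x j * c j) * (m * G i j) - m * (lam / 64) * (2 * ‖x‖) ^ 2 ≤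
      ∑ i, ∑ j, (x i * c i) * (x j * c j) * ∑ r, truncGram γ V i j (w r) := by
    have h2 : ∑ i, ∑ j, ((x i * c i) * (x j * c j) * (m * G i j) -
        |x i * c i| * |x j * c j| * (m * (lam / 64))) ≤
        ∑ i, ∑ j, (x i * c i) * (x j * c j) * ∑ r, truncGram γ V i j (w r) := by
      refine Finset.sum_le_sum fun i _ => Finset.sum_le_sum fun j _ => ?_
      have h3 : |(x i * c i) * (x j * c j) * (∑ r, truncGram γ V i j (w r) - m * G i j)| ≤
          |x i * c i| * |x j * c j| * (m * (lam / 64)) := by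
        rw [abs_mul, abs_mul]
        gcongr
        exact hdev i j
      have := (abs_le.1 h3).1
      linarith
    have h4 : ∑ i, ∑ j, |x i * c i| * |x j * c j| * (m * (lam / 64)) =
        m * (lam / 64) * (∑ i, |x i * c i|) ^ 2 := by
      rw [pow_two, Finset.sum_mul_sum, Finset.mul_sum]
      refine Finset.sum_congr rfl fun i _ => ?_
      rw [Finset.mul_sum]
      exact Finset.sum_congr rfl fun j _ => by ring
    simp only [Finset.sum_sub_distrib] at h2
    rw [h4] at h2
    -- The form deviates by at most `lam/64 · 4‖x‖² = lam/16 ‖x‖²`, whatever the number of samples,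
    -- because the weights `c` are normalized.
    have h5 : (∑ i, |x i * c i|) ^ 2 ≤ (2 * ‖x‖) ^ 2 := by
      have h0 : 0 ≤ ∑ i, |x i * c i| := Finset.sum_nonneg fun i _ => abs_nonneg _
      gcongr
      exact sum_abs_mul_le hc x
    have h6 : m * (lam / 64) * (∑ i, |x i * c i|) ^ 2 ≤ m * (lam / 64) * (2 * ‖x‖) ^ 2 := by gcongr
    linarith
  have h7 : ∑ i, ∑ j, (x i * c i) * (x j * c j) * (m * G i j) =
      m * ∑ i, ∑ j, (x i * c i) * (x j * c j) * G i j := by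
    simp only [Finset.mul_sum]
    exact Finset.sum_congr rfl fun i _ => Finset.sum_congr rfl fun j _ => by ring
  rw [h7] at h1
  rw [one_div, ← div_eq_inv_mul, le_div_iff₀ hm']
  have := mul_le_mul_of_nonneg_left (hG x) hm'.le
  nlinarith

lemma norm_featVec_le_of_sums {a : Fin m → ℝ} (hc : ∑ i, c i ^ 2 ≤ 2) (hm : 0 < m) {A₁ : ℝ}
    (ht : ∀ i, |t i| ≤ b) (w : PiLp 2 (fun _ : Fin m => SpaceTime d)) (hA : 0 ≤ A₁) (hb : 0 ≤ b)
    (hS : ∀ i, |∑ r, a r * φ i (w r)| ≤ A₁ * √m) : ‖featVec c t φ a w‖ ≤ 2 * (A₁ + b) := by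
  have hM : 0 < √(m : ℝ) := Real.sqrt_pos.2 (by exact_mod_cast hm)
  apply le_of_sq_le_sq _ (by positivity)
  rw [PiLp.norm_sq_eq_of_L2]
  calc _ ≤ ∑ i, c i ^ 2 * (A₁ + b) ^ 2 := by
        refine Finset.sum_le_sum fun i _ => ?_
        simp only [featVec, featResidual, Real.norm_eq_abs, abs_mul, mul_pow, sq_abs]
        refine mul_le_mul_of_nonneg_left ?_ (sq_nonneg _)
        rw [← sq_abs]
        gcongr
        refine (abs_sub _ _).trans (add_le_add ?_ (ht i))
        rw [abs_mul, abs_of_pos (by positivity), one_div, ← div_eq_inv_mul, div_le_iff₀ hM]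
        exact hS i
    _ = (∑ i, c i ^ 2) * (A₁ + b) ^ 2 := by rw [Finset.sum_mul]
    _ ≤ 2 * (A₁ + b) ^ 2 := by gcongr
    _ ≤ _ := by nlinarith [sq_nonneg (A₁ + b)]

lemma exp_neg_mul_log_div {N δ : ℝ} (hN : 0 < N) (hδ : 0 < δ) (k : ℕ) :
    Real.exp (-(k * Real.log (N / δ))) = (δ / N) ^ k := by
  rw [← mul_neg, ← Real.log_inv, inv_div, Real.exp_nat_mul, Real.exp_log (by positivity)]

/-- The random initialization is well-behaved with probability at least `1 - δ`. -/
theorem exists_good_event (h : FeatureBound φ γ b) (hc : ∑ i, c i ^ 2 ≤ 2) (ht : ∀ i, |t i| ≤ b)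
    (hd : 0 < d) (hm : 2 ≤ m) (hN : 2 ≤ Fintype.card ι) {δ lam V : ℝ} (hδ : 0 < δ) (hδ1 : δ < 1)
    (hlam : 0 < lam)
    (hG : ∀ x : EuclideanSpace ℝ ι, lam * ‖x‖ ^ 2 ≤
      ∫ w, ‖∑ i, (x i * c i) • γ i w‖ ^ 2 ∂stdGaussian (SpaceTime d))
    (hV : 0 < V) (hVlam : 768000000 * b ^ 2 * d ^ 6 ≤ lam * V ^ 4)
    (hlm : Real.log (Fintype.card ι / δ) ≤ m)
    (hmV : 49152 * Real.log (Fintype.card ι / δ) * b ^ 4 * V ^ 4 ≤ m * lam ^ 2) :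
    ∃ S : Set ((Fin m → SpaceTime d) × (Fin m → ℝ)), MeasurableSet S ∧
      1 - δ ≤ (initLaw d m).real S ∧ ∀ ω ∈ S, (∀ r, |ω.2 r| = 1) ∧
        (∀ r, 1 + ‖ω.1 r‖ ^ 2 ≤ 20 * d * Real.log (m / δ)) ∧
        ‖featVec c t φ ω.2 (WithLp.toLp 2 ω.1)‖ ≤
          68 * b * d * √(Real.log (Fintype.card ι / δ)) ∧
        ∀ x : EuclideanSpace ℝ ι, 7 / 8 * lam * ‖x‖ ^ 2 ≤ 1 / m *
          ∑ r with 1 + ‖ω.1 r‖ ^ 2 ≤ V, ‖∑ i, (x i * c i) • γ i (ω.1 r)‖ ^ 2 := by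
  have hb1 : 1 ≤ b := h.one_le
  have hb : 0 < b := by linarith
  have hd' : (1 : ℝ) ≤ d := by exact_mod_cast hd
  have hm2 : (2 : ℝ) ≤ m := by exact_mod_cast hm
  have hN2 : (2 : ℝ) ≤ Fintype.card ι := by exact_mod_cast hN
  set N : ℝ := (Fintype.card ι : ℝ) with hNdef
  set l := Real.log (N / δ) with hl
  set B := Real.log (m / δ) with hB
  have hlog2 : 0.6931471803 < Real.log 2 := Real.log_two_gt_d9
  have hl2 : Real.log 2 ≤ l := by
    refine Real.log_le_log (by norm_num) ?_
    rw [le_div_iff₀ hδ]; nlinarith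
  have hB2 : Real.log 2 ≤ B := by
    refine Real.log_le_log (by norm_num) ?_
    rw [le_div_iff₀ hδ]; nlinarith
  set H := 20 * d * B with hH
  set S₀ : Set ((Fin m → SpaceTime d) × (Fin m → ℝ)) := {ω | ¬ ∀ r, |ω.2 r| = 1} with hS₀
  set S₁ : Set ((Fin m → SpaceTime d) × (Fin m → ℝ)) := {ω | ∃ r, H < 1 + ‖ω.1 r‖ ^ 2} with hS₁
  set S₂ : ι → Set ((Fin m → SpaceTime d) × (Fin m → ℝ)) := fun i =>
    {ω | 32 * b * d * √l * √m ≤ |∑ r, ω.2 r * φ i (ω.1 r)|} with hS₂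
  set S₃ : ι → ι → Set ((Fin m → SpaceTime d) × (Fin m → ℝ)) := fun i j =>
    {ω | m * (lam / 64) ≤ |∑ r, truncGram γ V i j (ω.1 r) -
      m * ∫ w, truncGram γ V i j w ∂stdGaussian (SpaceTime d)|} with hS₃
  have p0 : (initLaw d m).real S₀ = 0 := by
    rw [measureReal_def, show initLaw d m S₀ = 0 from ae_initLaw_abs]; rfl
  have p1 : (initLaw d m).real S₁ ≤ δ / 4 := by
    refine (initLaw_norm_tail H).trans ?_
    have h1 : ((d : ℝ) + 1) / 2 - (H - 1) / 4 ≤ -(Real.log 2 + Real.log 2 + B) := by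
      have : (d : ℝ) * Real.log 2 ≤ d * B := by gcongr
      have : Real.log 2 ≤ d * Real.log 2 := by nlinarith
      have : B ≤ d * B := by nlinarith
      rw [hH]
      nlinarith
    calc _ ≤ m * Real.exp (-(Real.log 2 + Real.log 2 + B)) := by gcongr
      _ = δ / 4 := by
        rw [Real.exp_neg, Real.exp_add, Real.exp_add, Real.exp_log (by norm_num),
          Real.exp_log (by positivity)]
        field_simp
        norm_num
  have p2 : (initLaw d m).real (⋃ i, S₂ i) ≤ δ / 4 := by
    refine (measureReal_iUnion_fintype_le _).trans ?_
    calc _ ≤ ∑ _i : ι, 2 * (δ / N) ^ 5 := by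
          refine Finset.sum_le_sum fun i _ => ?_
          refine (initLaw_signed_sum_tail hd (by omega) hb (h.continuous_val i) (h.val i)
            (by linarith : 0 ≤ l) hlm).trans (le_of_eq ?_)
          have := exp_neg_mul_log_div (by linarith : 0 < N) hδ 5
          push_cast at this
          rw [this]
      _ = 2 * δ ^ 5 / N ^ 4 := by
          rw [Finset.sum_const, Finset.card_univ, nsmul_eq_mul, ← hNdef]
          have : N ≠ 0 := by linarith
          field_simp
      _ ≤ 2 * δ / 2 ^ 4 := by
          gcongr
          exact pow_le_of_le_one hδ.le hδ1.le (by norm_num)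
      _ ≤ δ / 4 := by linarith
  have p3 : (initLaw d m).real (⋃ i, ⋃ j, S₃ i j) ≤ δ / 4 := by
    -- Since `49152 = 2 · 6 · 64²`, the Hoeffding exponent is at least `6 log(N/δ)`; the union over
    -- `N²` pairs still leaves `N⁻⁴`.
    have hone : ∀ i j, (initLaw d m).real (S₃ i j) ≤ 2 * (δ / N) ^ 6 := by
      intro i j
      refine (initLaw_hoeffding (K := b ^ 2 * V ^ 2) (by positivity)
        (h.measurable_truncGram V i j) (h.abs_truncGram_le V i j)
        (by positivity : 0 ≤ lam / 64)).trans ?_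
      have h6 := exp_neg_mul_log_div (by linarith : 0 < N) hδ 6
      rw [← h6]
      gcongr
      rw [le_div_iff₀ (by positivity)]
      push_cast
      nlinarith
    refine (measureReal_iUnion_fintype_le _).trans ?_
    calc _ ≤ ∑ _i : ι, ∑ _j : ι, 2 * (δ / N) ^ 6 := by
          refine Finset.sum_le_sum fun i _ => ?_
          exact (measureReal_iUnion_fintype_le _).trans (Finset.sum_le_sum fun j _ => hone i j)
      _ = 2 * δ ^ 6 / N ^ 4 := by
          simp only [Finset.sum_const, Finset.card_univ, nsmul_eq_mul, ← hNdef]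
          have : N ≠ 0 := by linarith
          field_simp
      _ ≤ 2 * δ / 2 ^ 4 := by
          gcongr
          exact pow_le_of_le_one hδ.le hδ1.le (by norm_num)
      _ ≤ δ / 4 := by linarith
  set bad := S₀ ∪ S₁ ∪ (⋃ i, S₂ i) ∪ ⋃ i, ⋃ j, S₃ i j with hbad
  have pbad : (initLaw d m).real bad ≤ δ := by
    have e1 := measureReal_union_le (μ := initLaw d m) (S₀ ∪ S₁ ∪ ⋃ i, S₂ i) (⋃ i, ⋃ j, S₃ i j)
    have e2 := measureReal_union_le (μ := initLaw d m) (S₀ ∪ S₁) (⋃ i, S₂ i)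
    have e3 := measureReal_union_le (μ := initLaw d m) S₀ S₁
    linarith
  -- A measurable hull of the bad set has the same measure, so measurability of the individual
  -- events need not be shown.
  refine ⟨(toMeasurable (initLaw d m) bad)ᶜ, (measurableSet_toMeasurable _ _).compl, ?_, ?_⟩
  · rw [probReal_compl_eq_one_sub (measurableSet_toMeasurable _ _), measureReal_def,
      measure_toMeasurable, ← measureReal_def]
    linarith
  · intro ω hω
    have hω' : ω ∉ bad := fun hh => hω (subset_toMeasurable _ _ hh)
    simp only [hbad, Set.mem_union, Set.mem_iUnion, not_or, not_exists] at hω'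
    obtain ⟨⟨⟨w0, w1⟩, w2⟩, w3⟩ := hω'
    have w0' : ∀ r, |ω.2 r| = 1 := not_not.1 w0
    have w1' : ∀ r, 1 + ‖ω.1 r‖ ^ 2 ≤ H := fun r => not_lt.1 fun hh => w1 ⟨r, hh⟩
    refine ⟨w0', w1', ?_, ?_⟩
    · refine (norm_featVec_le_of_sums (A₁ := 32 * b * d * √l) hc (by omega) ht
        (WithLp.toLp 2 ω.1) (by positivity) hb.le fun i => (not_le.1 (w2 i)).le).trans ?_
      -- Lets the target term `2b` be absorbed as `4bd√l`, so that `64 + 4 = 68`.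
      have hsl : 1 / 2 ≤ √l := by
        apply Real.le_sqrt_of_sq_le
        linarith
      have : 1 / 2 ≤ d * √l := by nlinarith
      nlinarith
    · exact truncGram_sum_ge hc (by omega) ω.1 hlam.le (fun i j => (not_le.1 (w3 i j)).le)
        (h.truncGram_form_ge hc hd hV hVlam hG)

end GoodEvent

/-! ### The heat-equation residuals as features of single neurons. -/

section Features

variable {d m : ℕ} {σ : ℝ → ℝ} {c : ℝ}

lemma ActivationAssumption.hasDerivAt (h : ActivationAssumption σ c) (k : ℕ) (z : ℝ) :
    HasDerivAt (iteratedDeriv k σ) (iteratedDeriv (k + 1) σ z) z := by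
  have hs : ContDiff ℝ ⊤ σ := contDiff_iff_contDiffAt.2 fun z => (h.analytic z).contDiffAt
  have hd : Differentiable ℝ (iteratedDeriv k σ) :=
    hs.differentiable_iteratedDeriv k (by exact_mod_cast WithTop.coe_lt_top _)
  rw [iteratedDeriv_succ]
  exact (hd z).hasDerivAt

/-- The Lipschitz constant of the derivative of order `k - 1` bounds the one of order `k`. Order
zero is excluded: `σ` itself may grow linearly. -/
lemma ActivationAssumption.abs_iteratedDeriv_le (h : ActivationAssumption σ c) {κ : ℝ}
    (hκ : c ≤ κ) {k : ℕ} (h1 : 1 ≤ k) (h3 : k ≤ 3) (z : ℝ) : |iteratedDeriv k σ z| ≤ κ := by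
  obtain ⟨j, rfl⟩ := Nat.exists_eq_add_of_le' h1
  have hc : 0 ≤ c := (abs_nonneg _).trans (h.bounded_third 0)
  refine le_trans ?_ hκ
  have := (h.hasDerivAt j z).le_of_lip' hc
    (Filter.Eventually.of_forall fun y => h.lipschitz j (by omega) y z)
  simpa using this

lemma ActivationAssumption.lip (h : ActivationAssumption σ c) {κ : ℝ} (hκ : c ≤ κ) {k : ℕ}
    (h3 : k ≤ 3) {x : SpaceTime d} (hx : ‖x‖ ≤ 1) (v w : SpaceTime d) :
    |iteratedDeriv k σ (inner ℝ v x) - iteratedDeriv k σ (inner ℝ w x)| ≤ κ * ‖v - w‖ := by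
  have hc : 0 ≤ c := (abs_nonneg _).trans (h.bounded_third 0)
  refine (h.lipschitz k h3 _ _).trans ?_
  rw [← inner_sub_left]
  have : |inner ℝ (v - w) x| ≤ ‖v - w‖ := (abs_real_inner_le_norm _ _).trans
    (mul_le_of_le_one_right (norm_nonneg _) hx)
  exact mul_le_mul hκ this (abs_nonneg _) (hc.trans hκ)

/-- The unit vector in the time direction. -/
noncomputable def timeDir (d : ℕ) : SpaceTime d := EuclideanSpace.single 0 1

lemma norm_timeDir : ‖timeDir d‖ = 1 := by simp [timeDir]

/-- Squared norm of the spatial part. -/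
noncomputable def spaceSq (w : SpaceTime d) : ℝ := ‖w‖ ^ 2 - w 0 ^ 2

lemma spaceSq_eq_sum (w : SpaceTime d) : spaceSq w = ∑ i : Fin d, w i.succ ^ 2 := by
  simp [spaceSq, EuclideanSpace.norm_sq_eq, Fin.sum_univ_succ]

lemma abs_time_le (w : SpaceTime d) : |w 0| ≤ ‖w‖ := PiLp.norm_apply_le w 0

lemma spaceSq_nonneg (w : SpaceTime d) : 0 ≤ spaceSq w := by
  rw [spaceSq_eq_sum]; positivity

lemma spaceSq_le (w : SpaceTime d) : spaceSq w ≤ ‖w‖ ^ 2 := by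
  unfold spaceSq; linarith [sq_nonneg (w 0)]

lemma abs_spaceSq_sub_le (v w : SpaceTime d) :
    |spaceSq v - spaceSq w| ≤ 2 * (‖v‖ + ‖w‖) * ‖v - w‖ := by
  have e : spaceSq v - spaceSq w =
      (‖v‖ + ‖w‖) * (‖v‖ - ‖w‖) - (v 0 + w 0) * (v 0 - w 0) := by unfold spaceSq; ring
  rw [e]
  have h1 : |‖v‖ - ‖w‖| ≤ ‖v - w‖ := abs_norm_sub_norm_le v w
  have h2 : |v 0 - w 0| ≤ ‖v - w‖ := by simpa using abs_time_le (v - w)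
  have h3 : |v 0 + w 0| ≤ ‖v‖ + ‖w‖ :=
    (abs_add_le _ _).trans (add_le_add (abs_time_le v) (abs_time_le w))
  refine (abs_sub _ _).trans ?_
  rw [abs_mul, abs_mul, abs_of_nonneg (by positivity : 0 ≤ ‖v‖ + ‖w‖)]
  have : (‖v‖ + ‖w‖) * |‖v‖ - ‖w‖| ≤ (‖v‖ + ‖w‖) * ‖v - w‖ := by gcongr
  have : |v 0 + w 0| * |v 0 - w 0| ≤ (‖v‖ + ‖w‖) * ‖v - w‖ := by gcongr
  linarith

/-- Heat operator applied to a single neuron, as a function of its weight. -/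
noncomputable def heatFeature (σ : ℝ → ℝ) (x w : SpaceTime d) : ℝ :=
  w 0 * iteratedDeriv 1 σ (inner ℝ w x) - spaceSq w * iteratedDeriv 2 σ (inner ℝ w x)

/-- Gradient of `heatFeature` in the weight. -/
noncomputable def heatFeatureGrad (σ : ℝ → ℝ) (x w : SpaceTime d) : SpaceTime d :=
  iteratedDeriv 1 σ (inner ℝ w x) • timeDir d + (w 0 * iteratedDeriv 2 σ (inner ℝ w x)) • x
    - ((2 * iteratedDeriv 2 σ (inner ℝ w x)) • (w - w 0 • timeDir d)
      + (spaceSq w * iteratedDeriv 3 σ (inner ℝ w x)) • x)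

lemma hasFDerivAt_inner_left (x w : SpaceTime d) :
    HasFDerivAt (fun w : SpaceTime d => inner ℝ w x) (InnerProductSpace.toDual ℝ _ x) w := by
  have : (fun w : SpaceTime d => inner ℝ w x) = InnerProductSpace.toDual ℝ (SpaceTime d) x := by
    ext w; simp [real_inner_comm]
  rw [this]
  exact ContinuousLinearMap.hasFDerivAt _

lemma hasFDerivAt_time (w : SpaceTime d) :
    HasFDerivAt (fun w : SpaceTime d => w 0) (InnerProductSpace.toDual ℝ _ (timeDir d)) w := by
  have : (fun w : SpaceTime d => w 0) = InnerProductSpace.toDual ℝ (SpaceTime d) (timeDir d) := by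
    ext w; simp [timeDir, EuclideanSpace.inner_single_left]
  rw [this]
  exact ContinuousLinearMap.hasFDerivAt _

lemma ActivationAssumption.hasFDerivAt_comp_inner (h : ActivationAssumption σ c) (k : ℕ)
    (x w : SpaceTime d) :
    HasFDerivAt (fun w : SpaceTime d => iteratedDeriv k σ (inner ℝ w x))
      (iteratedDeriv (k + 1) σ (inner ℝ w x) • InnerProductSpace.toDual ℝ _ x) w :=
  HasDerivAt.comp_hasFDerivAt (h₂ := iteratedDeriv k σ) w (h.hasDerivAt k (inner ℝ w x))
    (hasFDerivAt_inner_left x w)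

lemma hasGradientAt_heatFeature (h : ActivationAssumption σ c) (x w : SpaceTime d) :
    HasGradientAt (heatFeature σ x) (heatFeatureGrad σ x w) w := by
  rw [hasGradientAt_iff_hasFDerivAt]
  have h1 := (hasFDerivAt_time w).mul (h.hasFDerivAt_comp_inner 1 x w)
  have h2 := (((hasFDerivAt_id w).norm_sq.sub ((hasFDerivAt_time w).pow 2))).mul
    (h.hasFDerivAt_comp_inner 2 x w)
  refine (h1.sub h2).congr_fderiv ?_
  ext v
  simp [heatFeatureGrad, spaceSq]
  ring

lemma hasGradientAt_neuron (h : ActivationAssumption σ c) (x w : SpaceTime d) :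
    HasGradientAt (fun w : SpaceTime d => σ (inner ℝ w x))
      (iteratedDeriv 1 σ (inner ℝ w x) • x) w := by
  rw [hasGradientAt_iff_hasFDerivAt]
  have := h.hasFDerivAt_comp_inner 0 x w
  simp only [iteratedDeriv_zero] at this
  simpa using this

lemma abs_heatFeature_le (h : ActivationAssumption σ c) {κ : ℝ} (hκ : c ≤ κ)
    (x w : SpaceTime d) : |heatFeature σ x w| ≤ 2 * κ * (1 + ‖w‖ ^ 2) := by
  have hκ0 : 0 ≤ κ := ((abs_nonneg _).trans (h.bounded_third 0)).trans hκ
  unfold heatFeature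
  refine (abs_sub _ _).trans ?_
  rw [abs_mul, abs_mul, abs_of_nonneg (spaceSq_nonneg w)]
  have h1 := h.abs_iteratedDeriv_le hκ (k := 1) le_rfl (by norm_num) (inner ℝ w x)
  have h2 := h.abs_iteratedDeriv_le hκ (k := 2) (by norm_num) (by norm_num) (inner ℝ w x)
  calc _ ≤ ‖w‖ * κ + ‖w‖ ^ 2 * κ := by
        gcongr
        · exact abs_time_le w
        · exact spaceSq_le w
    _ ≤ _ := by nlinarith [mul_nonneg hκ0 (sq_nonneg (‖w‖ - 1)), mul_nonneg hκ0 (sq_nonneg ‖w‖)]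

lemma norm_sub_time_le (w : SpaceTime d) : ‖w - w 0 • timeDir d‖ ≤ 2 * ‖w‖ := by
  refine (norm_sub_le _ _).trans ?_
  rw [norm_smul, norm_timeDir, mul_one, Real.norm_eq_abs]
  linarith [abs_time_le w]

lemma norm_heatFeatureGrad_le (h : ActivationAssumption σ c) {κ : ℝ} (hκ : c ≤ κ)
    {x : SpaceTime d} (hx : ‖x‖ ≤ 1) (w : SpaceTime d) :
    ‖heatFeatureGrad σ x w‖ ≤ 20 * κ * (1 + ‖w‖ ^ 2) := by
  have hκ0 : 0 ≤ κ := ((abs_nonneg _).trans (h.bounded_third 0)).trans hκ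
  have h1 := h.abs_iteratedDeriv_le hκ (k := 1) le_rfl (by norm_num) (inner ℝ w x)
  have h2 := h.abs_iteratedDeriv_le hκ (k := 2) (by norm_num) (by norm_num) (inner ℝ w x)
  have h3 := h.abs_iteratedDeriv_le hκ (k := 3) (by norm_num) le_rfl (inner ℝ w x)
  unfold heatFeatureGrad
  refine (norm_sub_le _ _).trans ((add_le_add (norm_add_le _ _) (norm_add_le _ _)).trans ?_)
  simp only [norm_smul, norm_mul, Real.norm_eq_abs, norm_timeDir, abs_of_nonneg (spaceSq_nonneg w)]
  calc _ ≤ κ * 1 + ‖w‖ * κ * 1 + (|2| * κ * (2 * ‖w‖) + ‖w‖ ^ 2 * κ * 1) := by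
        gcongr
        · exact abs_time_le w
        · exact norm_sub_time_le w
        · exact spaceSq_le w
    _ ≤ _ := by
        rw [abs_of_pos (by norm_num : (0 : ℝ) < 2)]
        nlinarith [mul_nonneg hκ0 (sq_nonneg (‖w‖ - 1)), mul_nonneg hκ0 (sq_nonneg ‖w‖)]

lemma norm_smul_sub_smul_le {E : Type*} [NormedAddCommGroup E] [NormedSpace ℝ E] (α β : ℝ)
    (u v : E) : ‖α • u - β • v‖ ≤ |α - β| * ‖u‖ + |β| * ‖u - v‖ := by
  have : α • u - β • v = (α - β) • u + β • (u - v) := by module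
  rw [this]
  refine (norm_add_le _ _).trans ?_
  simp [norm_smul]

lemma abs_mul_sub_mul_le (α β u v : ℝ) :
    |α * u - β * v| ≤ |α - β| * |u| + |β| * |u - v| := norm_smul_sub_smul_le α β u v

/-- Products are split one factor at a time. The Lipschitz bound for `σ'''` replaces a fourth
derivative, and the quadratic growth comes from the factor `spaceSq`. -/
lemma heatFeatureGrad_lip (h : ActivationAssumption σ c) {κ : ℝ} (hκ : c ≤ κ)
    {x : SpaceTime d} (hx : ‖x‖ ≤ 1) (v w : SpaceTime d) :
    ‖heatFeatureGrad σ x v - heatFeatureGrad σ x w‖ ≤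
      20 * κ * (1 + ‖v‖ ^ 2 + ‖w‖ ^ 2) * ‖v - w‖ := by
  have hκ0 : 0 ≤ κ := ((abs_nonneg _).trans (h.bounded_third 0)).trans hκ
  have l1 := h.lip hκ (k := 1) (by norm_num) hx v w
  have l2 := h.lip hκ (k := 2) (by norm_num) hx v w
  have l3 := h.lip hκ (k := 3) (by norm_num) hx v w
  have b2 := fun z => h.abs_iteratedDeriv_le hκ (k := 2) (by norm_num) (by norm_num) z
  have b3 := fun z => h.abs_iteratedDeriv_le hκ (k := 3) (by norm_num) le_rfl z
  have t0 : |v 0 - w 0| ≤ ‖v - w‖ := by simpa using abs_time_le (v - w)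
  unfold heatFeatureGrad
  set s1 := iteratedDeriv 1 σ (inner ℝ v x)
  set s1' := iteratedDeriv 1 σ (inner ℝ w x)
  set s2 := iteratedDeriv 2 σ (inner ℝ v x) with hs2
  set s2' := iteratedDeriv 2 σ (inner ℝ w x) with hs2'
  set s3 := iteratedDeriv 3 σ (inner ℝ v x) with hs3
  set s3' := iteratedDeriv 3 σ (inner ℝ w x)
  set Δ := ‖v - w‖ with hΔ
  have hΔ0 : 0 ≤ Δ := norm_nonneg _
  have p1 : ‖s1 • timeDir d - s1' • timeDir d‖ ≤ κ * Δ := by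
    rw [← sub_smul, norm_smul, norm_timeDir, mul_one]; exact l1
  have p2 : ‖(v 0 * s2) • x - (w 0 * s2') • x‖ ≤ Δ * κ + ‖w‖ * (κ * Δ) := by
    rw [← sub_smul, norm_smul]
    refine (mul_le_of_le_one_right (norm_nonneg _) hx).trans ?_
    refine (abs_mul_sub_mul_le _ _ _ _).trans ?_
    gcongr
    · exact b2 _
    · exact abs_time_le w
  have p3 : ‖(2 * s2) • (v - v 0 • timeDir d) - (2 * s2') • (w - w 0 • timeDir d)‖ ≤
      2 * (κ * Δ) * (2 * ‖v‖) + 2 * κ * (2 * Δ) := by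
    refine (norm_smul_sub_smul_le _ _ _ _).trans ?_
    have e1 : |2 * s2 - 2 * s2'| ≤ 2 * (κ * Δ) := by
      rw [← mul_sub, abs_mul, abs_of_pos (by norm_num : (0 : ℝ) < 2)]; gcongr
    have e2 : |2 * s2'| ≤ 2 * κ := by
      rw [abs_mul, abs_of_pos (by norm_num : (0 : ℝ) < 2)]; gcongr; exact b2 _
    have e3 : v - v 0 • timeDir d - (w - w 0 • timeDir d) =
        (v - w) - (v - w) 0 • timeDir d := by
      simp only [PiLp.sub_apply, sub_smul]; abel
    rw [e3]
    gcongr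
    · exact norm_sub_time_le v
    · exact norm_sub_time_le (v - w)
  have p4 : ‖(spaceSq v * s3) • x - (spaceSq w * s3') • x‖ ≤
      2 * (‖v‖ + ‖w‖) * Δ * κ + ‖w‖ ^ 2 * (κ * Δ) := by
    rw [← sub_smul, norm_smul]
    refine (mul_le_of_le_one_right (norm_nonneg _) hx).trans ?_
    refine (abs_mul_sub_mul_le _ _ _ _).trans ?_
    rw [abs_of_nonneg (spaceSq_nonneg w)]
    gcongr
    · exact abs_spaceSq_sub_le v w
    · exact b3 _
    · exact spaceSq_le w
  have e : ∀ A B C D A' B' C' D' : SpaceTime d, A + B - (C + D) - (A' + B' - (C' + D')) =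
      (A - A') + (B - B') - ((C - C') + (D - D')) := by intros; abel
  rw [e]
  refine (norm_sub_le _ _).trans ((add_le_add (norm_add_le _ _) (norm_add_le _ _)).trans ?_)
  refine (add_le_add (add_le_add p1 p2) (add_le_add p3 p4)).trans ?_
  have hk : 0 ≤ κ * Δ := mul_nonneg hκ0 hΔ0
  nlinarith [mul_nonneg hk (sq_nonneg (‖w‖ - 1)), mul_nonneg hk (sq_nonneg (‖v‖ - 1)),
    mul_nonneg hk (sq_nonneg ‖v‖), mul_nonneg hk (sq_nonneg ‖w‖)]

variable {n₁ n₂ : ℕ}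

/-- The features of the network: heat operator at interior samples, value at boundary samples. -/
noncomputable def pinnFeature (σ : ℝ → ℝ) (D : TrainingData d n₁ n₂) :
    Fin n₁ ⊕ Fin n₂ → SpaceTime d → ℝ :=
  Sum.elim (fun p => heatFeature σ (D.x p)) (fun j w => σ (inner ℝ w (D.y j)))

/-- Gradients of `pinnFeature`. -/
noncomputable def pinnFeatureGrad (σ : ℝ → ℝ) (D : TrainingData d n₁ n₂) :
    Fin n₁ ⊕ Fin n₂ → SpaceTime d → SpaceTime d :=
  Sum.elim (fun p => heatFeatureGrad σ (D.x p))
    (fun j w => iteratedDeriv 1 σ (inner ℝ w (D.y j)) • D.y j)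

/-- Normalization of the residuals. -/
noncomputable def pinnWeight (n₁ n₂ : ℕ) : Fin n₁ ⊕ Fin n₂ → ℝ :=
  Sum.elim (fun _ => 1 / √n₁) (fun _ => 1 / √n₂)

/-- Target values of the residuals. -/
def pinnTarget (D : TrainingData d n₁ n₂) : Fin n₁ ⊕ Fin n₂ → ℝ :=
  Sum.elim (fun p => D.f (D.x p)) (fun j => D.g (D.y j))

lemma pinnFeature_bound (h : ActivationAssumption σ c) {κ : ℝ} (hκ1 : 1 ≤ κ) (hκ : c ≤ κ)
    (hκ0 : |σ 0| ≤ κ) {D : TrainingData d n₁ n₂} (hD : ∀ i, ‖D.sample i‖ ≤ 1) :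
    FeatureBound (pinnFeature σ D) (pinnFeatureGrad σ D) (20 * κ) where
  one_le := by linarith
  hasGrad i w := by
    rcases i with p | j
    · exact hasGradientAt_heatFeature h _ w
    · exact hasGradientAt_neuron h _ w
  val i w := by
    rcases i with p | j
    · refine (abs_heatFeature_le h hκ _ w).trans ?_
      gcongr
      norm_num
    · have l0 := h.lip hκ (k := 0) (by norm_num) (hD (Sum.inr j)) w 0
      simp only [iteratedDeriv_zero, inner_zero_left, sub_zero] at l0
      have := abs_sub_abs_le_abs_sub (σ (inner ℝ w (D.sample (Sum.inr j)))) (σ 0)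
      have e : pinnFeature σ D (Sum.inr j) w = σ (inner ℝ w (D.sample (Sum.inr j))) := rfl
      rw [e]
      nlinarith [mul_nonneg (by linarith : 0 ≤ κ) (sq_nonneg (‖w‖ - 1)),
        mul_nonneg (by linarith : 0 ≤ κ) (sq_nonneg ‖w‖)]
  grad i w := by
    rcases i with p | j
    · exact norm_heatFeatureGrad_le h hκ (hD (Sum.inl p)) w
    · have h1 := h.abs_iteratedDeriv_le hκ (k := 1) le_rfl (by norm_num)
        (inner ℝ w (D.sample (Sum.inr j)))
      calc ‖iteratedDeriv 1 σ (inner ℝ w (D.sample (Sum.inr j))) • D.sample (Sum.inr j)‖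
          ≤ κ * 1 := by rw [norm_smul]; gcongr; exacts [h1, hD _]
        _ ≤ _ := by nlinarith [sq_nonneg ‖w‖]
  lip i v w := by
    rcases i with p | j
    · exact heatFeatureGrad_lip h hκ (hD (Sum.inl p)) v w
    · have l1 := h.lip hκ (k := 1) (by norm_num) (hD (Sum.inr j)) v w
      calc ‖iteratedDeriv 1 σ (inner ℝ v (D.sample (Sum.inr j))) • D.sample (Sum.inr j) -
            iteratedDeriv 1 σ (inner ℝ w (D.sample (Sum.inr j))) • D.sample (Sum.inr j)‖
          ≤ (κ * ‖v - w‖) * 1 := by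
            rw [← sub_smul, norm_smul]; gcongr; exacts [l1, hD _]
        _ ≤ _ := by
          rw [mul_one]
          gcongr
          nlinarith [sq_nonneg ‖v‖, sq_nonneg ‖w‖]

lemma sum_pinnWeight_sq (h₁ : 0 < n₁) (h₂ : 0 < n₂) : ∑ i, pinnWeight n₁ n₂ i ^ 2 = 2 := by
  have e1 : (n₁ : ℝ) ≠ 0 := by positivity
  have e2 : (n₂ : ℝ) ≠ 0 := by positivity
  simp [pinnWeight, e1, e2]
  norm_num

/-- Arbitrary coefficients `β` and profile `g` keep the form stable under differentiation, so the
lemma can be applied twice for second derivatives. -/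
lemma pderiv_neuron_sum {g g' : ℝ → ℝ} (hg : ∀ z, HasDerivAt g (g' z) z) (i : Fin (d + 1))
    (β : Fin m → ℝ) (w : Fin m → SpaceTime d) :
    pderiv i (fun x => 1 / √m * ∑ r, β r * g (inner ℝ (w r) x)) =
      fun x => 1 / √m * ∑ r, (β r * w r i) * g' (inner ℝ (w r) x) := by
  ext x
  refine HasLineDerivAt.lineDeriv ?_
  have h1 : ∀ r, HasDerivAt (fun t : ℝ => g (inner ℝ (w r) (x + t • EuclideanSpace.single i 1)))
      (g' (inner ℝ (w r) x) * w r i) 0 := by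
    intro r
    have e : (fun t : ℝ => inner ℝ (w r) (x + t • EuclideanSpace.single i (1 : ℝ))) =
        fun t => inner ℝ (w r) x + t * w r i := by
      ext t
      rw [inner_add_right, real_inner_smul_right, EuclideanSpace.inner_single_right]
      simp
    have h2 : HasDerivAt (fun t : ℝ => inner ℝ (w r) (x + t • EuclideanSpace.single i (1 : ℝ)))
        (w r i) 0 := by
      rw [e]
      simpa using ((hasDerivAt_id (0 : ℝ)).mul_const (w r i)).const_add (inner ℝ (w r) x)
    refine HasDerivAt.comp (h₂ := g) 0 ?_ h2
    simpa using hg (inner ℝ (w r) x)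
  have h3 := (HasDerivAt.fun_sum (u := Finset.univ)
    fun r _ => (h1 r).const_mul (β r)).const_mul (1 / √(m : ℝ))
  refine h3.congr_deriv ?_
  congr 1
  exact Finset.sum_congr rfl fun r _ => by ring

lemma heatOp_network (h : ActivationAssumption σ c) (a : Fin m → ℝ) (w : Weights d m)
    (x : SpaceTime d) :
    heatOp (network σ a w) x = 1 / √m * ∑ r, a r * heatFeature σ x (w r) := by
  have d0 : ∀ z, HasDerivAt σ (iteratedDeriv 1 σ z) z := by simpa using h.hasDerivAt 0
  have hn : network σ a w = fun x => 1 / √m * ∑ r, a r * σ (inner ℝ (w r) x) := rfl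
  unfold heatOp
  simp only [hn, pderiv_neuron_sum d0, pderiv_neuron_sum (h.hasDerivAt 1)]
  rw [← Finset.mul_sum, ← mul_sub, Finset.sum_comm, ← Finset.sum_sub_distrib]
  congr 1
  refine Finset.sum_congr rfl fun r _ => ?_
  rw [heatFeature, spaceSq_eq_sum, mul_sub, Finset.sum_mul, Finset.mul_sum]
  congr 1
  · ring
  · exact Finset.sum_congr rfl fun i _ => by ring

lemma pinnResidual_eq (h : ActivationAssumption σ c) (D : TrainingData d n₁ n₂) (a : Fin m → ℝ)
    (i : Fin n₁ ⊕ Fin n₂) :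
    pinnResidual σ D a i =
      featResidual (pinnWeight n₁ n₂) (pinnTarget D) (pinnFeature σ D) a i := by
  ext w
  rcases i with p | j
  · simp only [pinnResidual, heatOp_network h]
    rfl
  · rfl

lemma loss_eq (h : ActivationAssumption σ c) (D : TrainingData d n₁ n₂) (a : Fin m → ℝ) :
    loss σ D a = featLoss (pinnWeight n₁ n₂) (pinnTarget D) (pinnFeature σ D) a := by
  ext w
  rw [featLoss_eq, Fintype.sum_sum_type]
  simp only [loss, pinnResidual_eq h]

lemma inner_featGrad {ι E : Type*} [NormedAddCommGroup E] [InnerProductSpace ℝ E] (c : ι → ℝ)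
    (γ : ι → E → E) (a : Fin m → ℝ) (w : PiLp 2 (fun _ : Fin m => E)) (i j : ι) :
    inner ℝ (featGrad c γ a i w) (featGrad c γ a j w) =
      c i * c j * (1 / m * ∑ r, a r ^ 2 * inner ℝ (γ i (w r)) (γ j (w r))) := by
  have hm : (√(m : ℝ))⁻¹ * (√(m : ℝ))⁻¹ = (m : ℝ)⁻¹ := by
    rw [← mul_inv, Real.mul_self_sqrt (Nat.cast_nonneg m)]
  simp only [featGrad, PiLp.inner_apply, real_inner_smul_left, real_inner_smul_right,
    Finset.mul_sum, one_div, ← hm]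
  exact Finset.sum_congr rfl fun r _ => by ring

lemma gram_eq (h : ActivationAssumption σ c) {b : ℝ} {D : TrainingData d n₁ n₂}
    (hF : FeatureBound (pinnFeature σ D) (pinnFeatureGrad σ D) b) (a : Fin m → ℝ)
    (w : Weights d m) (i j : Fin n₁ ⊕ Fin n₂) :
    gram σ D a w i j = pinnWeight n₁ n₂ i * pinnWeight n₁ n₂ j * (1 / m * ∑ r, a r ^ 2 *
      inner ℝ (pinnFeatureGrad σ D i (w r)) (pinnFeatureGrad σ D j (w r))) := by
  simp only [gram, Matrix.of_apply, pinnResidual_eq h,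
    (hasGradientAt_featResidual hF i w).gradient, (hasGradientAt_featResidual hF j w).gradient,
    inner_featGrad]

/-- Almost surely `a r ^ 2 = 1`, and every neuron has the same Gaussian marginal, so the average
over neurons has an expectation free of `m`. -/
lemma gramInf_eq (h : ActivationAssumption σ c) {b : ℝ} {D : TrainingData d n₁ n₂} (hm : 0 < m)
    (hF : FeatureBound (pinnFeature σ D) (pinnFeatureGrad σ D) b) (i j : Fin n₁ ⊕ Fin n₂) :
    gramInf m σ D i j = pinnWeight n₁ n₂ i * pinnWeight n₁ n₂ j *
      ∫ w, inner ℝ (pinnFeatureGrad σ D i w) (pinnFeatureGrad σ D j w)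
        ∂stdGaussian (SpaceTime d) := by
  have hm' : (m : ℝ) ≠ 0 := by positivity
  set Z : SpaceTime d → ℝ := fun w =>
    inner ℝ (pinnFeatureGrad σ D i w) (pinnFeatureGrad σ D j w) with hZ
  have hZc : Continuous Z := (hF.continuous_grad i).inner (hF.continuous_grad j)
  have hZi : Integrable Z (stdGaussian (SpaceTime d)) := hF.integrable_inner i j
  have e1 : gramInf m σ D i j = ∫ ω, pinnWeight n₁ n₂ i * pinnWeight n₁ n₂ j *
      (1 / m * ∑ r, Z (ω.1 r)) ∂initLaw d m := by
    simp only [gramInf, Matrix.of_apply]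
    refine integral_congr_ae ?_
    filter_upwards [ae_initLaw_abs] with ω hω
    rw [gram_eq h hF]
    congr 2
    refine Finset.sum_congr rfl fun r _ => ?_
    rw [← sq_abs, hω r]
    simp [hZ]
  have hmp : ∀ r, MeasurePreserving (fun ω : (Fin m → SpaceTime d) × (Fin m → ℝ) => ω.1 r)
      (initLaw d m) (stdGaussian (SpaceTime d)) := fun r =>
    (measurePreserving_eval (fun _ : Fin m => stdGaussian (SpaceTime d)) r).comp
      measurePreserving_fst
  rw [e1, integral_const_mul, integral_const_mul, integral_finsetSum]
  · have e2 : ∀ r, ∫ ω, Z (ω.1 r) ∂initLaw d m = ∫ w, Z w ∂stdGaussian (SpaceTime d) := fun r => by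
      rw [← (hmp r).map_eq, integral_map (hmp r).measurable.aemeasurable hZc.aestronglyMeasurable]
    simp only [e2, Finset.sum_const, Finset.card_univ, Fintype.card_fin, nsmul_eq_mul]
    field_simp
  · exact fun r _ => (hmp r).integrable_comp_of_integrable hZi

end Features

/-! ### The least eigenvalue as a bound for the quadratic form. -/

section LeastEigenvalue

open Matrix

variable {ι : Type*} [Fintype ι] [DecidableEq ι] {A : Matrix ι ι ℝ}

lemma lambdaMin_le_of_mem_spectrum (hA : A.IsHermitian) {μ : ℝ} (hμ : μ ∈ spectrum ℝ A) :
    lambdaMin A ≤ μ := by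
  refine csInf_le ?_ hμ
  rw [hA.spectrum_real_eq_range_eigenvalues]
  exact (Set.finite_range _).bddBelow

lemma lambdaMin_pos [Nonempty ι] (hA : A.PosDef) : 0 < lambdaMin A := by
  have hmem : lambdaMin A ∈ Set.range hA.1.eigenvalues := by
    unfold lambdaMin
    rw [hA.1.spectrum_real_eq_range_eigenvalues]
    exact (Set.range_nonempty _).csInf_mem (Set.finite_range _)
  obtain ⟨i, hi⟩ := hmem
  rw [← hi]
  exact hA.eigenvalues_pos i

/-- Subtracting `lambdaMin A` times the identity shifts the spectrum into `[0, ∞)`, so the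
difference is positive semidefinite. -/
lemma lambdaMin_mul_le (hA : A.IsHermitian) (x : ι → ℝ) :
    lambdaMin A * ∑ i, x i ^ 2 ≤ ∑ i, ∑ j, x i * x j * A i j := by
  set L := lambdaMin A with hL
  have hB : (A - algebraMap ℝ (Matrix ι ι ℝ) L).IsHermitian := by
    refine hA.sub ?_
    rw [Matrix.algebraMap_eq_diagonal]
    exact Matrix.isHermitian_diagonal _
  have hpsd : (A - algebraMap ℝ (Matrix ι ι ℝ) L).PosSemidef := by
    rw [hB.posSemidef_iff_eigenvalues_nonneg]
    intro i
    have h1 : hB.eigenvalues i ∈ spectrum ℝ (A - algebraMap ℝ (Matrix ι ι ℝ) L) := by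
      rw [hB.spectrum_real_eq_range_eigenvalues]; exact ⟨i, rfl⟩
    rw [← spectrum.sub_singleton_eq] at h1
    obtain ⟨μ, hμ, ν, hν, hμν⟩ := Set.mem_sub.1 h1
    rw [Set.mem_singleton_iff.1 hν] at hμν
    have := lambdaMin_le_of_mem_spectrum hA hμ
    simp only [Pi.zero_apply]
    linarith
  have h := hpsd.dotProduct_mulVec_nonneg x
  rw [Matrix.sub_mulVec, dotProduct_sub, Matrix.algebraMap_eq_diagonal] at h
  simp only [star_trivial, dotProduct, mulVec, diagonal_apply, Pi.algebraMap_apply,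
    Algebra.algebraMap_self, RingHom.id_apply, ite_mul, zero_mul, Finset.sum_ite_eq,
    Finset.mem_univ, if_true, Finset.mul_sum] at h
  rw [Finset.mul_sum]
  have e1 : ∑ i, x i * (L * x i) = ∑ i, L * x i ^ 2 := Finset.sum_congr rfl fun i _ => by ring
  have e2 : ∑ i, ∑ j, x i * (A i j * x j) = ∑ i, ∑ j, x i * x j * A i j :=
    Finset.sum_congr rfl fun i _ => Finset.sum_congr rfl fun j _ => by ring
  rw [e1, e2] at h
  linarith

lemma lambdaMin_le_diag (hA : A.IsHermitian) (i : ι) : lambdaMin A ≤ A i i := by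
  have h := lambdaMin_mul_le hA (Pi.single i 1)
  simpa [Pi.single_apply, ite_pow] using h

end LeastEigenvalue

/-! ### Linear independence of the feature gradients. -/

section Independence

open Filter Topology

/-- Generalized exponential sums with different absolute bases cannot vanish infinitely often. -/
lemma eq_zero_of_frequently_expPoly {ι : Type*} [Fintype ι] [DecidableEq ι] {α z A B C : ι → ℝ}
    (hz : ∀ i, z i ≠ 0) (hinj : ∀ i j, i ≠ j → |z i| ≠ |z j|)
    (hP : ∀ i, ∃ ε > 0, ∀ᶠ k : ℕ in atTop, ε ≤ |A i + B i * k + C i * (k : ℝ) ^ 2|)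
    (h : ∃ᶠ k : ℕ in atTop, ∑ i, α i * ((A i + B i * k + C i * (k : ℝ) ^ 2) * z i ^ k) = 0) :
    ∀ i, α i = 0 := by
  by_contra! hne
  -- Among the indices with nonzero coefficient, the one with largest `|z i|` dominates: after
  -- division by `z i ^ k` all other terms tend to zero, while its own stays at least `|α i| ε`.
  obtain ⟨i, hi, hmax⟩ := Finset.exists_max_image (Finset.univ.filter fun i => α i ≠ 0)
    (fun i => |z i|) (by obtain ⟨i, hi⟩ := hne; exact ⟨i, by simpa using hi⟩)
  have hαi : α i ≠ 0 := by simpa using hi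
  obtain ⟨ε, hε, hPi⟩ := hP i
  have hlim : Tendsto (fun k : ℕ => ∑ j ∈ Finset.univ.erase i,
      α j * ((A j + B j * k + C j * (k : ℝ) ^ 2) * (z j / z i) ^ k)) atTop (𝓝 0) := by
    rw [← Finset.sum_const_zero (s := Finset.univ.erase i)]
    refine tendsto_finsetSum _ fun j hj => ?_
    by_cases hαj : α j = 0
    · simp [hαj]
    · have hlt : |z j / z i| < 1 := by
        rw [abs_div, div_lt_one (abs_pos.2 (hz i))]
        exact lt_of_le_of_ne (hmax j (by simpa using hαj))
          (hinj j i (Finset.ne_of_mem_erase hj))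
      have h0 := (tendsto_pow_const_mul_const_pow_of_abs_lt_one 0 hlt).const_mul (A j)
      have h1 := (tendsto_pow_const_mul_const_pow_of_abs_lt_one 1 hlt).const_mul (B j)
      have h2 := (tendsto_pow_const_mul_const_pow_of_abs_lt_one 2 hlt).const_mul (C j)
      have h3 := ((h0.add h1).add h2).const_mul (α j)
      simp only [mul_zero, add_zero] at h3
      refine h3.congr fun k => ?_
      ring
  have hsmall : ∀ᶠ k : ℕ in atTop, |∑ j ∈ Finset.univ.erase i,
      α j * ((A j + B j * k + C j * (k : ℝ) ^ 2) * (z j / z i) ^ k)| < |α i| * ε := by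
    have := (tendsto_order.1 hlim.abs).2 (|α i| * ε) (by rw [abs_zero]; positivity)
    exact this
  obtain ⟨k, hk, hk1, hk2⟩ := (h.and_eventually (hsmall.and hPi)).exists
  rw [← Finset.add_sum_erase _ _ (Finset.mem_univ i)] at hk
  have hzk : z i ^ k ≠ 0 := pow_ne_zero _ (hz i)
  have hk' : α i * (A i + B i * k + C i * (k : ℝ) ^ 2) + ∑ j ∈ Finset.univ.erase i,
      α j * ((A j + B j * k + C j * (k : ℝ) ^ 2) * (z j / z i) ^ k) = 0 := by
    have e : ∑ j ∈ Finset.univ.erase i,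
        α j * ((A j + B j * k + C j * (k : ℝ) ^ 2) * (z j / z i) ^ k) =
        (∑ j ∈ Finset.univ.erase i,
          α j * ((A j + B j * k + C j * (k : ℝ) ^ 2) * z j ^ k)) / z i ^ k := by
      rw [Finset.sum_div]
      exact Finset.sum_congr rfl fun j _ => by rw [div_pow]; ring
    rw [e, ← mul_left_inj' hzk, add_mul, div_mul_cancel₀ _ hzk, zero_mul, ← hk]
    ring
  have habs : |α i| * ε ≤ |α i * (A i + B i * k + C i * (k : ℝ) ^ 2)| := by
    rw [abs_mul]; gcongr
  rw [eq_neg_of_add_eq_zero_left hk', abs_neg] at habs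
  linarith

/-- A real-analytic function with finitely many nonzero Taylor coefficients is a polynomial. -/
lemma frequently_iteratedDeriv_ne_zero {σ : ℝ → ℝ} (ha : ∀ z, AnalyticAt ℝ σ z)
    (hp : ¬ ∃ p : Polynomial ℝ, ∀ z, σ z = p.eval z) :
    ∃ᶠ k : ℕ in atTop, iteratedDeriv k σ 0 ≠ 0 := by
  by_contra hcon
  simp only [not_frequently, not_not, eventually_atTop] at hcon
  obtain ⟨K, hK⟩ := hcon
  set p : Polynomial ℝ := ∑ k ∈ Finset.range K,
    Polynomial.monomial k (iteratedDeriv k σ 0 / k.factorial) with hpdef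
  refine hp ⟨p, ?_⟩
  -- Near `0` the Taylor series is a finite sum; the identity theorem extends the equality to all of
  -- `ℝ`.
  have hev : σ =ᶠ[𝓝 0] fun z => p.eval z := by
    filter_upwards [(ha 0).hasFPowerSeriesAt.eventually_hasSum] with y hy
    rw [zero_add] at hy
    simp only [FormalMultilinearSeries.ofScalars_apply_eq, smul_eq_mul] at hy
    have h2 := hasSum_sum_of_ne_finset_zero (L := .unconditional ℕ) (s := Finset.range K)
      (f := fun n => iteratedDeriv n σ 0 / n.factorial * y ^ n) (fun n hn => by
        rw [hK n (by simpa using hn)]; simp)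
    rw [hy.unique h2, hpdef, Polynomial.eval_finsetSum]
    simp [Polynomial.eval_monomial]
  have := AnalyticOnNhd.eq_of_eventuallyEq (𝕜 := ℝ) (fun z _ => ha z)
    (fun z _ => AnalyticOnNhd.eval_polynomial p z (Set.mem_univ z)) hev
  exact fun z => congrFun this z

variable {d n₁ n₂ : ℕ} {σ : ℝ → ℝ} {c : ℝ}

/-- Finitely many hyperplanes do not cover the space. -/
lemma exists_inner_ne_zero {K : Set (SpaceTime d)} (hK : K.Finite) :
    ∃ v : SpaceTime d, ∀ u ∈ K, u ≠ 0 → inner ℝ v u ≠ 0 := by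
  have : Finite {u : K // (u : SpaceTime d) ≠ 0} := by
    have := hK.to_subtype; infer_instance
  obtain ⟨v, hv⟩ := Module.Dual.exists_forall_ne_zero_of_forall_exists
    (fun u : {u : K // (u : SpaceTime d) ≠ 0} => innerₛₗ ℝ (u : SpaceTime d))
    (fun u => ⟨u, by simpa using u.2⟩)
  refine ⟨v, fun u hu h0 => ?_⟩
  have := hv ⟨⟨u, hu⟩, h0⟩
  rwa [real_inner_comm]

/-- The `k`-th derivative of a feature along the ray through `v`. -/
noncomputable def rayDeriv (σ : ℝ → ℝ) (D : TrainingData d n₁ n₂) (v : SpaceTime d) (k : ℕ)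
    (t : ℝ) : Fin n₁ ⊕ Fin n₂ → ℝ
  | Sum.inl p =>
    -- Leibniz rule, with `z ^ k / z` and `z ^ k / z ^ 2` for the lower powers of `z`: this avoids
    -- truncated subtraction in the exponent and is correct for `z ≠ 0`.
    v 0 * (t * (inner ℝ v (D.x p) ^ k * iteratedDeriv (k + 1) σ (t * inner ℝ v (D.x p))) +
      k * (inner ℝ v (D.x p) ^ k / inner ℝ v (D.x p) *
        iteratedDeriv k σ (t * inner ℝ v (D.x p)))) -
    spaceSq v * (t ^ 2 * (inner ℝ v (D.x p) ^ k *
        iteratedDeriv (k + 2) σ (t * inner ℝ v (D.x p))) +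
      2 * k * (t * (inner ℝ v (D.x p) ^ k / inner ℝ v (D.x p) *
        iteratedDeriv (k + 1) σ (t * inner ℝ v (D.x p)))) +
      k * (k - 1) * (inner ℝ v (D.x p) ^ k / inner ℝ v (D.x p) ^ 2 *
        iteratedDeriv k σ (t * inner ℝ v (D.x p))))
  | Sum.inr j => inner ℝ v (D.y j) ^ k * iteratedDeriv k σ (t * inner ℝ v (D.y j))

lemma hasDerivAt_rayDeriv (h : ActivationAssumption σ c) {D : TrainingData d n₁ n₂}
    {v : SpaceTime d} (hv : ∀ i, inner ℝ v (D.sample i) ≠ 0) (k : ℕ) (t : ℝ)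
    (i : Fin n₁ ⊕ Fin n₂) :
    HasDerivAt (fun t => rayDeriv σ D v k t i) (rayDeriv σ D v (k + 1) t i) t := by
  have hs : ∀ (z : ℝ) (k : ℕ), HasDerivAt (fun t => iteratedDeriv k σ (t * z))
      (iteratedDeriv (k + 1) σ (t * z) * z) t := fun z k => by
    have := HasDerivAt.comp (h₂ := iteratedDeriv k σ) t (h.hasDerivAt k (t * z))
      ((hasDerivAt_id t).mul_const z)
    simpa [Function.comp_def] using this
  have hid := hasDerivAt_id t
  rcases i with p | j
  · have hz : inner ℝ v (D.x p) ≠ 0 := hv (Sum.inl p)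
    simp only [rayDeriv]
    set z := inner ℝ v (D.x p) with hzdef
    have d1 := (((hid.mul ((hs z (k + 1)).const_mul (z ^ k))).add
      (((hs z k).const_mul (z ^ k / z)).const_mul (k : ℝ))).const_mul (v 0))
    have d2 := ((((hid.pow 2).mul ((hs z (k + 2)).const_mul (z ^ k))).add
      ((hid.mul ((hs z (k + 1)).const_mul (z ^ k / z))).const_mul (2 * (k : ℝ)))).add
      (((hs z k).const_mul (z ^ k / z ^ 2)).const_mul ((k : ℝ) * (k - 1)))).const_mul (spaceSq v)
    refine (d1.sub d2).congr_deriv ?_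
    simp only [id, Pi.pow_apply]
    push_cast
    field_simp
    ring
  · simp only [rayDeriv]
    refine ((hs (inner ℝ v (D.y j)) k).const_mul _).congr_deriv ?_
    ring

lemma rayDeriv_zero_eq (D : TrainingData d n₁ n₂) (v : SpaceTime d) (t : ℝ)
    (i : Fin n₁ ⊕ Fin n₂) : rayDeriv σ D v 0 t i = pinnFeature σ D i (t • v) := by
  rcases i with p | j
  · simp [rayDeriv, pinnFeature, heatFeature, spaceSq, real_inner_smul_left, norm_smul, mul_pow,
      sq_abs]
    ring
  · simp [rayDeriv, pinnFeature, real_inner_smul_left]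

/-- The gradients of the features are linearly independent as functions of the weight. -/
theorem pinnFeatureGrad_independent (h : ActivationAssumption σ c) (hd : 0 < d)
    {D : TrainingData d n₁ n₂} (hne : ∀ i, D.sample i ≠ 0) (hD : D.NonParallel) {b : ℝ}
    (hF : FeatureBound (pinnFeature σ D) (pinnFeatureGrad σ D) b) {α : Fin n₁ ⊕ Fin n₂ → ℝ}
    (hα : ∀ w, ∑ i, α i • pinnFeatureGrad σ D i w = 0) : ∀ i, α i = 0 := by
  classical
  set e : SpaceTime d := EuclideanSpace.single (Fin.succ ⟨0, hd⟩) 1 with he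
  -- A generic direction: avoiding the samples makes all `zᵢ` nonzero, avoiding sums and differences
  -- makes the `|zᵢ|` distinct, and avoiding `e` makes the spatial part of `v` nonzero.
  obtain ⟨v, hv⟩ := exists_inner_ne_zero (K := insert e (Set.range D.sample ∪
    (Set.range fun p : (Fin n₁ ⊕ Fin n₂) × (Fin n₁ ⊕ Fin n₂) => D.sample p.1 - D.sample p.2) ∪
    (Set.range fun p : (Fin n₁ ⊕ Fin n₂) × (Fin n₁ ⊕ Fin n₂) => D.sample p.1 + D.sample p.2)))
    ((((Set.finite_range _).union (Set.finite_range _)).union (Set.finite_range _)).insert e)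
  have hz : ∀ i, inner ℝ v (D.sample i) ≠ 0 := fun i =>
    hv _ (Or.inr (Or.inl (Or.inl ⟨i, rfl⟩))) (hne i)
  have hzinj : ∀ i j, i ≠ j → |inner ℝ v (D.sample i)| ≠ |inner ℝ v (D.sample j)| := by
    intro i j hij hab
    have hli := LinearIndependent.pair_iff.1 (hD i j hij)
    rcases abs_eq_abs.1 hab with h1 | h1
    · refine hv (D.sample i - D.sample j) (Or.inr (Or.inl (Or.inr ⟨(i, j), rfl⟩))) (fun h0 => ?_)
        (by rw [inner_sub_right, h1, sub_self])
      have := hli 1 (-1) (by rw [one_smul, neg_one_smul, ← sub_eq_add_neg]; exact h0)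
      exact one_ne_zero this.1
    · refine hv (D.sample i + D.sample j) (Or.inr (Or.inr ⟨(i, j), rfl⟩)) (fun h0 => ?_)
        (by rw [inner_add_right, h1, neg_add_cancel])
      have := hli 1 1 (by rw [one_smul, one_smul]; exact h0)
      exact one_ne_zero this.1
  have hq : 0 < spaceSq v := by
    have h1 : v (Fin.succ ⟨0, hd⟩) ≠ 0 := by
      have := hv e (Or.inl rfl) (by simp [he])
      simpa [he, EuclideanSpace.inner_single_right] using this
    rw [spaceSq_eq_sum]
    exact Finset.sum_pos' (fun _ _ => sq_nonneg _) ⟨⟨0, hd⟩, Finset.mem_univ _, by positivity⟩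
  -- Vanishing gradient only makes the combination of features constant, so derivatives along the
  -- ray vanish from order one on, not at order zero.
  have hconst : ∀ w, ∑ i, α i * pinnFeature σ D i w = ∑ i, α i * pinnFeature σ D i 0 := by
    have hder : ∀ w, HasFDerivAt (fun w => ∑ i, α i * pinnFeature σ D i w)
        (0 : SpaceTime d →L[ℝ] ℝ) w := by
      intro w
      refine (HasFDerivAt.fun_sum (u := Finset.univ) fun i _ =>
        (hasGradientAt_iff_hasFDerivAt.1 (hF.hasGrad i w)).const_mul (α i)).congr_fderiv ?_
      have := congrArg (InnerProductSpace.toDual ℝ (SpaceTime d)) (hα w)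
      simpa using this
    exact fun w => is_const_of_fderiv_eq_zero (𝕜 := ℝ) (fun w => (hder w).differentiableAt)
      (fun w => (hder w).fderiv) w 0
  have hH : ∀ k t, HasDerivAt (fun t => ∑ i, α i * rayDeriv σ D v k t i)
      (∑ i, α i * rayDeriv σ D v (k + 1) t i) t := fun k t =>
    HasDerivAt.fun_sum fun i _ => (hasDerivAt_rayDeriv h hz k t i).const_mul (α i)
  have hzero : ∀ k t, ∑ i, α i * rayDeriv σ D v (k + 1) t i = 0 := by
    intro k
    induction k with
    | zero =>
      intro t
      refine (hH 0 t).unique ?_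
      have e0 : (fun t => ∑ i, α i * rayDeriv σ D v 0 t i) =
          fun _ => ∑ i, α i * pinnFeature σ D i 0 := by
        ext t; simp only [rayDeriv_zero_eq]; exact hconst _
      rw [e0]
      exact hasDerivAt_const _ _
    | succ k ih =>
      intro t
      refine (hH (k + 1) t).unique ?_
      have e0 : (fun t => ∑ i, α i * rayDeriv σ D v (k + 1) t i) = fun _ => (0 : ℝ) := funext ih
      rw [e0]
      exact hasDerivAt_const _ _
  -- At `t = 0` an interior feature gives `v₀ k zᵏ⁻¹ - |v'|² k(k-1) zᵏ⁻²` times `σ⁽ᵏ⁾(0)`, where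
  -- `v'` is the spatial part of `v`; `A`, `B`, `C` collect the powers of `k`. Since `C ≠ 0` there,
  -- the polynomial eventually stays away from zero.
  set A : Fin n₁ ⊕ Fin n₂ → ℝ := Sum.elim (fun _ => 0) (fun _ => 1) with hA
  set B : Fin n₁ ⊕ Fin n₂ → ℝ := Sum.elim (fun p => v 0 / inner ℝ v (D.x p) +
    spaceSq v / inner ℝ v (D.x p) ^ 2) (fun _ => 0) with hB
  set C : Fin n₁ ⊕ Fin n₂ → ℝ := Sum.elim (fun p => -(spaceSq v / inner ℝ v (D.x p) ^ 2))
    (fun _ => 0) with hC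
  have hray : ∀ k i, rayDeriv σ D v k 0 i = iteratedDeriv k σ 0 *
      ((A i + B i * k + C i * (k : ℝ) ^ 2) * inner ℝ v (D.sample i) ^ k) := by
    intro k i
    rcases i with p | j
    · simp [rayDeriv, hA, hB, hC, TrainingData.sample]
      ring
    · simp [rayDeriv, hA, hB, hC, TrainingData.sample]
      ring
  refine eq_zero_of_frequently_expPoly (z := fun i => inner ℝ v (D.sample i)) (A := A) (B := B)
    (C := C) hz hzinj (fun i => ?_) ?_
  · rcases i with p | j
    · refine ⟨1, one_pos, ?_⟩
      have hq' : 0 < spaceSq v / inner ℝ v (D.x p) ^ 2 := by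
        have := hz (Sum.inl p)
        have : inner ℝ v (D.x p) ≠ 0 := this
        positivity
      have hl : Tendsto (fun k : ℕ => spaceSq v / inner ℝ v (D.x p) ^ 2 * (k : ℝ)) atTop atTop :=
        tendsto_natCast_atTop_atTop.const_mul_atTop hq'
      filter_upwards [hl.eventually_ge_atTop (1 + (v 0 / inner ℝ v (D.x p) +
        spaceSq v / inner ℝ v (D.x p) ^ 2)), eventually_ge_atTop 1] with k hk hk1
      have hk1' : (1 : ℝ) ≤ k := by exact_mod_cast hk1
      simp only [hA, hB, hC, Sum.elim_inl]
      rw [le_abs]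
      right
      nlinarith
    · refine ⟨1, one_pos, Eventually.of_forall fun k => ?_⟩
      simp [hA, hB, hC]
  · refine ((frequently_iteratedDeriv_ne_zero h.analytic h.not_polynomial).and_eventually
      (eventually_ge_atTop 1)).mono fun k ⟨hk, hk1⟩ => ?_
    obtain ⟨j, rfl⟩ := Nat.exists_eq_add_of_le' hk1
    have h0 := hzero j 0
    have h1 : iteratedDeriv (j + 1) σ 0 * ∑ i, α i * ((A i + B i * ((j + 1 : ℕ) : ℝ) +
        C i * ((j + 1 : ℕ) : ℝ) ^ 2) * inner ℝ v (D.sample i) ^ (j + 1)) = 0 := by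
      refine Eq.trans ?_ h0
      rw [Finset.mul_sum]
      exact Finset.sum_congr rfl fun i _ => by rw [hray]; ring
    exact (mul_eq_zero.1 h1).resolve_left hk

end Independence

/-! ### Arithmetic: the width bound implies every smallness condition. -/

section Regime

variable {b d L β p η m A V ρ : ℝ}

/-- All variables but `η` are at least `1`, so their exponents may be raised freely, whereas the
power of `η` must match exactly. The power `η³` arises as the geometric mean of the `η⁴` and `η²`
conditions. -/
lemma sqrt_cube_width (hb : 1 ≤ b) (hd : 1 ≤ d) (hL : 1 ≤ L) (hβ : 1 ≤ β) (hp : 1 ≤ p)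
    (hη : 0 < η) (hm : 0 < m)
    (h1 : 10 ^ 23 * b ^ 8 * p ^ 2 * d ^ 10 * L ^ 2 * η ^ 4 ≤ m)
    (h3 : 10 ^ 21 * b ^ 4 * p ^ 4 * d ^ 8 * L ^ 2 * η ^ 2 * β ^ 6 ≤ m) :
    10 ^ 22 * b ^ 6 * p ^ 3 * d ^ 9 * L ^ 2 * η ^ 3 * β ^ 3 ≤ m := by
  apply le_of_sq_le_sq _ hm.le
  calc (10 ^ 22 * b ^ 6 * p ^ 3 * d ^ 9 * L ^ 2 * η ^ 3 * β ^ 3) ^ 2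
      = (10 ^ 23 * b ^ 8 * p ^ 2 * d ^ 10 * L ^ 2 * η ^ 4) *
        (10 ^ 21 * b ^ 4 * p ^ 4 * d ^ 8 * L ^ 2 * η ^ 2 * β ^ 6) := by ring
    _ ≤ m * m := by gcongr
    _ = m ^ 2 := by ring

lemma regime_hoeffding (hb : 1 ≤ b) (hd : 1 ≤ d) (hL : 1 ≤ L) (hβ : 1 ≤ β) (hp : 1 ≤ p)
    (h2 : 10 ^ 23 * b ^ 4 * p ^ 4 * d ^ 8 * L * β ^ 2 ≤ m) :
    L / 2 ≤ m ∧ 49152 * (L / 2) * b ^ 4 * (768000000 * p * d ^ 6) ≤ m * (b ^ 2 / p) ^ 2 := by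
  constructor
  · calc L / 2 ≤ 10 ^ 23 * 1 ^ 4 * 1 ^ 4 * 1 ^ 8 * L * 1 ^ 2 := by norm_num; linarith
      _ ≤ 10 ^ 23 * b ^ 4 * p ^ 4 * d ^ 8 * L * β ^ 2 := by gcongr
      _ ≤ m := h2
  · have h : 18874368000000 * 1 ^ 4 * p ^ 3 * d ^ 6 * L * 1 ^ 2 ≤ m := by
      refine le_trans ?_ h2
      gcongr <;> norm_num
    calc 49152 * (L / 2) * b ^ 4 * (768000000 * p * d ^ 6)
        = (18874368000000 * 1 ^ 4 * p ^ 3 * d ^ 6 * L * 1 ^ 2) * (b ^ 2 / p) ^ 2 := by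
          field_simp; ring
      _ ≤ m * (b ^ 2 / p) ^ 2 := by gcongr

lemma regime_displacement (hb : 1 ≤ b) (hd : 1 ≤ d) (hL : 1 ≤ L) (hβ : 1 ≤ β) (hp : 1 ≤ p)
    (hη : 0 < η) (hm : 0 < m)
    (h1 : 10 ^ 23 * b ^ 8 * p ^ 2 * d ^ 10 * L ^ 2 * η ^ 4 ≤ m)
    (h3 : 10 ^ 21 * b ^ 4 * p ^ 4 * d ^ 8 * L ^ 2 * η ^ 2 * β ^ 6 ≤ m)
    (hA2 : A ^ 2 = 2312 * b ^ 2 * d ^ 2 * L) : 8 * b * √η ^ 3 * A ^ 2 ≤ √m := by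
  apply le_of_sq_le_sq _ (Real.sqrt_nonneg m)
  rw [Real.sq_sqrt hm.le]
  have hs : √η ^ 2 = η := Real.sq_sqrt hη.le
  calc (8 * b * √η ^ 3 * A ^ 2) ^ 2 = 64 * b ^ 2 * (√η ^ 2) ^ 3 * (A ^ 2) ^ 2 := by ring
    _ = 342102016 * b ^ 6 * 1 ^ 3 * d ^ 4 * L ^ 2 * η ^ 3 * 1 ^ 3 := by rw [hs, hA2]; ring
    _ ≤ 10 ^ 22 * b ^ 6 * p ^ 3 * d ^ 9 * L ^ 2 * η ^ 3 * β ^ 3 := by gcongr <;> norm_num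
    _ ≤ m := sqrt_cube_width hb hd hL hβ hp hη hm h1 h3

lemma regime_radius (hb : 1 ≤ b) (hd : 1 ≤ d) (hL : 1 ≤ L) (hβ : 1 ≤ β) (hp : 1 ≤ p)
    (hη : 0 < η) (hm : 0 < m)
    (h2 : 10 ^ 23 * b ^ 4 * p ^ 4 * d ^ 8 * L * β ^ 2 ≤ m)
    (h3 : 10 ^ 21 * b ^ 4 * p ^ 4 * d ^ 8 * L ^ 2 * η ^ 2 * β ^ 6 ≤ m)
    (hρ : m * ρ ^ 2 ≤ 2312 * b ^ 2 * d ^ 2 * L * (8 * (p / b ^ 2) ^ 2 + 2 * η ^ 2)) :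
    64 * b * ρ * √(20 * d * (β / 2)) ≤ 1 := by
  apply le_of_sq_le_sq _ zero_le_one
  have e : (64 * b * ρ * √(20 * d * (β / 2))) ^ 2 = 40960 * b ^ 2 * d * β * ρ ^ 2 := by
    rw [mul_pow, Real.sq_sqrt (by positivity)]; ring
  rw [e]
  refine le_of_mul_le_mul_left ?_ hm
  have t1 : 2 * 10 ^ 10 * 1 ^ 4 * p ^ 2 * d ^ 3 * L * β ^ 1 ≤ m := by
    refine le_trans ?_ h2
    gcongr <;> norm_num
  have t2 : 2 * 10 ^ 10 * b ^ 4 * 1 ^ 4 * d ^ 3 * L ^ 1 * η ^ 2 * β ^ 1 ≤ m := by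
    refine le_trans ?_ h3
    gcongr <;> norm_num
  calc m * (40960 * b ^ 2 * d * β * ρ ^ 2) = 40960 * b ^ 2 * d * β * (m * ρ ^ 2) := by ring
    _ ≤ 40960 * b ^ 2 * d * β *
        (2312 * b ^ 2 * d ^ 2 * L * (8 * (p / b ^ 2) ^ 2 + 2 * η ^ 2)) := by gcongr
    _ = 757596160 * (p ^ 2 * d ^ 3 * L * β) + 189399040 * (b ^ 4 * d ^ 3 * L * η ^ 2 * β) := by
        field_simp; ring
    _ ≤ m * 1 ^ 2 := by
        have : 0 ≤ p ^ 2 * d ^ 3 * L * β := by positivity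
        have : 0 ≤ b ^ 4 * d ^ 3 * L * η ^ 2 * β := by positivity
        linarith

lemma regime_gram (hb : 1 ≤ b) (hd : 1 ≤ d) (hL : 1 ≤ L) (hβ : 1 ≤ β) (hp : 1 ≤ p)
    (hη : 0 < η) (hm : 0 < m)
    (h2 : 10 ^ 23 * b ^ 4 * p ^ 4 * d ^ 8 * L * β ^ 2 ≤ m)
    (h3 : 10 ^ 21 * b ^ 4 * p ^ 4 * d ^ 8 * L ^ 2 * η ^ 2 * β ^ 6 ≤ m)
    (hV : V ^ 4 = 768000000 * p * d ^ 6)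
    (hρ : m * ρ ^ 2 ≤ 2312 * b ^ 2 * d ^ 2 * L * (8 * (p / b ^ 2) ^ 2 + 2 * η ^ 2)) :
    (320 * b ^ 2 * V ^ 2 * ρ) ^ 2 ≤ b ^ 2 / p / 400 := by
  have e : (320 * b ^ 2 * V ^ 2 * ρ) ^ 2 = 102400 * b ^ 4 * V ^ 4 * ρ ^ 2 := by ring
  rw [e, hV]
  refine le_of_mul_le_mul_left ?_ hm
  have t1 : 4 * 10 ^ 21 * 1 ^ 4 * p ^ 4 * d ^ 8 * L * 1 ^ 2 ≤ m := by
    refine le_trans ?_ h2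
    gcongr
    norm_num
  have t2 : 8 * 10 ^ 20 * b ^ 4 * p ^ 2 * d ^ 8 * L ^ 1 * η ^ 2 * 1 ^ 6 ≤ m := by
    refine le_trans ?_ h3
    gcongr <;> norm_num
  calc m * (102400 * b ^ 4 * (768000000 * p * d ^ 6) * ρ ^ 2)
      = 102400 * b ^ 4 * (768000000 * p * d ^ 6) * (m * ρ ^ 2) := by ring
    _ ≤ 102400 * b ^ 4 * (768000000 * p * d ^ 6) *
        (2312 * b ^ 2 * d ^ 2 * L * (8 * (p / b ^ 2) ^ 2 + 2 * η ^ 2)) := by gcongr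
    _ = (102400 * 768000000 * 2312 * 400) * (8 * (p ^ 4 * d ^ 8 * L) +
        2 * (b ^ 4 * p ^ 2 * d ^ 8 * L * η ^ 2)) * (b ^ 2 / p / 400) := by field_simp
    _ ≤ m * (b ^ 2 / p / 400) := by
        gcongr
        have : 0 ≤ p ^ 4 * d ^ 8 * L := by positivity
        have : 0 ≤ b ^ 4 * p ^ 2 * d ^ 8 * L * η ^ 2 := by positivity
        linarith

lemma regime_taylor (hb : 1 ≤ b) (hd : 1 ≤ d) (hL : 1 ≤ L) (hβ : 1 ≤ β) (hp : 1 ≤ p)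
    (hm : 0 < m)
    (h3 : 10 ^ 21 * b ^ 4 * p ^ 4 * d ^ 8 * L ^ 2 * η ^ 2 * β ^ 6 ≤ m)
    (hA2 : A ^ 2 = 2312 * b ^ 2 * d ^ 2 * L) :
    20000 * b ^ 3 * η * (20 * d * (β / 2)) ^ 3 * A ≤ b ^ 2 / p / 4 * √m := by
  apply le_of_sq_le_sq _ (by positivity)
  have e1 : (b ^ 2 / p / 4 * √m) ^ 2 = m * ((b ^ 2 / p) ^ 2 / 16) := by
    rw [mul_pow, Real.sq_sqrt hm.le]; ring
  rw [e1]
  have t : 20000 ^ 2 * 10 ^ 6 * 2312 * 16 * b ^ 4 * p ^ 2 * d ^ 8 * L ^ 1 * η ^ 2 * β ^ 6 ≤ m := by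
    refine le_trans ?_ h3
    gcongr <;> norm_num
  calc (20000 * b ^ 3 * η * (20 * d * (β / 2)) ^ 3 * A) ^ 2
      = 20000 ^ 2 * b ^ 6 * η ^ 2 * (10 * d * β) ^ 6 * A ^ 2 := by ring
    _ = (20000 ^ 2 * 10 ^ 6 * 2312 * 16 * b ^ 4 * p ^ 2 * d ^ 8 * L ^ 1 * η ^ 2 * β ^ 6) *
        ((b ^ 2 / p) ^ 2 / 16) := by rw [hA2]; field_simp
    _ ≤ m * ((b ^ 2 / p) ^ 2 / 16) := by gcongr

/-- The width bound puts training in the lazy regime. -/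
lemma lazy_regime {l B lam : ℝ} (hb : 1 ≤ b) (hd : 1 ≤ d) (hl : 1 / 2 ≤ l) (hB : 1 / 2 ≤ B)
    (hlam : 0 < lam) (hlamb : lam ≤ b ^ 2) (hη : 0 < η) (hm : 0 < m)
    (h1 : 10 ^ 24 * b ^ 12 * (d ^ 8 / lam ^ 2 * l * (η ^ 4 * d ^ 2 * l)) ≤ m)
    (h2 : 10 ^ 24 * b ^ 12 * (d ^ 8 / lam ^ 2 * l * (1 / lam ^ 2 * B ^ 2)) ≤ m)
    (h3 : 10 ^ 24 * b ^ 12 * (d ^ 8 / lam ^ 2 * l * (η ^ 2 * B ^ 6 * l / lam ^ 2)) ≤ m)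
    (hA : A = 68 * b * d * √l) (hV : lam * V ^ 4 = 768000000 * b ^ 2 * d ^ 6)
    (hρ : ρ = A / √m * (2 / lam + η)) :
    l ≤ m ∧ 49152 * l * b ^ 4 * V ^ 4 ≤ m * lam ^ 2 ∧ 8 * b * √η ^ 3 * A ^ 2 ≤ √m ∧
      64 * b * ρ * √(20 * d * B) ≤ 1 ∧ (320 * b ^ 2 * V ^ 2 * ρ) ^ 2 ≤ lam / 400 ∧
      20000 * b ^ 3 * η * (20 * d * B) ^ 3 * A ≤ lam / 4 * √m := by
  have hb0 : 0 < b := by linarith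
  -- The substitutions `p = b²/lam`, `L = 2l`, `β = 2B` make every quantity except `η` at least `1`;
  -- for `p` this uses `lam ≤ b²`.
  obtain ⟨p, hp⟩ : ∃ p, p = b ^ 2 / lam := ⟨_, rfl⟩
  obtain ⟨L, rfl⟩ : ∃ L, l = L / 2 := ⟨2 * l, by ring⟩
  obtain ⟨β, rfl⟩ : ∃ β, B = β / 2 := ⟨2 * B, by ring⟩
  have hp1 : 1 ≤ p := by rw [hp, le_div_iff₀ hlam]; linarith
  have hL1 : 1 ≤ L := by linarith
  have hβ1 : 1 ≤ β := by linarith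
  have hp0 : 0 < p := by linarith
  obtain rfl : lam = b ^ 2 / p := by rw [hp]; field_simp
  have w1 : 10 ^ 23 * b ^ 8 * p ^ 2 * d ^ 10 * L ^ 2 * η ^ 4 ≤ m := by
    have e : 10 ^ 24 * b ^ 12 * (d ^ 8 / (b ^ 2 / p) ^ 2 * (L / 2) * (η ^ 4 * d ^ 2 * (L / 2))) =
      10 / 4 * (10 ^ 23 * b ^ 8 * p ^ 2 * d ^ 10 * L ^ 2 * η ^ 4) := by field_simp; ring
    have : 0 ≤ 10 ^ 23 * b ^ 8 * p ^ 2 * d ^ 10 * L ^ 2 * η ^ 4 := by positivity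
    linarith
  have w2 : 10 ^ 23 * b ^ 4 * p ^ 4 * d ^ 8 * L * β ^ 2 ≤ m := by
    have e : 10 ^ 24 * b ^ 12 * (d ^ 8 / (b ^ 2 / p) ^ 2 * (L / 2) *
        (1 / (b ^ 2 / p) ^ 2 * (β / 2) ^ 2)) =
      10 / 8 * (10 ^ 23 * b ^ 4 * p ^ 4 * d ^ 8 * L * β ^ 2) := by field_simp; ring
    have : 0 ≤ 10 ^ 23 * b ^ 4 * p ^ 4 * d ^ 8 * L * β ^ 2 := by positivity
    linarith
  have w3 : 10 ^ 21 * b ^ 4 * p ^ 4 * d ^ 8 * L ^ 2 * η ^ 2 * β ^ 6 ≤ m := by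
    have e : 10 ^ 24 * b ^ 12 * (d ^ 8 / (b ^ 2 / p) ^ 2 * (L / 2) *
        (η ^ 2 * (β / 2) ^ 6 * (L / 2) / (b ^ 2 / p) ^ 2)) =
      1000 / 256 * (10 ^ 21 * b ^ 4 * p ^ 4 * d ^ 8 * L ^ 2 * η ^ 2 * β ^ 6) := by
      field_simp; ring
    have : 0 ≤ 10 ^ 21 * b ^ 4 * p ^ 4 * d ^ 8 * L ^ 2 * η ^ 2 * β ^ 6 := by positivity
    linarith
  have hA2 : A ^ 2 = 2312 * b ^ 2 * d ^ 2 * L := by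
    rw [hA, mul_pow, Real.sq_sqrt (by linarith)]; ring
  have hV4 : V ^ 4 = 768000000 * p * d ^ 6 := by
    field_simp at hV
    linarith
  -- Uses `(2/lam + η)² ≤ 8/lam² + 2η²`, which separates the powers of `η`; here `1/lam = p/b²`.
  have hρ2 : m * ρ ^ 2 ≤ 2312 * b ^ 2 * d ^ 2 * L * (8 * (p / b ^ 2) ^ 2 + 2 * η ^ 2) := by
    have e : m * ρ ^ 2 = A ^ 2 * (2 * (p / b ^ 2) + η) ^ 2 := by
      rw [hρ, mul_pow, div_pow, Real.sq_sqrt hm.le]; field_simp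
    rw [e, hA2]
    gcongr
    nlinarith [sq_nonneg (2 * (p / b ^ 2) - η)]
  obtain ⟨c1, c2⟩ := regime_hoeffding hb hd hL1 hβ1 hp1 w2
  exact ⟨c1, by rw [hV4]; exact c2, regime_displacement hb hd hL1 hβ1 hp1 hη hm w1 w3 hA2,
    regime_radius hb hd hL1 hβ1 hp1 hη hm w2 w3 hρ2,
    regime_gram hb hd hL1 hβ1 hp1 hη hm w2 w3 hV4 hρ2,
    regime_taylor hb hd hL1 hβ1 hp1 hm w3 hA2⟩

end Regime

/-! ### The limiting Gram matrix and convergence with high probability. -/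

section LimitGram

variable {d m n₁ n₂ : ℕ} {σ : ℝ → ℝ} {c b : ℝ} {D : TrainingData d n₁ n₂}

lemma gramInf_isHermitian : (gramInf m σ D).IsHermitian := by
  refine Matrix.IsHermitian.ext fun i j => ?_
  simp only [gramInf, gram, Matrix.of_apply, star_trivial]
  exact integral_congr_ae (Filter.Eventually.of_forall fun ω => real_inner_comm _ _)

lemma gramInf_form (h : ActivationAssumption σ c) (hm : 0 < m)
    (hF : FeatureBound (pinnFeature σ D) (pinnFeatureGrad σ D) b) (x : Fin n₁ ⊕ Fin n₂ → ℝ) :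
    ∑ i, ∑ j, x i * x j * gramInf m σ D i j = ∫ w, ‖∑ i, (x i * pinnWeight n₁ n₂ i) •
      pinnFeatureGrad σ D i w‖ ^ 2 ∂stdGaussian (SpaceTime d) := by
  have e : ∀ w, ‖∑ i, (x i * pinnWeight n₁ n₂ i) • pinnFeatureGrad σ D i w‖ ^ 2 =
      ∑ i, ∑ j, (x i * pinnWeight n₁ n₂ i) * (x j * pinnWeight n₁ n₂ j) *
        inner ℝ (pinnFeatureGrad σ D i w) (pinnFeatureGrad σ D j w) := fun w =>
    norm_sq_sum_smul (WithLp.toLp 2 x) fun i => pinnFeatureGrad σ D i w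
  have hint : ∀ i j, Integrable (fun w => (x i * pinnWeight n₁ n₂ i) *
      (x j * pinnWeight n₁ n₂ j) * inner ℝ (pinnFeatureGrad σ D i w) (pinnFeatureGrad σ D j w))
      (stdGaussian (SpaceTime d)) := fun i j => (hF.integrable_inner i j).const_mul _
  simp only [e]
  rw [integral_finsetSum _ fun i _ => integrable_finsetSum _ fun j _ => hint i j]
  refine Finset.sum_congr rfl fun i _ => ?_
  rw [integral_finsetSum _ fun j _ => hint i j]
  refine Finset.sum_congr rfl fun j _ => ?_
  rw [integral_const_mul, gramInf_eq h hm hF]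
  ring

lemma pinnWeight_pos (h₁ : 0 < n₁) (h₂ : 0 < n₂) (i : Fin n₁ ⊕ Fin n₂) :
    0 < pinnWeight n₁ n₂ i := by
  rcases i with p | j <;> simp [pinnWeight, h₁, h₂]

/-- If the form vanishes at `x`, its nonnegative continuous integrand vanishes almost everywhere,
hence everywhere because the Gaussian charges open sets. Independence of the gradients then gives `x
= 0`. -/
lemma gramInf_posDef (h : ActivationAssumption σ c) (hd : 0 < d) (h₁ : 0 < n₁) (h₂ : 0 < n₂)
    (hm : 0 < m) (hF : FeatureBound (pinnFeature σ D) (pinnFeatureGrad σ D) b)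
    (hne : ∀ i, D.sample i ≠ 0) (hD : D.NonParallel) : (gramInf m σ D).PosDef := by
  refine Matrix.PosDef.of_dotProduct_mulVec_pos gramInf_isHermitian fun x hx => ?_
  have e : star x ⬝ᵥ (gramInf m σ D).mulVec x = ∑ i, ∑ j, x i * x j * gramInf m σ D i j := by
    simp only [dotProduct, Matrix.mulVec, star_trivial, Finset.mul_sum]
    exact Finset.sum_congr rfl fun i _ => Finset.sum_congr rfl fun j _ => by ring
  rw [e, gramInf_form h hm hF]
  have hγ := hF.continuous_grad
  have hint := hF.integrable_norm_sq_sum (sum_pinnWeight_sq h₁ h₂).le (WithLp.toLp 2 x)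
  refine lt_of_le_of_ne (integral_nonneg fun w => by positivity) fun h0 => hx ?_
  have hae := (integral_eq_zero_iff_of_nonneg (fun w => by positivity) hint).1 h0.symm
  have hc : Continuous fun w =>
      ‖∑ i, (x i * pinnWeight n₁ n₂ i) • pinnFeatureGrad σ D i w‖ ^ 2 := by
    fun_prop
  have hall := (hc.ae_eq_iff_eq (stdGaussian (SpaceTime d)) continuous_zero).1 hae
  have hz := pinnFeatureGrad_independent h hd hne hD hF
    (α := fun i => x i * pinnWeight n₁ n₂ i) fun w => by
      have := congrFun hall w
      simpa using this
  funext i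
  exact (mul_eq_zero.1 (hz i)).resolve_right (pinnWeight_pos h₁ h₂ i).ne'

/-- A boundary sample is used for the diagonal entry because its gradient `σ'(wᵀy) y` is bounded
uniformly in `w`. The result normalizes `p ≥ 1` in `lazy_regime`. -/
lemma lambdaMin_gramInf_le (h : ActivationAssumption σ c) {κ : ℝ} (hκ : c ≤ κ) (h₂ : 0 < n₂)
    (hm : 0 < m) (hF : FeatureBound (pinnFeature σ D) (pinnFeatureGrad σ D) b)
    (hD : ∀ i, ‖D.sample i‖ ≤ 1) : lambdaMin (gramInf m σ D) ≤ κ ^ 2 := by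
  have hκ0 : 0 ≤ κ := ((abs_nonneg _).trans (h.bounded_third 0)).trans hκ
  set i : Fin n₁ ⊕ Fin n₂ := Sum.inr ⟨0, h₂⟩
  refine (lambdaMin_le_diag gramInf_isHermitian i).trans ?_
  rw [gramInf_eq h hm hF]
  have h1 : ∫ w, inner ℝ (pinnFeatureGrad σ D i w) (pinnFeatureGrad σ D i w)
      ∂stdGaussian (SpaceTime d) ≤ κ ^ 2 := by
    calc _ ≤ ∫ _w : SpaceTime d, κ ^ 2 ∂stdGaussian (SpaceTime d) := by
          refine integral_mono (hF.integrable_inner i i) (integrable_const _) fun w => ?_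
          simp only [real_inner_self_eq_norm_sq]
          have hle : ‖pinnFeatureGrad σ D i w‖ ≤ κ := by
            change ‖iteratedDeriv 1 σ (inner ℝ w (D.sample i)) • D.sample i‖ ≤ κ
            rw [norm_smul]
            exact (mul_le_of_le_one_right (norm_nonneg _) (hD i)).trans
              (h.abs_iteratedDeriv_le hκ le_rfl (by norm_num) _)
          gcongr
      _ = κ ^ 2 := by simp
  have h2 : pinnWeight n₁ n₂ i * pinnWeight n₁ n₂ i ≤ 1 := by
    have : (1 : ℝ) ≤ n₂ := by exact_mod_cast h₂
    simp only [pinnWeight, i, Sum.elim_inr]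
    rw [div_mul_div_comm, one_mul, Real.mul_self_sqrt (by positivity)]
    exact (div_le_one (by positivity)).2 this
  have h3 : 0 ≤ pinnWeight n₁ n₂ i * pinnWeight n₁ n₂ i := mul_self_nonneg _
  calc _ ≤ pinnWeight n₁ n₂ i * pinnWeight n₁ n₂ i * κ ^ 2 := by gcongr
    _ ≤ 1 * κ ^ 2 := by gcongr
    _ = κ ^ 2 := one_mul _

lemma cylInterior_subset_cylClosed {T : ℝ} {Ω : Set (EuclideanSpace ℝ (Fin d))} :
    cylInterior T Ω ⊆ cylClosed T Ω :=
  fun _ hx => ⟨Set.Ioo_subset_Icc_self hx.1, subset_closure hx.2⟩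

lemma cylBoundary_subset_cylClosed {T : ℝ} (hT : 0 < T) {Ω : Set (EuclideanSpace ℝ (Fin d))} :
    cylBoundary T Ω ⊆ cylClosed T Ω := by
  rintro x (hx | hx)
  · exact ⟨by rw [hx.1]; exact ⟨le_rfl, hT.le⟩, subset_closure hx.2⟩
  · exact ⟨hx.1, frontier_subset_closure hx.2⟩

/-- High-probability linear convergence, for features bounded by `b`. -/
theorem exists_event_loss_decay (h : ActivationAssumption σ c) (hd : 0 < d) (h₁ : 0 < n₁)
    (h₂ : 0 < n₂) (hF : FeatureBound (pinnFeature σ D) (pinnFeatureGrad σ D) b)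
    (ht : ∀ i, |pinnTarget D i| ≤ b) (hm : 2 ≤ m) {η δ : ℝ} (hη : 0 < η) (hδ : 0 < δ)
    (hδ1 : δ < 1) (hlam : 0 < lambdaMin (gramInf m σ D))
    (hlamb : lambdaMin (gramInf m σ D) ≤ b ^ 2)
    (hw : 10 ^ 24 * b ^ 12 * widthBound d (n₁ + n₂) m (lambdaMin (gramInf m σ D)) η δ ≤ m) :
    ∃ E : Set ((Fin m → SpaceTime d) × (Fin m → ℝ)), MeasurableSet E ∧
      1 - δ ≤ (initLaw d m).real E ∧ ∀ ω ∈ E,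
        ∀ w : ℕ → Weights d m, w 0 = WithLp.toLp 2 ω.1 → IsIGD η (loss σ D ω.2) w →
          ∀ k : ℕ, loss σ D ω.2 (w k) ≤
            ((1 + η * lambdaMin (gramInf m σ D) / 2) ^ k)⁻¹ * loss σ D ω.2 (w 0) := by
  set lam := lambdaMin (gramInf m σ D) with hlamdef
  have hb1 : 1 ≤ b := hF.one_le
  have hd1 : (1 : ℝ) ≤ d := by exact_mod_cast hd
  have hm2 : (2 : ℝ) ≤ m := by exact_mod_cast hm
  have hm0 : (0 : ℝ) < m := by linarith
  have hcard : Fintype.card (Fin n₁ ⊕ Fin n₂) = n₁ + n₂ := by simp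
  have hN2 : (2 : ℝ) ≤ ((n₁ + n₂ : ℕ) : ℝ) := by exact_mod_cast (by omega : 2 ≤ n₁ + n₂)
  have hhalf : ∀ y : ℝ, 2 ≤ y → 1 / 2 ≤ Real.log (y / δ) := by
    intro y hy
    have h2 : Real.log 2 ≤ Real.log (y / δ) := by
      refine Real.log_le_log (by norm_num) ?_
      rw [le_div_iff₀ hδ]; nlinarith
    linarith [Real.log_two_gt_d9]
  obtain ⟨l, hl⟩ : ∃ l, l = Real.log (((n₁ + n₂ : ℕ) : ℝ) / δ) := ⟨_, rfl⟩
  obtain ⟨B, hB⟩ : ∃ B, B = Real.log ((m : ℝ) / δ) := ⟨_, rfl⟩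
  have hl2 : 1 / 2 ≤ l := hl ▸ hhalf _ hN2
  have hB2 : 1 / 2 ≤ B := hB ▸ hhalf _ hm2
  unfold widthBound at hw
  rw [← hl, ← hB] at hw
  have hmono : ∀ y, y ≤ max (η ^ 4 * (d : ℝ) ^ 2 * l) (max (1 / lam ^ 2 * B ^ 2)
      (η ^ 2 * B ^ 6 * l / lam ^ 2)) →
      10 ^ 24 * b ^ 12 * ((d : ℝ) ^ 8 / lam ^ 2 * l * y) ≤ m := by
    intro y hy
    refine le_trans ?_ hw
    gcongr
  -- The truncation level for which the loss allowed in `FeatureBound.truncGram_form_ge` is met with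
  -- equality.
  set V := √√(768000000 * b ^ 2 * (d : ℝ) ^ 6 / lam) with hV
  have hV0 : 0 < V := by rw [hV]; positivity
  have hV4 : lam * V ^ 4 = 768000000 * b ^ 2 * (d : ℝ) ^ 6 := by
    have : V ^ 4 = (V ^ 2) ^ 2 := by ring
    rw [this, hV, Real.sq_sqrt (Real.sqrt_nonneg _), Real.sq_sqrt (by positivity)]
    field_simp
  obtain ⟨r1, r2, r3, r4, r5, r6⟩ := lazy_regime (l := l) (B := B) (lam := lam) (V := V)
    hb1 hd1 hl2 hB2 hlam hlamb hη hm0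
    (hmono _ (le_max_left _ _)) (hmono _ ((le_max_left _ _).trans (le_max_right _ _)))
    (hmono _ ((le_max_right _ _).trans (le_max_right _ _))) rfl hV4 rfl
  have hG : ∀ x : EuclideanSpace ℝ (Fin n₁ ⊕ Fin n₂), lam * ‖x‖ ^ 2 ≤
      ∫ w, ‖∑ i, (x i * pinnWeight n₁ n₂ i) • pinnFeatureGrad σ D i w‖ ^ 2
        ∂stdGaussian (SpaceTime d) := by
    intro x
    have := lambdaMin_mul_le (gramInf_isHermitian (m := m) (σ := σ) (D := D)) x
    rw [gramInf_form h (by omega) hF] at this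
    simpa [PiLp.norm_sq_eq_of_L2] using this
  obtain ⟨E, hE, hEp, hEω⟩ := exists_good_event (m := m) hF (sum_pinnWeight_sq h₁ h₂).le ht hd hm
    (by rw [hcard]; omega) hδ hδ1 hlam hG hV0 hV4.ge (by rw [hcard, ← hl]; exact r1)
    (by rw [hcard, ← hl]; exact r2)
  refine ⟨E, hE, hEp, fun ω hω w hw0 hIGD k => ?_⟩
  obtain ⟨ha, hH, hA, hgram⟩ := hEω ω hω
  rw [loss_eq h] at hIGD ⊢
  refine featLoss_decay_of_featVec_decay hη hlam k ?_
  refine featVec_decay (H := 20 * d * B) (A := 68 * b * d * √l) (V := V) hF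
    (sum_pinnWeight_sq h₁ h₂).le ha (by omega) hη hlam hIGD
    (Finset.univ.filter fun r => 1 + ‖ω.1 r‖ ^ 2 ≤ V) ?_ ?_ ?_ ?_ rfl r3 r4 r5 r6 k
  · rw [hw0]; rw [hcard, ← hl] at hA; exact hA
  · rw [hw0, hB]; exact hH
  · rw [hw0]; intro r hr; exact (Finset.mem_filter.1 hr).2
  · rw [hw0]; exact hgram

end LimitGram

/-! ### The main theorem. -/

theorem theorem1 (c S M : ℝ) :
    -- the constant depends only on the parameters of the activation and on a bound for `f`, `g`
    ∃ C : ℝ, 0 < C ∧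
      ∀ (d n₁ n₂ : ℕ), 0 < d → 0 < n₁ → 0 < n₂ →
      ∀ (σ : ℝ → ℝ), ActivationAssumption σ c → |σ 0| ≤ S →
      ∀ (T : ℝ) (Ω : Set (EuclideanSpace ℝ (Fin d))), 0 < T → IsOpen Ω →
        (∀ x ∈ cylClosed T Ω, ‖x‖ ≤ 1) →
      ∀ (D : TrainingData d n₁ n₂),
        ContinuousOn D.f (cylInterior T Ω) → (∀ x ∈ cylInterior T Ω, |D.f x| ≤ M) →
        ContinuousOn D.g (cylBoundary T Ω) → (∀ y ∈ cylBoundary T Ω, |D.g y| ≤ M) →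
        (∀ p, D.x p ∈ cylInterior T Ω) → (∀ j, D.y j ∈ cylBoundary T Ω) →
        D.NonParallel →
      ∀ (m : ℕ) (η δ : ℝ), 2 ≤ m → 0 < η → 0 < δ → δ < 1 →
        0 < lambdaMin (gramInf m σ D) ∧
        (C * widthBound d (n₁ + n₂) m (lambdaMin (gramInf m σ D)) η δ ≤ m →
          ∃ E : Set ((Fin m → SpaceTime d) × (Fin m → ℝ)), MeasurableSet E ∧
            1 - δ ≤ (initLaw d m).real E ∧
            ∀ ω ∈ E,
              (∃ w : ℕ → Weights d m, w 0 = WithLp.toLp 2 ω.1 ∧ IsIGD η (loss σ D ω.2) w) ∧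
              ∀ w : ℕ → Weights d m, w 0 = WithLp.toLp 2 ω.1 → IsIGD η (loss σ D ω.2) w →
                ∀ k : ℕ, loss σ D ω.2 (w k) ≤
                  ((1 + η * lambdaMin (gramInf m σ D) / 2) ^ k)⁻¹ * loss σ D ω.2 (w 0)) := by
  -- A single constant dominates all the data; the feature bound is `b = 20κ`, whence `C = 10²⁴
  -- b¹²`.
  set κ := 1 + |c| + |S| + |M| with hκ
  have hκ1 : 1 ≤ κ := by rw [hκ]; linarith [abs_nonneg c, abs_nonneg S, abs_nonneg M]
  have hcκ : c ≤ κ := by linarith [le_abs_self c, abs_nonneg S, abs_nonneg M]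
  have hSκ : S ≤ κ := by linarith [le_abs_self S, abs_nonneg c, abs_nonneg M]
  have hMκ : M ≤ κ := by linarith [le_abs_self M, abs_nonneg c, abs_nonneg S]
  refine ⟨10 ^ 24 * (20 * κ) ^ 12, by positivity, ?_⟩
  intro d n₁ n₂ hd h₁ h₂ σ hσ hS T Ω hT _ hcyl D _ hf _ hg hx hy hD m η δ hm hη hδ hδ1
  have hsample : ∀ i, ‖D.sample i‖ ≤ 1 := by
    rintro (p | j)
    · exact hcyl _ (cylInterior_subset_cylClosed (hx p))
    · exact hcyl _ (cylBoundary_subset_cylClosed hT (hy j))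
  -- Each sample is paired with one from the other group, which exists as `n₁, n₂ ≥ 1`; members of
  -- an independent pair are nonzero.
  have hne : ∀ i, D.sample i ≠ 0 := by
    rintro (p | j)
    · exact (hD (Sum.inl p) (Sum.inr ⟨0, h₂⟩) Sum.inl_ne_inr).ne_zero 0
    · exact (hD (Sum.inr j) (Sum.inl ⟨0, h₁⟩) Sum.inr_ne_inl).ne_zero 0
  have hF := pinnFeature_bound hσ hκ1 hcκ (hS.trans hSκ) hsample
  have ht : ∀ i, |pinnTarget D i| ≤ 20 * κ := by
    rintro (p | j)
    · exact (hf _ (hx p)).trans (by linarith)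
    · exact (hg _ (hy j)).trans (by linarith)
  have hne' : Nonempty (Fin n₁ ⊕ Fin n₂) := ⟨Sum.inl ⟨0, h₁⟩⟩
  have hlam : 0 < lambdaMin (gramInf m σ D) :=
    lambdaMin_pos (gramInf_posDef hσ hd h₁ h₂ (by omega) hF hne hD)
  refine ⟨hlam, fun hwidth => ?_⟩
  have hlamb : lambdaMin (gramInf m σ D) ≤ (20 * κ) ^ 2 :=
    (lambdaMin_gramInf_le hσ hcκ h₂ (by omega) hF hsample).trans (by gcongr; linarith)
  obtain ⟨E, hE, hEp, hEω⟩ :=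
    exists_event_loss_decay hσ hd h₁ h₂ hF ht hm hη hδ hδ1 hlam hlamb hwidth
  refine ⟨E, hE, hEp, fun ω hω => ⟨?_, hEω ω hω⟩⟩
  -- Runs exist from every initialization, not only on `E`: the proximal objective is continuous and
  -- coercive.
  refine exists_isIGD (g := featLossGrad (pinnWeight n₁ n₂) (pinnTarget D) (pinnFeature σ D)
    (pinnFeatureGrad σ D) ω.2) (fun w => ?_) (fun w => ?_) hη _
  · rw [loss_eq hσ]; exact hasGradientAt_featLoss hF w
  · rw [loss_eq hσ]; exact featLoss_nonneg w
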